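/- **Theorem 1.1 (Global existence).** Let $\mathbb H^2$ be the hyperbolic plane with a fixed origin $O$, write $|x|=d(x,O)$ and $\langle s\rangle=(1+s^2)^{1/2}$, and for $k>0$ put $\theta_k(x)=(\cosh|x|)^{-k-1/2}$. Let $p>3$, $k>0$, $C\in\mathbb R$ and $0<\delta<1$. Then there are $h\in(1,p-2)$, $\varepsilon_0>0$ and $N>0$, depending only on $p,k,C,\delta$, such that the following holds. Let $F_p\in C^1(\mathbb R)$ satisfy $F_p(0)=F_p'(0)=0$ and $$|F_p'(v)|\le C\Big(\ln\frac1{|v|}\Big)^{1-p}\qquad\text{for } 0<|v|<\delta ,$$ and let $(u_0,u_1)\in C^1(\mathbb H^2)\times C(\mathbb H^2)$ satisfy $$|u_0|+|u_1|+|\nabla u_0|\le\theta_k\quad\text{on }\mathbb H^2 ,$$ where $|\nabla u_0|$ is the Riemannian length of the gradient. Then for every real $\varepsilon$ with $|\varepsilon|<\varepsilon_0$ the Cauchy problem $$\partial_t^2u-\big(\Delta_{\mathbb H^2}+\tfrac14\big)u=F_p(u)\ \text{ on }\mathbb R\times\mathbb H^2,\qquad u(0,\cdot)=\varepsilon u_0,\quad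 \partial_tu(0,\cdot)=\varepsilon u_1,$$ has a global weak solution $u\in C(\mathbb R\times\mathbb H^2)$, and this solution satisfies $$e^{|x|/2}\,\big\langle |t|-|x|\big\rangle^{h}\,|u(t,x)|\le N|\varepsilon|\qquad\text{for all }(t,x)\in\mathbb R\times\mathbb H^2 .$$ Here a weak solution is a continuous $u$ with $u(0,\cdot)=\varepsilon u_0$ such that, for every $\varphi\in C_c^\infty(\mathbb R\times\mathbb H^2)$ and both signs $\pm$, with $dx$ the Riemannian measure, $$\int_{\pm t>0}\int_{\mathbb H^2}u\,\big(\partial_t^2\varphi-\Delta_{\mathbb H^2}\varphi-\tfrac14\varphi\big)\,dx\,dt=\int_{\pm t>0}\int_{\mathbb H^2}F_p(u)\,\varphi\,dx\,dt\pm\varepsilon\int_{\mathbb H^2}\big(u_1\,\varphi(0,\cdot)-u_0\,\partial_t\varphi(0,\cdot)\big)\,dx .$$ -/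

import Mathlib

open MeasureTheory Set UpperHalfPlane
open scoped ContDiff Laplacian

noncomputable section

namespace HypWave

/-!
The hyperbolic plane `ℍ²` is Mathlib's upper half plane `ℍ` with metric `(dx² + dy²) / y²`: its
distance `dist` and its Riemannian measure `volume` (that is, `dx dy / y²`) are Mathlib's.  The
origin `O` is the point `I`, and `z ↦ (z : ℂ)` is a global chart of `ℍ` with image `{w | 0 < w.im}`
and inverse `ofComplex`.
-/

/-- Geodesic distance `|z|` of `z` to the origin. -/
def radius (z : ℍ) : ℝ := dist z UpperHalfPlane.I

/-- The function `f` on the hyperbolic plane, read in the global chart. -/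
def inChart (f : ℍ → ℝ) : ℂ → ℝ := fun w => f (ofComplex w)

/-- `f ∈ C¹(ℍ²)`. -/
def IsC1 (f : ℍ → ℝ) : Prop := ContDiffOn ℝ 1 (inChart f) {w : ℂ | 0 < w.im}

/-- The Riemannian length `|∇ f|` of the gradient: for the metric `(dx² + dy²) / y²` it is `y` times
the Euclidean length of the differential. -/
def gradNorm (f : ℍ → ℝ) (z : ℍ) : ℝ := z.im * ‖fderiv ℝ (inChart f) (z : ℂ)‖

/-- The Laplace-Beltrami operator `y² (∂ₓ² + ∂_y²)` of the hyperbolic plane. -/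
def laplaceBeltrami (f : ℍ → ℝ) (z : ℍ) : ℝ := z.im ^ 2 * (Δ (inChart f)) (z : ℂ)

/-- The shifted wave operator `∂ₜ² φ - (Δ + 1/4) φ`. -/
def waveOp (φ : ℝ → ℍ → ℝ) (t : ℝ) (z : ℍ) : ℝ :=
  iteratedDeriv 2 (fun s => φ s z) t - (laplaceBeltrami (φ t) z + 1 / 4 * φ t z)

/-- `φ ∈ C_c^∞(ℝ × ℍ²)`. -/
structure IsTestFunction (φ : ℝ → ℍ → ℝ) : Prop where
  smooth : ContDiffOn ℝ ∞ (fun q : ℝ × ℂ => φ q.1 (ofComplex q.2)) {q : ℝ × ℂ | 0 < q.2.im}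
  compact : HasCompactSupport (Function.uncurry φ)

/-- `u ∈ C(ℝ × ℍ²)` is a global weak solution of
`∂ₜ² u - (Δ + 1/4) u = F(u)`, `u(0, ·) = f`, `∂ₜ u(0, ·) = g`:
the equation and the initial values hold in the sense of distributions (after integration by parts
against test functions), forward and backward in time.  As test functions need not vanish at
`t = 0`, the terms there carry the initial data. -/
structure IsGlobalWeakSolution (F : ℝ → ℝ) (f g : ℍ → ℝ) (u : ℝ → ℍ → ℝ) : Prop where
  continuous : Continuous (Function.uncurry u)
  initial : ∀ z, u 0 z = f z
  forward : ∀ φ : ℝ → ℍ → ℝ, IsTestFunction φ →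
    ∫ t in Ioi (0 : ℝ), ∫ z : ℍ, u t z * waveOp φ t z =
      (∫ t in Ioi (0 : ℝ), ∫ z : ℍ, F (u t z) * φ t z) +
        ∫ z : ℍ, (g z * φ 0 z - f z * deriv (fun s => φ s z) 0)
  backward : ∀ φ : ℝ → ℍ → ℝ, IsTestFunction φ →
    ∫ t in Iio (0 : ℝ), ∫ z : ℍ, u t z * waveOp φ t z =
      (∫ t in Iio (0 : ℝ), ∫ z : ℍ, F (u t z) * φ t z) -
        ∫ z : ℍ, (g z * φ 0 z - f z * deriv (fun s => φ s z) 0)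

/-- `θ_k = (cosh |z|)^(-k - 1/2)`. -/
def theta (k : ℝ) (z : ℍ) : ℝ := Real.cosh (radius z) ^ (-k - 1 / 2)

/-- Initial data in `C¹ × C` with `|u₀| + |u₁| + |∇ u₀| ≤ θ_k`. -/
structure IsAdmissibleData (k : ℝ) (u₀ u₁ : ℍ → ℝ) : Prop where
  c1 : IsC1 u₀
  continuous : Continuous u₁
  bound : ∀ z, |u₀ z| + |u₁ z| + gradNorm u₀ z ≤ theta k z

/-- `F ∈ C¹`, `F(0) = F'(0) = 0` and `|F'(v)| ≤ C (ln (1/|v|))^(1-p)` for `0 < |v| < δ`. -/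
structure IsLogNonlinearity (p C δ : ℝ) (F : ℝ → ℝ) : Prop where
  c1 : ContDiff ℝ 1 F
  zero : F 0 = 0
  deriv_zero : deriv F 0 = 0
  deriv_bound : ∀ v, 0 < |v| → |v| < δ → |deriv F v| ≤ C * Real.log (1 / |v|) ^ (1 - p)

/-- The weight `e^(r/2) ⟨t - r⟩^h`, with `⟨s⟩ = (1 + s²)^(1/2)`. -/
def weight (h t r : ℝ) : ℝ := Real.exp (r / 2) * Real.sqrt (1 + (t - r) ^ 2) ^ h

end HypWave

end

noncomputable section

namespace HypWave

open Filter Topology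
open scoped ENNReal NNReal

/-! ### Calculus preliminaries -/

/-! The solution is the fixed point of Duhamel's formula in the sup norm weighted by `weight h`.
This needs an explicit form of the propagator `sin (t √A) / √A`, `A = -(Δ + 1/4)`, and weighted
bounds for it.

Formula. Write a point as `a + exp σ i` and put `v = exp (-σ / 2) u`. The shifted wave operator
becomes `∂ₜ² - ∂_σ² - e^(2σ) ∂ₐ²`. The kernel of the propagator is a multiple of `(cosh t - cosh
d)^(-1/2)` on the disc `d < t`. On each horocycle the radicand is a quadratic polynomial in `a`, so
a substitution by `sin φ` removes the singularity, and `propagator` is `t / (2π)` times an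
unweighted integral of `v` over a fixed box of parameters. Characteristic coordinates show that it
recovers a test function from its wave operator (`integral_propagator_conjWave`). The maps `node t ·
k` preserve Lebesgue measure and have inverses `node t · (-k)`, so the propagator is symmetric
(`integral_propagator_mul`). By duality every continuous mild solution is a weak solution
(`weak_form`), with no further regularity of `u`.

The propagator is also the integral against `diskMeasure`, whose density depends on the distance
alone, so it commutes with isometries. Two consequences are used. In geodesic polar coordinates
about the centre it can be differentiated in `t` for `C¹` data, and since the moving points have
hyperbolic speed at most one, `|∇ u₀|` controls the result. For radial bounds the centre may be
rotated to the point `exp (-r) i`.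

Decay. From that centre, let `c` be minus the logarithm of the height of a point of the disc and `ρ
≥ |c|` its radius. The factor `exp (-(ρ - c) / 4)` is bounded by an integrable power of `|sin φ|`
times an exponential gain in `c`. Hence a radial majorant of size `exp (-ρ / 2)` leads to a
one-dimensional integral in `c`, with `exp (r / 2)` already absorbed
(`lintegral_diskMeasure_radial_le`).

Nonlinearity. If `|u| ≤ exp (-(A + ρ / 2))`, then `ln (1 / |u|) ≥ A + ρ / 2`, and `F` has Lipschitz
constant at most `|C| (A + ρ / 2)^(1 - p)` there: the logarithm turns exponential decay in space
into a polynomial weight. For `h = (p - 1) / 2` this is the power `-2h`. A power `h` restores the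
bracket `⟨t - r⟩`, a power `(h + 1) / 2 > 1` makes the `c`-integral converge, and `(h - 1) / 2 > 0`
remains as the factor `A^(-(h - 1) / 2)`. Both inequalities are `p > 3`. A large `A` gives a
contraction, and small `ε` only serves to keep `|u|` below `exp (-(A + ρ / 2))`. Negative times
follow by reversing time and gluing at `t = 0`. -/

theorem hasDerivAt_setIntegral_of_isCompact {α : Type*} [TopologicalSpace α] [MeasurableSpace α]
    [OpensMeasurableSpace α] [SecondCountableTopology α] [T2Space α]
    {μ : Measure α} [IsFiniteMeasureOnCompacts μ]
    {K : Set α} (hK : IsCompact K) {U : Set ℝ} (hU : IsOpen U) {F F' : ℝ → α → ℝ}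
    (hF : ContinuousOn (Function.uncurry F) (U ×ˢ K))
    (hF' : ContinuousOn (Function.uncurry F') (U ×ˢ K))
    (hd : ∀ x ∈ U, ∀ a ∈ K, HasDerivAt (fun y => F y a) (F' x a) x) {x₀ : ℝ} (hx₀ : x₀ ∈ U) :
    HasDerivAt (fun x => ∫ a in K, F x a ∂μ) (∫ a in K, F' x₀ a ∂μ) x₀ := by
  obtain ⟨s, hs, hsU, hsc⟩ := local_compact_nhds (hU.mem_nhds hx₀)
  obtain ⟨B, hB⟩ := ((hsc.prod hK).image_of_continuousOn
    (hF'.mono (Set.prod_mono hsU subset_rfl))).isBounded.exists_norm_le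
  have hslice : ∀ {G : ℝ → α → ℝ}, ContinuousOn (Function.uncurry G) (U ×ˢ K) → ∀ x ∈ U,
      ContinuousOn (G x) K := fun hG x hx =>
    hG.comp (by fun_prop : ContinuousOn (fun a => (x, a)) K) (fun a ha => ⟨hx, ha⟩)
  have hmeas : ∀ {G : ℝ → α → ℝ}, ContinuousOn (Function.uncurry G) (U ×ˢ K) → ∀ x ∈ U,
      AEStronglyMeasurable (G x) (μ.restrict K) := fun hG x hx =>
    (hslice hG x hx).aestronglyMeasurable_of_isCompact hK hK.measurableSet
  refine (hasDerivAt_integral_of_dominated_loc_of_deriv_le (μ := μ.restrict K) (F' := F')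
    (bound := fun _ => B) hs ?_ ?_ (hmeas hF' x₀ hx₀) ?_ ?_ ?_).2
  · filter_upwards [hU.mem_nhds hx₀] with x hx using hmeas hF x hx
  · exact (hslice hF x₀ hx₀).integrableOn_compact hK
  · filter_upwards [ae_restrict_mem hK.measurableSet] with a ha x hx
    exact hB _ ⟨(x, a), ⟨hx, ha⟩, rfl⟩
  · exact integrableOn_const hK.measure_ne_top
  · filter_upwards [ae_restrict_mem hK.measurableSet] with a ha x hx using hd x (hsU hx) a ha

theorem hasDerivAt_intervalIntegral_of_continuousOn {a b : ℝ} (hab : a ≤ b) {U : Set ℝ}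
    (hU : IsOpen U) {F F' : ℝ → ℝ → ℝ}
    (hF : ContinuousOn (Function.uncurry F) (U ×ˢ Icc a b))
    (hF' : ContinuousOn (Function.uncurry F') (U ×ˢ Icc a b))
    (hd : ∀ x ∈ U, ∀ s ∈ Icc a b, HasDerivAt (fun y => F y s) (F' x s) x) {x₀ : ℝ}
    (hx₀ : x₀ ∈ U) :
    HasDerivAt (fun x => ∫ s in a..b, F x s) (∫ s in a..b, F' x₀ s) x₀ := by
  simp only [intervalIntegral.integral_of_le hab, ← integral_Icc_eq_integral_Ioc]
  exact hasDerivAt_setIntegral_of_isCompact isCompact_Icc hU hF hF' hd hx₀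

section DirDeriv

variable {E : Type*} [NormedAddCommGroup E] [NormedSpace ℝ E]

/-- The derivative of `f` in the direction `e`. -/
def dirDeriv (e : E) (f : E → ℝ) (p : E) : ℝ := fderiv ℝ f p e

theorem contDiff_dirDeriv {f : E → ℝ} (hf : ContDiff ℝ ∞ f) (e : E) :
    ContDiff ℝ ∞ (dirDeriv e f) := by
  have : ContDiff ℝ ∞ (fderiv ℝ f) := hf.fderiv_right (by simp)
  exact this.clm_apply contDiff_const

theorem hasCompactSupport_dirDeriv {f : E → ℝ} (hf : HasCompactSupport f) (e : E) :
    HasCompactSupport (dirDeriv e f) := hf.fderiv_apply ℝ e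

theorem dirDeriv_comm {f : E → ℝ} (hf : ContDiff ℝ ∞ f) (e e' : E) :
    dirDeriv e (dirDeriv e' f) = dirDeriv e' (dirDeriv e f) := by
  ext p
  have hd : Differentiable ℝ (fderiv ℝ f) := 
    ((hf.fderiv_right (m := ∞) (by simp)).differentiable (by simp))
  have key : ∀ e e' : E, dirDeriv e (dirDeriv e' f) p = fderiv ℝ (fderiv ℝ f) p e e' := by
    intro e e'
    have h := (hd p).hasFDerivAt.clm_apply (hasFDerivAt_const e' p)
    unfold dirDeriv
    rw [h.fderiv]
    simp
  have hs := (hf.contDiffAt (x := p)).isSymmSndFDerivAt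
    (by simp only [minSmoothness_of_isRCLikeNormedField]; exact WithTop.coe_le_coe.2 (le_top : (2 : ℕ∞) ≤ ⊤))
  rw [key, key, hs.eq]

theorem dirDeriv_comp_hasDerivAt {f : E → ℝ} (hf : ContDiff ℝ ∞ f) {γ : ℝ → E} {v : E} {t : ℝ}
    (hγ : HasDerivAt γ v t) : HasDerivAt (fun s => f (γ s)) (dirDeriv v f (γ t)) t :=
  ((hf.differentiable (by simp)) (γ t)).hasFDerivAt.comp_hasDerivAt t hγ

theorem dirDeriv_add (e e' : E) (f : E → ℝ) (p : E) :
    dirDeriv (e + e') f p = dirDeriv e f p + dirDeriv e' f p := map_add _ _ _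

theorem dirDeriv_smul (c : ℝ) (e : E) (f : E → ℝ) (p : E) :
    dirDeriv (c • e) f p = c * dirDeriv e f p := by simp [dirDeriv]

end DirDeriv

/-! ### Coordinates of `ℝ × ℝ × ℝ` -/

abbrev e₁ : ℝ × ℝ × ℝ := (1, 0, 0)
abbrev e₂ : ℝ × ℝ × ℝ := (0, 1, 0)
abbrev e₃ : ℝ × ℝ × ℝ := (0, 0, 1)

theorem hasDerivAt_comp_triple {f : ℝ × ℝ × ℝ → ℝ} (hf : ContDiff ℝ ∞ f) {a b c : ℝ → ℝ}
    {a' b' c' t : ℝ} (ha : HasDerivAt a a' t) (hb : HasDerivAt b b' t) (hc : HasDerivAt c c' t) :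
    HasDerivAt (fun s => f (a s, b s, c s)) (a' * dirDeriv e₁ f (a t, b t, c t) +
      b' * dirDeriv e₂ f (a t, b t, c t) + c' * dirDeriv e₃ f (a t, b t, c t)) t := by
  convert dirDeriv_comp_hasDerivAt hf (ha.prodMk (hb.prodMk hc)) using 1
  have : ((a', b', c') : ℝ × ℝ × ℝ) = a' • e₁ + b' • e₂ + c' • e₃ := by simp
  rw [this, dirDeriv_add, dirDeriv_add, dirDeriv_smul, dirDeriv_smul, dirDeriv_smul]

theorem eq_zero_of_hasCompactSupport {f : ℝ × ℝ × ℝ → ℝ} (hf : HasCompactSupport f) :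
    ∃ R > 0, ∀ a b c, (R < |a| ∨ R < |b| ∨ R < |c|) → f (a, b, c) = 0 := by
  obtain ⟨R, hR, h⟩ := hf.isBounded.exists_pos_norm_le
  refine ⟨R, hR, fun a b c habc => ?_⟩
  by_contra hne
  have := h (a, b, c) (subset_tsupport f hne)
  simp only [Prod.norm_def, Real.norm_eq_abs, sup_le_iff] at this
  grind

/-! ### The characteristic form of the representation formula -/

/-- Half the width, at characteristic times `μ`, `ν`, of the light cone. -/
def coneWidth (μ ν : ℝ) : ℝ := √((1 - Real.exp (-μ)) * (Real.exp ν - 1))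

theorem continuous_coneWidth : Continuous fun p : ℝ × ℝ => coneWidth p.1 p.2 := by
  unfold coneWidth; fun_prop

/-- Integration by parts with `-cos`, which vanishes at both ends. The factor `m` gained here
cancels the reciprocal width that appears when the width of the cone is differentiated. -/
theorem integral_sin_mul_comp (m : ℝ) {f f' : ℝ → ℝ} (hf : ∀ x, HasDerivAt f (f' x) x)
    (hf' : Continuous f') :
    ∫ φ in -(Real.pi / 2)..Real.pi / 2, Real.sin φ * f (m * Real.sin φ) =
      m * ∫ φ in -(Real.pi / 2)..Real.pi / 2, Real.cos φ ^ 2 * f' (m * Real.sin φ) := by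
  have hc : Continuous f := continuous_iff_continuousAt.2 fun x => (hf x).continuousAt
  have h := intervalIntegral.integral_mul_deriv_eq_deriv_mul (a := -(Real.pi / 2))
    (b := Real.pi / 2) (u := fun φ => f (m * Real.sin φ))
    (u' := fun φ => f' (m * Real.sin φ) * (m * Real.cos φ)) (v := fun φ => -Real.cos φ)
    (v' := fun φ => Real.sin φ)
    (fun x _ => (hf _).comp x ((Real.hasDerivAt_sin x).const_mul m))
    (fun x _ => by simpa using (Real.hasDerivAt_cos x).fun_neg)
    (Continuous.intervalIntegrable (by fun_prop) _ _)
    (Continuous.intervalIntegrable (by fun_prop) _ _)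
  simp only [Real.cos_neg, Real.cos_pi_div_two, neg_zero, mul_zero, sub_self, zero_sub] at h
  rw [← intervalIntegral.integral_const_mul, ← intervalIntegral.integral_neg] at *
  rw [intervalIntegral.integral_congr (g := fun φ => f (m * Real.sin φ) * Real.sin φ)
    (fun φ _ => mul_comm _ _), h]
  refine intervalIntegral.integral_congr fun φ _ => ?_
  ring

/-- Integration by parts with `sin φ cos φ`, which vanishes at both ends and has derivative `2 cos²
φ - 1`, up to sign the combination on the right. -/
theorem integral_cos_sq_sin_mul_comp (m : ℝ) {f f' : ℝ → ℝ} (hf : ∀ x, HasDerivAt f (f' x) x)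
    (hf' : Continuous f') :
    m * ∫ φ in -(Real.pi / 2)..Real.pi / 2, Real.cos φ ^ 2 * Real.sin φ * f' (m * Real.sin φ) =
      (∫ φ in -(Real.pi / 2)..Real.pi / 2, f (m * Real.sin φ)) -
        2 * ∫ φ in -(Real.pi / 2)..Real.pi / 2, Real.cos φ ^ 2 * f (m * Real.sin φ) := by
  have hc : Continuous f := continuous_iff_continuousAt.2 fun x => (hf x).continuousAt
  have h := intervalIntegral.integral_mul_deriv_eq_deriv_mul (a := -(Real.pi / 2))
    (b := Real.pi / 2) (v := fun φ => f (m * Real.sin φ))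
    (v' := fun φ => f' (m * Real.sin φ) * (m * Real.cos φ))
    (u := fun φ => Real.sin φ * Real.cos φ)
    (u' := fun φ => Real.cos φ * Real.cos φ + Real.sin φ * (-Real.sin φ))
    (fun x _ => (Real.hasDerivAt_sin x).mul (Real.hasDerivAt_cos x))
    (fun x _ => (hf _).comp x ((Real.hasDerivAt_sin x).const_mul m))
    (Continuous.intervalIntegrable (by fun_prop) _ _)
    (Continuous.intervalIntegrable (by fun_prop) _ _)
  simp only [Real.cos_neg, Real.cos_pi_div_two, mul_zero, zero_mul, sub_self, zero_sub] at h
  rw [← intervalIntegral.integral_const_mul]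
  rw [intervalIntegral.integral_congr (g := fun φ => Real.sin φ * Real.cos φ *
    (f' (m * Real.sin φ) * (m * Real.cos φ))) (fun φ _ => by ring), h]
  rw [← intervalIntegral.integral_const_mul, ← intervalIntegral.integral_sub
    (Continuous.intervalIntegrable (by fun_prop) _ _)
    (Continuous.intervalIntegrable (by fun_prop) _ _), ← intervalIntegral.integral_neg]
  refine intervalIntegral.integral_congr fun φ _ => ?_
  have := Real.sin_sq_add_cos_sq φ
  linear_combination f (m * Real.sin φ) * this

section Cone

variable {g : ℝ × ℝ × ℝ → ℝ}

theorem hasDerivAt_third (hg : ContDiff ℝ ∞ g) (a b x : ℝ) :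
    HasDerivAt (fun y => g (a, b, y)) (dirDeriv e₃ g (a, b, x)) x := by
  simpa using hasDerivAt_comp_triple hg (hasDerivAt_const x a) (hasDerivAt_const x b)
    (hasDerivAt_id x)

theorem hasDerivAt_coneWidth_right {μ ν : ℝ} (hμ : 0 < μ) (hν : 0 < ν) :
    HasDerivAt (fun s => coneWidth μ s)
      ((1 - Real.exp (-μ)) * Real.exp ν / (2 * coneWidth μ ν)) ν := by
  have h1 : 0 < 1 - Real.exp (-μ) := by simpa using hμ
  have h2 : 0 < Real.exp ν - 1 := by simpa using hν
  have := ((((Real.hasDerivAt_exp ν).sub_const 1).const_mul (1 - Real.exp (-μ)))).sqrt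
    (by positivity)
  exact this

theorem hasDerivAt_coneWidth_left {μ ν : ℝ} (hμ : 0 < μ) (hν : 0 < ν) :
    HasDerivAt (fun s => coneWidth s ν)
      (Real.exp (-μ) * (Real.exp ν - 1) / (2 * coneWidth μ ν)) μ := by
  have h1 : 0 < 1 - Real.exp (-μ) := by simpa using hμ
  have h2 : 0 < Real.exp ν - 1 := by simpa using hν
  have h0 : HasDerivAt (fun s : ℝ => 1 - Real.exp (-s)) (Real.exp (-μ)) μ := by
    have := ((hasDerivAt_neg μ).exp).const_sub 1
    simpa using this
  exact (h0.mul_const (Real.exp ν - 1)).sqrt (by positivity)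

theorem coneWidth_pos {μ ν : ℝ} (hμ : 0 < μ) (hν : 0 < ν) : 0 < coneWidth μ ν := by
  have h1 : 0 < 1 - Real.exp (-μ) := by simpa using hμ
  have h2 : 0 < Real.exp ν - 1 := by simpa using hν
  unfold coneWidth
  positivity

theorem coneWidth_sq {μ ν : ℝ} (hμ : 0 < μ) (hν : 0 < ν) :
    coneWidth μ ν ^ 2 = (1 - Real.exp (-μ)) * (Real.exp ν - 1) := by
  have h1 : 0 < 1 - Real.exp (-μ) := by simpa using hμ
  have h2 : 0 < Real.exp ν - 1 := by simpa using hν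
  unfold coneWidth
  rw [Real.sq_sqrt (by positivity)]

/-- Weighted mean of `g` over a horizontal section of the cone. -/
def coneMean (w : ℝ → ℝ) (g : ℝ × ℝ × ℝ → ℝ) (μ ν : ℝ) : ℝ :=
  ∫ φ in -(Real.pi / 2)..Real.pi / 2, w φ * g (μ, ν, coneWidth μ ν * Real.sin φ)

theorem continuous_coneMean (hg : Continuous g) {w : ℝ → ℝ} (hw : Continuous w) :
    Continuous fun p : ℝ × ℝ => coneMean w g p.1 p.2 := by
  have := continuous_coneWidth
  unfold coneMean
  apply intervalIntegral.continuous_parametric_intervalIntegral_of_continuous'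
  simp only [Function.uncurry_def]
  have h2 : Continuous fun p : (ℝ × ℝ) × ℝ => coneWidth p.1.1 p.1.2 := this.comp continuous_fst
  fun_prop

theorem coneMean_eq_zero (w : ℝ → ℝ) {R : ℝ}
    (h : ∀ a b c, (R < |a| ∨ R < |b| ∨ R < |c|) → g (a, b, c) = 0) {μ ν : ℝ}
    (hμν : R < |μ| ∨ R < |ν|) : coneMean w g μ ν = 0 := by
  unfold coneMean
  rw [intervalIntegral.integral_congr (g := fun _ => 0)]
  · simp
  · intro φ _
    simp only
    rw [h _ _ _ (by tauto), mul_zero]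

/-- The derivative of the width blows up like the reciprocal of the width, but it multiplies an
integral of `sin φ` times a smooth function, which by `integral_sin_mul_comp` carries a factor of
the width. A second transverse derivative results. -/
theorem hasDerivAt_coneMean_right (hg : ContDiff ℝ ∞ g) {μ ν : ℝ} (hμ : 0 < μ) (hν : 0 < ν) :
    HasDerivAt (fun s => coneMean 1 g μ s)
      (coneMean 1 (dirDeriv e₂ g) μ ν + (1 - Real.exp (-μ)) * Real.exp ν / 2 *
        coneMean (fun φ => Real.cos φ ^ 2) (dirDeriv e₃ (dirDeriv e₃ g)) μ ν) ν := by
  have hc : Continuous g := hg.continuous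
  have hc2 : Continuous (dirDeriv e₂ g) := (contDiff_dirDeriv hg _).continuous
  have hc3 : Continuous (dirDeriv e₃ g) := (contDiff_dirDeriv hg _).continuous
  have hc33 : Continuous (dirDeriv e₃ (dirDeriv e₃ g)) :=
    (contDiff_dirDeriv (contDiff_dirDeriv hg _) _).continuous
  have hw : Continuous fun s : ℝ => coneWidth μ s :=
    continuous_coneWidth.comp (by fun_prop : Continuous fun s : ℝ => (μ, s))
  have hw2 : Continuous fun s : ℝ × ℝ => coneWidth μ s.1 := hw.comp continuous_fst
  have h := hasDerivAt_intervalIntegral_of_continuousOn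
    (a := -(Real.pi / 2)) (b := Real.pi / 2) (by linarith [Real.pi_pos]) isOpen_Ioi
    (F := fun s φ => (1 : ℝ → ℝ) φ * g (μ, s, coneWidth μ s * Real.sin φ))
    (F' := fun s φ => dirDeriv e₂ g (μ, s, coneWidth μ s * Real.sin φ) +
      (1 - Real.exp (-μ)) * Real.exp s / (2 * coneWidth μ s) * (Real.sin φ *
        dirDeriv e₃ g (μ, s, coneWidth μ s * Real.sin φ))) (U := Ioi 0)
    ?_ ?_ ?_ hν
  · refine h.congr_deriv ?_
    have i1 : Continuous fun φ => dirDeriv e₂ g (μ, ν, coneWidth μ ν * Real.sin φ) := by fun_prop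
    have i2 : Continuous fun φ => Real.sin φ *
      dirDeriv e₃ g (μ, ν, coneWidth μ ν * Real.sin φ) := by fun_prop
    rw [intervalIntegral.integral_add (i1.intervalIntegrable _ _)
      ((i2.const_mul _).intervalIntegrable _ _), intervalIntegral.integral_const_mul,
      integral_sin_mul_comp (coneWidth μ ν)
        (fun x => hasDerivAt_third (contDiff_dirDeriv hg e₃) μ ν x) (by fun_prop)]
    have := (coneWidth_pos hμ hν).ne'
    simp only [coneMean, Pi.one_apply, one_mul]
    field_simp
  · simp only [Function.uncurry_def, Pi.one_apply, one_mul]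
    fun_prop
  · simp only [Function.uncurry_def]
    refine ContinuousOn.add (by fun_prop) (ContinuousOn.mul (ContinuousOn.div (by fun_prop)
      (by fun_prop) ?_) (by fun_prop))
    rintro ⟨s, φ⟩ ⟨hs, -⟩
    have := coneWidth_pos hμ hs
    positivity
  · intro s hs φ _
    have := hasDerivAt_comp_triple hg (hasDerivAt_const s μ) (hasDerivAt_id s)
      ((hasDerivAt_coneWidth_right hμ hs).mul_const (Real.sin φ))
    simp only [Pi.one_apply, one_mul]
    refine this.congr_deriv ?_
    simp only [id]
    ring

/-- The prefactor is chosen so that the `cos²` mean coming from its own derivative cancels the one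
produced by `integral_cos_sq_sin_mul_comp`. It also vanishes at `s = 0`, so that no boundary term
arises there later. -/
theorem hasDerivAt_coneMean_left (hg : ContDiff ℝ ∞ g) {μ ν : ℝ} (hμ : 0 < μ) (hν : 0 < ν) :
    HasDerivAt (fun s => (1 - Real.exp (-s)) * Real.exp ν *
        coneMean (fun φ => Real.cos φ ^ 2) g s ν)
      (Real.exp (ν - μ) / 2 * coneMean 1 g μ ν + (1 - Real.exp (-μ)) * Real.exp ν *
        coneMean (fun φ => Real.cos φ ^ 2) (dirDeriv e₁ g) μ ν) μ := by
  have hc : Continuous g := hg.continuous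
  have hc1 : Continuous (dirDeriv e₁ g) := (contDiff_dirDeriv hg _).continuous
  have hc3 : Continuous (dirDeriv e₃ g) := (contDiff_dirDeriv hg _).continuous
  have hw : Continuous fun s : ℝ => coneWidth s ν :=
    continuous_coneWidth.comp (by fun_prop : Continuous fun s : ℝ => (s, ν))
  have hw2 : Continuous fun s : ℝ × ℝ => coneWidth s.1 ν := hw.comp continuous_fst
  have hpos := coneWidth_pos hμ hν
  have h := hasDerivAt_intervalIntegral_of_continuousOn
    (a := -(Real.pi / 2)) (b := Real.pi / 2) (by linarith [Real.pi_pos]) isOpen_Ioi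
    (F := fun s φ => Real.cos φ ^ 2 * g (s, ν, coneWidth s ν * Real.sin φ))
    (F' := fun s φ => Real.cos φ ^ 2 * dirDeriv e₁ g (s, ν, coneWidth s ν * Real.sin φ) +
      Real.exp (-s) * (Real.exp ν - 1) / (2 * coneWidth s ν) * (Real.cos φ ^ 2 * Real.sin φ *
        dirDeriv e₃ g (s, ν, coneWidth s ν * Real.sin φ))) (U := Ioi 0)
    ?_ ?_ ?_ hμ
  · have h0 : HasDerivAt (fun s : ℝ => (1 - Real.exp (-s)) * Real.exp ν)
        (Real.exp (-μ) * Real.exp ν) μ := by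
      have := (((hasDerivAt_neg μ).exp).const_sub 1).mul_const (Real.exp ν)
      simpa using this
    refine (h0.mul h).congr_deriv ?_
    have i1 : Continuous fun φ => Real.cos φ ^ 2 *
      dirDeriv e₁ g (μ, ν, coneWidth μ ν * Real.sin φ) := by fun_prop
    have i2 : Continuous fun φ => Real.cos φ ^ 2 * Real.sin φ *
      dirDeriv e₃ g (μ, ν, coneWidth μ ν * Real.sin φ) := by fun_prop
    have i3 : Continuous fun φ => Real.cos φ ^ 2 *
      g (μ, ν, coneWidth μ ν * Real.sin φ) := by fun_prop
    have i4 : Continuous fun φ => g (μ, ν, coneWidth μ ν * Real.sin φ) := by fun_prop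
    have key := integral_cos_sq_sin_mul_comp (coneWidth μ ν)
        (fun x => hasDerivAt_third hg μ ν x) (by fun_prop)
    rw [intervalIntegral.integral_add (i1.intervalIntegrable _ _)
      ((i2.const_mul _).intervalIntegrable _ _), intervalIntegral.integral_const_mul]
    simp only [coneMean, Pi.one_apply, one_mul]
    set X := ∫ φ in -(Real.pi / 2)..Real.pi / 2, Real.cos φ ^ 2 * Real.sin φ *
      dirDeriv e₃ g (μ, ν, coneWidth μ ν * Real.sin φ)
    have e1 : (1 - Real.exp (-μ)) * Real.exp ν *
        (Real.exp (-μ) * (Real.exp ν - 1) / (2 * coneWidth μ ν) * X) =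
        Real.exp (-μ) * Real.exp ν / 2 * (coneWidth μ ν * X) := by
      have := coneWidth_sq hμ hν
      field_simp
      rw [this]
    rw [mul_add, e1, key, show ν - μ = -μ + ν by ring, Real.exp_add]
    ring
  · simp only [Function.uncurry_def]
    fun_prop
  · simp only [Function.uncurry_def]
    refine ContinuousOn.add (by fun_prop) (ContinuousOn.mul (ContinuousOn.div (by fun_prop)
      (by fun_prop) ?_) (by fun_prop))
    rintro ⟨s, φ⟩ ⟨hs, -⟩
    have := coneWidth_pos hs hν
    positivity
  · intro s hs φ _
    have := hasDerivAt_comp_triple hg (hasDerivAt_id s) (hasDerivAt_const s ν)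
      ((hasDerivAt_coneWidth_left hs hν).mul_const (Real.sin φ))
    refine (this.const_mul (Real.cos φ ^ 2)).congr_deriv ?_
    simp only [id]
    ring

theorem coneMean_comp_eq_zero_of_lt (w : ℝ → ℝ) {R : ℝ}
    (h : ∀ a b c, (R < |a| ∨ R < |b| ∨ R < |c|) → g (a, b, c) = 0) {p : ℝ × ℝ} (hp : R < ‖p‖) :
    coneMean w g p.1 p.2 = 0 :=
  coneMean_eq_zero w h (by simpa [Prod.norm_def, lt_sup_iff] using hp)

theorem hasCompactSupport_mul_coneMean (w : ℝ → ℝ) (hg : HasCompactSupport g) (c : ℝ × ℝ → ℝ) :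
    HasCompactSupport fun p : ℝ × ℝ => c p * coneMean w g p.1 p.2 := by
  obtain ⟨R, -, hR⟩ := eq_zero_of_hasCompactSupport hg
  refine HasCompactSupport.of_support_subset_isCompact (isCompact_closedBall 0 R) fun p hp => ?_
  rw [mem_closedBall_zero_iff]
  by_contra! hlt
  exact hp (by simp only [coneMean_comp_eq_zero_of_lt w hR hlt, mul_zero])

theorem coneMean_zero_right (μ : ℝ) : coneMean 1 g μ 0 = Real.pi * g (μ, 0, 0) := by
  simp [coneMean, coneWidth]

theorem coneMean_tendsto_zero_right (w : ℝ → ℝ) (hg : HasCompactSupport g) (μ : ℝ) :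
    Tendsto (fun ν => coneMean w g μ ν) atTop (𝓝 0) := by
  obtain ⟨R, -, hR⟩ := eq_zero_of_hasCompactSupport hg
  refine tendsto_const_nhds.congr' ?_
  filter_upwards [eventually_gt_atTop R] with ν hν
  exact (coneMean_eq_zero w hR (.inr (hν.trans_le (le_abs_self ν)))).symm

theorem coneMean_tendsto_zero_left (w : ℝ → ℝ) (hg : HasCompactSupport g) (ν : ℝ) (c : ℝ → ℝ) :
    Tendsto (fun μ => c μ * coneMean w g μ ν) atTop (𝓝 0) := by
  obtain ⟨R, -, hR⟩ := eq_zero_of_hasCompactSupport hg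
  refine tendsto_const_nhds.congr' ?_
  filter_upwards [eventually_gt_atTop R] with μ hμ
  rw [coneMean_eq_zero w hR (.inl (hμ.trans_le (le_abs_self μ))), mul_zero]

/-- The value of `g` at the vertex of the cone from its wave operator in the cone. -/
theorem integral_coneMean_waveOp (hg : ContDiff ℝ ∞ g) (hgs : HasCompactSupport g) :
    ∫ μ in Ioi (0 : ℝ), ∫ ν in Ioi (0 : ℝ), (4 * coneMean 1 (dirDeriv e₁ (dirDeriv e₂ g)) μ ν -
      Real.exp (ν - μ) * coneMean 1 (dirDeriv e₃ (dirDeriv e₃ g)) μ ν) =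
      4 * Real.pi * g (0, 0, 0) := by
  have hD : ∀ {f : ℝ × ℝ × ℝ → ℝ}, ContDiff ℝ ∞ f → ∀ e, ContDiff ℝ ∞ (dirDeriv e f) :=
    fun h e => contDiff_dirDeriv h e
  have hS : ∀ {f : ℝ × ℝ × ℝ → ℝ}, HasCompactSupport f → ∀ e, HasCompactSupport (dirDeriv e f) :=
    fun h e => hasCompactSupport_dirDeriv h e
  have hint : ∀ (c : ℝ × ℝ → ℝ) (w : ℝ → ℝ) (f : ℝ × ℝ × ℝ → ℝ), Continuous c → Continuous w →
      ContDiff ℝ ∞ f → HasCompactSupport f →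
      Integrable (fun p : ℝ × ℝ => c p * coneMean w f p.1 p.2)
        ((volume.restrict (Ioi 0)).prod (volume.restrict (Ioi 0))) := by
    intro c w f hc hw hf hfs
    rw [Measure.prod_restrict]
    exact ((hc.mul (continuous_coneMean hf.continuous hw)).integrable_of_hasCompactSupport
      (hasCompactSupport_mul_coneMean w hfs c)).integrableOn
  have hint1 : ∀ (c : ℝ → ℝ) (w : ℝ → ℝ) (f : ℝ × ℝ × ℝ → ℝ) (μ : ℝ), Continuous c →
      Continuous w → ContDiff ℝ ∞ f → HasCompactSupport f →
      IntegrableOn (fun ν => c ν * coneMean w f μ ν) (Ioi 0) := by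
    intro c w f μ hc hw hf hfs
    obtain ⟨R, -, hR⟩ := eq_zero_of_hasCompactSupport hfs
    refine (Continuous.integrable_of_hasCompactSupport (hc.mul
      ((continuous_coneMean hf.continuous hw).comp (by fun_prop : Continuous fun ν : ℝ => (μ, ν))))
      (HasCompactSupport.of_support_subset_isCompact (isCompact_closedBall 0 R)
        fun ν hν => ?_)).integrableOn
    rw [mem_closedBall_zero_iff]
    by_contra! hlt
    exact hν (mul_eq_zero_of_right _ (coneMean_eq_zero w hR (.inr (by simpa using hlt))))
  have hint2 : ∀ (c : ℝ → ℝ) (w : ℝ → ℝ) (f : ℝ × ℝ × ℝ → ℝ) (ν : ℝ), Continuous c →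
      Continuous w → ContDiff ℝ ∞ f → HasCompactSupport f →
      IntegrableOn (fun μ => c μ * coneMean w f μ ν) (Ioi 0) := by
    intro c w f ν hc hw hf hfs
    obtain ⟨R, -, hR⟩ := eq_zero_of_hasCompactSupport hfs
    refine (Continuous.integrable_of_hasCompactSupport (hc.mul
      ((continuous_coneMean hf.continuous hw).comp (by fun_prop : Continuous fun μ : ℝ => (μ, ν))))
      (HasCompactSupport.of_support_subset_isCompact (isCompact_closedBall 0 R)
        fun μ hμ => ?_)).integrableOn
    rw [mem_closedBall_zero_iff]
    by_contra! hlt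
    exact hμ (mul_eq_zero_of_right _ (coneMean_eq_zero w hR (.inl (by simpa using hlt))))
  have hcos : Continuous fun φ : ℝ => Real.cos φ ^ 2 := by fun_prop
  -- `B` is the `ν`-derivative of the mean of `∂_μ g`, and `D` below is the `μ`-derivative of a
  -- weighted mean of the second transverse derivative. The integrand is `4 B - 2 D`: the terms with
  -- third derivatives cancel. Integrating `B` in `ν` leaves the axis `ν = 0`, where the width is
  -- zero, and integrating `D` in `μ` leaves nothing.
  set B : ℝ → ℝ → ℝ := fun μ ν => 1 * coneMean 1 (dirDeriv e₂ (dirDeriv e₁ g)) μ ν +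
    (1 - Real.exp (-μ)) * Real.exp ν / 2 * coneMean (fun φ => Real.cos φ ^ 2)
      (dirDeriv e₃ (dirDeriv e₃ (dirDeriv e₁ g))) μ ν with hB
  set D : ℝ → ℝ → ℝ := fun μ ν => Real.exp (ν - μ) / 2 *
    coneMean 1 (dirDeriv e₃ (dirDeriv e₃ g)) μ ν + (1 - Real.exp (-μ)) * Real.exp ν *
      coneMean (fun φ => Real.cos φ ^ 2) (dirDeriv e₁ (dirDeriv e₃ (dirDeriv e₃ g))) μ ν with hDd
  have hBi : Integrable (fun p : ℝ × ℝ => B p.1 p.2)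
      ((volume.restrict (Ioi 0)).prod (volume.restrict (Ioi 0))) :=
    (hint (fun _ => 1) _ _ (by fun_prop) continuous_one (hD (hD hg _) _) (hS (hS hgs _) _)).add
      (hint (fun p => (1 - Real.exp (-p.1)) * Real.exp p.2 / 2) _ _ (by fun_prop) hcos
        (hD (hD (hD hg _) _) _) (hS (hS (hS hgs _) _) _))
  have hDi : Integrable (fun p : ℝ × ℝ => D p.1 p.2)
      ((volume.restrict (Ioi 0)).prod (volume.restrict (Ioi 0))) :=
    (hint (fun p => Real.exp (p.2 - p.1) / 2) _ _ (by fun_prop) continuous_one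
      (hD (hD hg _) _) (hS (hS hgs _) _)).add
      (hint (fun p => (1 - Real.exp (-p.1)) * Real.exp p.2) _ _ (by fun_prop) hcos
        (hD (hD (hD hg _) _) _) (hS (hS (hS hgs _) _) _))
  have hBν : ∀ μ ∈ Ioi (0 : ℝ), ∫ ν in Ioi (0 : ℝ), B μ ν =
      -(Real.pi * dirDeriv e₁ g (μ, 0, 0)) := by
    intro μ hμ
    rw [← coneMean_zero_right, ← zero_sub]
    refine integral_Ioi_of_hasDerivAt_of_tendsto ?_ (fun ν hν => ?_) ?_
      (coneMean_tendsto_zero_right 1 (hS hgs _) μ)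
    · exact ((continuous_coneMean (hD hg _).continuous continuous_one).comp
        (by fun_prop : Continuous fun ν : ℝ => (μ, ν))).continuousWithinAt
    · simpa only [hB, one_mul] using hasDerivAt_coneMean_right (hD hg e₁) hμ hν
    · exact (hint1 (fun _ => 1) _ _ μ (by fun_prop) continuous_one (hD (hD hg _) _)
        (hS (hS hgs _) _)).add (hint1 (fun ν => (1 - Real.exp (-μ)) * Real.exp ν / 2) _ _ μ
        (by fun_prop) hcos (hD (hD (hD hg _) _) _) (hS (hS (hS hgs _) _) _))
  have hDμ : ∀ ν ∈ Ioi (0 : ℝ), ∫ μ in Ioi (0 : ℝ), D μ ν = 0 := by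
    intro ν hν
    have h := integral_Ioi_of_hasDerivAt_of_tendsto (a := 0) (m := 0) (f' := fun μ => D μ ν)
      (f := fun μ => (1 - Real.exp (-μ)) * Real.exp ν *
        coneMean (fun φ => Real.cos φ ^ 2) (dirDeriv e₃ (dirDeriv e₃ g)) μ ν)
      ?_ (fun μ hμ => ?_) ?_
      (coneMean_tendsto_zero_left _ (hS (hS hgs _) _) ν _)
    · simpa using h
    · exact (Continuous.mul (by fun_prop)
        ((continuous_coneMean (hD (hD hg _) _).continuous hcos).comp
        (by fun_prop : Continuous fun μ : ℝ => (μ, ν)))).continuousWithinAt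
    · exact hasDerivAt_coneMean_left (hD (hD hg _) _) hμ hν
    · exact (hint2 (fun μ => Real.exp (ν - μ) / 2) _ _ ν (by fun_prop) continuous_one
        (hD (hD hg _) _) (hS (hS hgs _) _)).add
        (hint2 (fun μ => (1 - Real.exp (-μ)) * Real.exp ν) _ _ ν (by fun_prop) hcos
        (hD (hD (hD hg _) _) _) (hS (hS (hS hgs _) _) _))
  have hg1 : ∫ μ in Ioi (0 : ℝ), dirDeriv e₁ g (μ, 0, 0) = -g (0, 0, 0) := by
    rw [← zero_sub]
    obtain ⟨R, -, hR⟩ := eq_zero_of_hasCompactSupport hgs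
    obtain ⟨R', -, hR'⟩ := eq_zero_of_hasCompactSupport (hS hgs e₁)
    refine integral_Ioi_of_hasDerivAt_of_tendsto' (f := fun μ => g (μ, 0, 0)) (fun μ _ => ?_) ?_
      (tendsto_const_nhds.congr' ?_)
    · simpa using hasDerivAt_comp_triple hg (hasDerivAt_id μ) (hasDerivAt_const μ (0 : ℝ))
        (hasDerivAt_const μ (0 : ℝ))
    · refine (Continuous.integrable_of_hasCompactSupport
        ((hD hg e₁).continuous.comp (by fun_prop : Continuous fun μ : ℝ => (μ, (0 : ℝ), (0 : ℝ))))
        (HasCompactSupport.of_support_subset_isCompact (isCompact_closedBall 0 R')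
          fun μ hμ => ?_)).integrableOn
      rw [mem_closedBall_zero_iff]
      by_contra! hlt
      exact hμ (hR' _ _ _ (.inl (by simpa using hlt)))
    · filter_upwards [eventually_gt_atTop R] with μ hμ
      exact (hR _ _ _ (.inl (hμ.trans_le (le_abs_self μ)))).symm
  have hsplit : ∀ μ ν, 4 * coneMean 1 (dirDeriv e₁ (dirDeriv e₂ g)) μ ν -
      Real.exp (ν - μ) * coneMean 1 (dirDeriv e₃ (dirDeriv e₃ g)) μ ν =
      4 * B μ ν - 2 * D μ ν := by
    intro μ ν
    have h1 : dirDeriv e₃ (dirDeriv e₃ (dirDeriv e₁ g)) =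
        dirDeriv e₁ (dirDeriv e₃ (dirDeriv e₃ g)) := by
      rw [dirDeriv_comm hg e₃ e₁, dirDeriv_comm (hD hg _) e₃ e₁]
    simp only [hB, hDd, h1, dirDeriv_comm hg e₂ e₁]
    ring
  simp only [hsplit]
  rw [integral_integral_sub (f := fun p => 4 * B p.1 p.2) (g := fun p => 2 * D p.1 p.2)
    (hBi.const_mul 4) (hDi.const_mul 2)]
  have e1 : ∫ μ in Ioi (0 : ℝ), ∫ ν in Ioi (0 : ℝ), 4 * B μ ν = 4 * Real.pi * g (0, 0, 0) := by
    simp only [integral_const_mul]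
    rw [setIntegral_congr_fun measurableSet_Ioi hBν, integral_neg, integral_const_mul, hg1]
    ring
  have e2 : ∫ μ in Ioi (0 : ℝ), ∫ ν in Ioi (0 : ℝ), 2 * D μ ν = 0 := by
    simp only [integral_const_mul]
    rw [integral_integral_swap hDi, setIntegral_congr_fun measurableSet_Ioi hDμ]
    simp
  rw [e1, e2, sub_zero]

end Cone

/-! ### The propagator in horocyclic coordinates -/

/-- Half the Euclidean width, at height `exp b`, of the hyperbolic disc of radius `t` around `I`. -/
def halfWidth (t b : ℝ) : ℝ := √(2 * Real.exp b * (Real.cosh t - Real.cosh b))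

/-- The point of the hyperbolic disc of radius `t` around `x` with parameters `k`. -/
def node (t : ℝ) (x k : ℝ × ℝ) : ℝ × ℝ :=
  (x.1 + Real.exp x.2 * halfWidth t (t * k.1) * Real.sin k.2, x.2 + t * k.1)

/-- The parameter domain of `node`. -/
def box : Set (ℝ × ℝ) := Icc (-1) 1 ×ˢ Icc (-(Real.pi / 2)) (Real.pi / 2)

/-- The propagator `sin (t √A) / √A` of the shifted wave equation, acting on functions of the
horocyclic coordinates `(a, σ)` that are multiplied by `exp (-σ / 2)`. -/
def propagator (t : ℝ) (v : ℝ × ℝ → ℝ) (x : ℝ × ℝ) : ℝ :=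
  t / (2 * Real.pi) * ∫ k in box, v (node t x k)

theorem isCompact_box : IsCompact box := isCompact_Icc.prod isCompact_Icc

/-- In the characteristic variables `t - b` and `t + b` the radicand splits into a product of
functions of one variable each. -/
theorem halfWidth_eq_coneWidth (t b : ℝ) : halfWidth t b = coneWidth (t - b) (t + b) := by
  unfold halfWidth coneWidth
  congr 1
  have h1 : Real.exp (-(t - b)) = Real.exp b * Real.exp (-t) := by rw [← Real.exp_add]; ring_nf
  have h3 : Real.exp b * Real.exp (-b) = 1 := by rw [← Real.exp_add]; simp
  have h4 : Real.exp t * Real.exp (-t) = 1 := by rw [← Real.exp_add]; simp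
  rw [Real.cosh_eq, Real.cosh_eq, h1, Real.exp_add]
  linear_combination Real.exp b ^ 2 * h4 - h3

@[fun_prop]
theorem Continuous.halfWidth {X : Type*} [TopologicalSpace X] {f g : X → ℝ} (hf : Continuous f)
    (hg : Continuous g) : Continuous fun x => halfWidth (f x) (g x) := by
  unfold HypWave.halfWidth
  fun_prop

@[fun_prop]
theorem Continuous.node {X : Type*} [TopologicalSpace X] {f : X → ℝ} {g h : X → ℝ × ℝ}
    (hf : Continuous f) (hg : Continuous g) (hh : Continuous h) :
    Continuous fun x => node (f x) (g x) (h x) := by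
  unfold HypWave.node
  fun_prop

theorem continuous_propagator {X : Type*} [TopologicalSpace X] [FirstCountableTopology X]
    [LocallyCompactSpace X] {v : X → ℝ × ℝ → ℝ} (hv : Continuous (Function.uncurry v))
    {f : X → ℝ} {g : X → ℝ × ℝ} (hf : Continuous f) (hg : Continuous g) :
    Continuous fun x => propagator (f x) (v x) (g x) := by
  unfold propagator
  refine (by fun_prop : Continuous fun x => f x / (2 * Real.pi)).mul ?_
  refine continuous_parametric_integral_of_continuous (f := fun x k => v x (node (f x) (g x) k))
    ?_ isCompact_box
  exact hv.comp (by fun_prop : Continuous fun p : X × (ℝ × ℝ) => (p.1, node (f p.1) (g p.1) p.2))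

theorem integrable_of_bounded_of_norm_le {E : Type*} [NormedAddCommGroup E] [ProperSpace E]
    [MeasurableSpace E] [OpensMeasurableSpace E] {μ : Measure E} [IsFiniteMeasureOnCompacts μ]
    {f : E → ℝ} (hf : AEStronglyMeasurable f μ) {C R : ℝ} (hC : ∀ x, |f x| ≤ C)
    (hR : ∀ x, R < ‖x‖ → f x = 0) : Integrable f μ := by
  have hK := isCompact_closedBall (0 : E) R
  have h : IntegrableOn f (Metric.closedBall 0 R) μ :=
    Measure.integrableOn_of_bounded hK.measure_ne_top hf (ae_of_all _ hC)
  refine (integrableOn_iff_integrable_of_support_subset fun x hx => ?_).1 h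
  rw [mem_closedBall_zero_iff]
  by_contra! hlt
  exact hx (hR x hlt)

theorem integral_box {f : ℝ × ℝ → ℝ} (hf : Continuous f) : ∫ k in box, f k =
    ∫ c in (-1 : ℝ)..1, ∫ φ in -(Real.pi / 2)..Real.pi / 2, f (c, φ) := by
  rw [box, Measure.volume_eq_prod, setIntegral_prod _
    (by rw [← Measure.volume_eq_prod]; exact hf.continuousOn.integrableOn_compact isCompact_box)]
  rw [intervalIntegral.integral_of_le (by norm_num), ← integral_Icc_eq_integral_Ioc]
  refine setIntegral_congr_fun measurableSet_Icc fun c _ => ?_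
  rw [intervalIntegral.integral_of_le (by linarith [Real.pi_pos]), integral_Icc_eq_integral_Ioc]

/-- The substitution is `b = t c`. The definition uses the rescaled variable so that the domain of
integration does not move with `t`. -/
theorem propagator_eq {v : ℝ × ℝ → ℝ} (hv : Continuous v) (t : ℝ) (x : ℝ × ℝ) :
    propagator t v x = 1 / (2 * Real.pi) * ∫ b in -t..t, ∫ φ in -(Real.pi / 2)..Real.pi / 2,
      v (x.1 + Real.exp x.2 * halfWidth t b * Real.sin φ, x.2 + b) := by
  rw [propagator, integral_box (by fun_prop)]
  have h := intervalIntegral.mul_integral_comp_mul_left (a := -1) (b := 1) t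
    (f := fun b => ∫ φ in -(Real.pi / 2)..Real.pi / 2,
      v (x.1 + Real.exp x.2 * halfWidth t b * Real.sin φ, x.2 + b))
  rw [mul_neg_one, mul_one] at h
  rw [← h]
  simp only [node]
  ring

/-- The conjugated wave operator `∂ₜ² - ∂_σ² - e^(2σ) ∂ₐ²`. -/
def conjWave (ψ : ℝ × ℝ × ℝ → ℝ) (p : ℝ × ℝ × ℝ) : ℝ :=
  dirDeriv e₁ (dirDeriv e₁ ψ) p - dirDeriv e₃ (dirDeriv e₃ ψ) p -
    Real.exp (2 * p.2.2) * dirDeriv e₂ (dirDeriv e₂ ψ) p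

/-- The linear map to `(t - b, t + b)` has determinant `2`. After extension by zero to the plane it
is realised by a translation in `b`, Fubini, and a scaling and translation in `t`. -/
theorem integral_Ioi_integral_comp_sub_add {h : ℝ × ℝ → ℝ} (hh : Continuous h)
    (hs : HasCompactSupport h) :
    ∫ t in Ioi (0 : ℝ), ∫ b in -t..t, h (t - b, t + b) =
      1 / 2 * ∫ μ in Ioi (0 : ℝ), ∫ ν in Ioi (0 : ℝ), h (μ, ν) := by
  set H : ℝ → ℝ → ℝ := fun μ ν => (Ioi 0 ×ˢ Ioi 0).indicator h (μ, ν) with hH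
  have hS : MeasurableSet (Ioi (0 : ℝ) ×ˢ Ioi (0 : ℝ)) := measurableSet_Ioi.prod measurableSet_Ioi
  have hHm : Measurable fun p : ℝ × ℝ => H p.1 p.2 := hh.measurable.indicator hS
  obtain ⟨C, hC⟩ := hs.exists_bound_of_continuous hh
  obtain ⟨R, hR0, hR⟩ := hs.isBounded.exists_pos_norm_le
  have hHC : ∀ μ ν, |H μ ν| ≤ C := fun μ ν => by
    refine le_trans ?_ (hC (μ, ν))
    simpa only [hH, Real.norm_eq_abs] using norm_indicator_le_norm_self h (μ, ν)
  have hHR : ∀ μ ν, (R < |μ| ∨ R < |ν|) → H μ ν = 0 := by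
    intro μ ν hlt
    refine indicator_apply_eq_zero.2 fun _ => ?_
    by_contra hne
    have := hR (μ, ν) (subset_tsupport h hne)
    simp only [Prod.norm_def, Real.norm_eq_abs, sup_le_iff] at this
    grind
  have e1 : ∫ μ in Ioi (0 : ℝ), ∫ ν in Ioi (0 : ℝ), h (μ, ν) = ∫ μ, ∫ ν, H μ ν := by
    rw [← integral_indicator measurableSet_Ioi]
    congr 1 with μ
    by_cases hμ : μ ∈ Ioi (0 : ℝ)
    · rw [indicator_of_mem hμ, ← integral_indicator measurableSet_Ioi]
      congr 1 with ν
      by_cases hν : ν ∈ Ioi (0 : ℝ) <;> simp_all [indicator]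
    · rw [indicator_of_notMem hμ]
      symm
      rw [show (fun ν => H μ ν) = fun _ => 0 from funext fun ν => by
        simp only [hH]; exact indicator_of_notMem (fun hm => hμ hm.1) _]
      simp
  have e2 : ∫ t in Ioi (0 : ℝ), ∫ b in -t..t, h (t - b, t + b) =
      ∫ t, ∫ b, H (t - b) (t + b) := by
    rw [← integral_indicator measurableSet_Ioi]
    congr 1 with t
    by_cases ht : t ∈ Ioi (0 : ℝ)
    · have ht0 : 0 < t := ht
      rw [indicator_of_mem ht, intervalIntegral.integral_of_le (by linarith),
        integral_Ioc_eq_integral_Ioo, ← integral_indicator measurableSet_Ioo]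
      congr 1 with b
      by_cases hb : b ∈ Ioo (-t) t
      · rw [indicator_of_mem hb]
        exact (indicator_of_mem (show ((t - b, t + b) : ℝ × ℝ) ∈ Ioi (0 : ℝ) ×ˢ Ioi (0 : ℝ) from
          ⟨by simpa using hb.2, by simpa using (by linarith [hb.1] : 0 < t + b)⟩) _).symm
      · rw [indicator_of_notMem hb]
        refine (indicator_of_notMem (fun hm => hb ?_) _).symm
        have h1 : 0 < t - b := hm.1
        have h2 : 0 < t + b := hm.2
        constructor <;> linarith
    · rw [indicator_of_notMem ht]
      symm
      rw [show (fun b => H (t - b) (t + b)) = fun _ => 0 from funext fun b => by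
        refine indicator_of_notMem (fun hm => ht ?_) _
        have h1 : 0 < t - b := hm.1
        have h2 : 0 < t + b := hm.2
        exact (by linarith : (0 : ℝ) < t)]
      simp
  have e3 : ∀ t, ∫ b, H (t - b) (t + b) = ∫ μ, H μ (2 * t - μ) := by
    intro t
    rw [← integral_sub_left_eq_self (fun μ => H μ (2 * t - μ)) volume t]
    congr 1 with b
    ring_nf
  have e4 : ∀ μ, ∫ t, H μ (2 * t - μ) = 1 / 2 * ∫ ν, H μ ν := by
    intro μ
    rw [Measure.integral_comp_mul_left (fun t => H μ (t - μ)) 2,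
      integral_sub_right_eq_self (fun t => H μ t) μ]
    norm_num
  rw [e1, e2]
  simp only [e3]
  rw [integral_integral_swap]
  · simp only [e4]
    rw [integral_const_mul]
  · refine integrable_of_bounded_of_norm_le (C := C) (R := R) ?_ (fun p => hHC _ _) ?_
    · exact (hHm.comp (by fun_prop : Measurable fun p : ℝ × ℝ =>
        (p.2, 2 * p.1 - p.2))).aestronglyMeasurable
    · intro p hp
      simp only [Prod.norm_def, Real.norm_eq_abs, lt_sup_iff] at hp
      refine hHR _ _ ?_
      by_contra! hcon
      rw [abs_le, abs_le] at hcon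
      rw [lt_abs, lt_abs] at hp
      grind

/-- Duhamel's formula for test functions: a test function is recovered from its wave operator. -/
theorem integral_propagator_conjWave {ψ : ℝ × ℝ × ℝ → ℝ} (hψ : ContDiff ℝ ∞ ψ)
    (hs : HasCompactSupport ψ) (s : ℝ) (x : ℝ × ℝ) :
    ∫ t in Ioi (0 : ℝ), propagator t (fun q => conjWave ψ (s + t, q)) x = ψ (s, x) := by
  have hD : ∀ {f : ℝ × ℝ × ℝ → ℝ}, ContDiff ℝ ∞ f → ∀ e, ContDiff ℝ ∞ (dirDeriv e f) :=
    fun h e => contDiff_dirDeriv h e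
  -- Characteristic coordinates of the forward cone with vertex `(s, x)`: the first two entries are
  -- `t - b` and `t + b`, and the third is the horizontal displacement measured at the height of
  -- `x`.
  set T : ℝ × ℝ × ℝ → ℝ × ℝ × ℝ := fun p =>
    (s + (p.1 + p.2.1) / 2, x.1 + Real.exp x.2 * p.2.2, x.2 + (p.2.1 - p.1) / 2) with hT
  have hTc : ContDiff ℝ ∞ T := by fun_prop
  set g : ℝ × ℝ × ℝ → ℝ := ψ ∘ T with hg
  have hgc : ContDiff ℝ ∞ g := hψ.comp hTc
  have hchain : ∀ {f : ℝ × ℝ × ℝ → ℝ}, ContDiff ℝ ∞ f →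
      dirDeriv e₁ (f ∘ T) = (fun p => 1 / 2 * dirDeriv e₁ f p - 1 / 2 * dirDeriv e₃ f p) ∘ T ∧
      dirDeriv e₂ (f ∘ T) = (fun p => 1 / 2 * dirDeriv e₁ f p + 1 / 2 * dirDeriv e₃ f p) ∘ T ∧
      dirDeriv e₃ (f ∘ T) = (fun p => Real.exp x.2 * dirDeriv e₂ f p) ∘ T := by
    intro f hf
    have hline : ∀ (p e : ℝ × ℝ × ℝ), HasDerivAt (fun r : ℝ => p + r • e) e 0 := fun p e => by
      simpa using ((hasDerivAt_id (0 : ℝ)).smul_const e).const_add p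
    refine ⟨?_, ?_, ?_⟩ <;> ext p
    · have h1 := dirDeriv_comp_hasDerivAt (hf.comp hTc) (hline p e₁)
      have h2 := hasDerivAt_comp_triple hf (t := 0)
        (a := fun r => s + (p.1 + r + p.2.1) / 2) (b := fun _ => x.1 + Real.exp x.2 * p.2.2)
        (c := fun r => x.2 + (p.2.1 - (p.1 + r)) / 2)
        ((((hasDerivAt_id (0 : ℝ)).const_add p.1).add_const p.2.1).div_const 2 |>.const_add s)
        (hasDerivAt_const _ _)
        ((((hasDerivAt_id (0 : ℝ)).const_add p.1).const_sub p.2.1).div_const 2 |>.const_add x.2)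
      have := h1.unique (h2.congr_of_eventuallyEq (.of_forall fun r => by simp [hT]))
      simp only [zero_smul, add_zero] at this
      rw [this]
      simp only [hT, Function.comp]
      ring
    · have h1 := dirDeriv_comp_hasDerivAt (hf.comp hTc) (hline p e₂)
      have h2 := hasDerivAt_comp_triple hf (t := 0)
        (a := fun r => s + (p.1 + (p.2.1 + r)) / 2) (b := fun _ => x.1 + Real.exp x.2 * p.2.2)
        (c := fun r => x.2 + (p.2.1 + r - p.1) / 2)
        ((((hasDerivAt_id (0 : ℝ)).const_add p.2.1).const_add p.1).div_const 2 |>.const_add s)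
        (hasDerivAt_const _ _)
        ((((hasDerivAt_id (0 : ℝ)).const_add p.2.1).sub_const p.1).div_const 2 |>.const_add x.2)
      have := h1.unique (h2.congr_of_eventuallyEq (.of_forall fun r => by simp [hT]))
      simp only [zero_smul, add_zero] at this
      rw [this]
      simp only [hT, Function.comp]
      ring
    · have h1 := dirDeriv_comp_hasDerivAt (hf.comp hTc) (hline p e₃)
      have h2 := hasDerivAt_comp_triple hf (t := 0)
        (a := fun _ => s + (p.1 + p.2.1) / 2) (b := fun r => x.1 + Real.exp x.2 * (p.2.2 + r))
        (c := fun _ => x.2 + (p.2.1 - p.1) / 2)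
        (hasDerivAt_const _ _)
        ((((hasDerivAt_id (0 : ℝ)).const_add p.2.2).const_mul _).const_add x.1)
        (hasDerivAt_const _ _)
      have := h1.unique (h2.congr_of_eventuallyEq (.of_forall fun r => by simp [hT]))
      simp only [zero_smul, add_zero] at this
      rw [this]
      simp only [hT, Function.comp]
      ring
  have hgs : HasCompactSupport g := by
    obtain ⟨R, hR0, hR⟩ := eq_zero_of_hasCompactSupport hs
    refine HasCompactSupport.of_support_subset_isCompact
      (isCompact_closedBall 0 (2 * R + |s| + |x.2| + (R + |x.1|) * Real.exp (-x.2)))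
      fun p hp => ?_
    by_contra hlt
    apply hp
    refine hR _ _ _ ?_
    by_contra! hcon
    apply hlt
    rw [mem_closedBall_zero_iff]
    obtain ⟨h1, h2, h3⟩ := hcon
    have hx2 : (R + |x.1|) * Real.exp (-x.2) ≥ 0 := by positivity
    have h4 : |p.2.2| ≤ (R + |x.1|) * Real.exp (-x.2) := by
      have h5 : |Real.exp x.2 * p.2.2| ≤ R + |x.1| := by
        have := abs_sub_abs_le_abs_sub (Real.exp x.2 * p.2.2) (-x.1)
        rw [sub_neg_eq_add, abs_neg, add_comm (Real.exp x.2 * p.2.2)] at this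
        linarith
      rw [abs_mul, abs_of_pos (Real.exp_pos _)] at h5
      calc |p.2.2| = Real.exp x.2 * |p.2.2| * Real.exp (-x.2) := by
            rw [mul_right_comm, ← Real.exp_add]; simp
        _ ≤ _ := by gcongr
    have a1 := abs_le.1 h1
    have a2 := abs_le.1 h3
    have a3 := neg_abs_le s
    have a4 := le_abs_self s
    have a5 := neg_abs_le x.2
    have a6 := le_abs_self x.2
    simp only [Prod.norm_def, Real.norm_eq_abs, sup_le_iff]
    refine ⟨abs_le.2 ⟨?_, ?_⟩, abs_le.2 ⟨?_, ?_⟩, ?_⟩ <;>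
      linarith [abs_nonneg s, abs_nonneg x.2]
  -- The coefficient arises because `p.2.1 - p.1` is twice the increment `b` of the logarithmic
  -- height, while the horizontal scaling by `exp x.2` supplies the remaining part of `exp (2 σ)`.
  have hwave : ∀ p, 4 * dirDeriv e₁ (dirDeriv e₂ g) p - Real.exp (p.2.1 - p.1) *
      dirDeriv e₃ (dirDeriv e₃ g) p = conjWave ψ (T p) := by
    intro p
    have k1 : ContDiff ℝ ∞ (fun p => 1 / 2 * dirDeriv e₁ ψ p + 1 / 2 * dirDeriv e₃ ψ p) :=
      ((contDiff_const.mul (hD hψ _)).add (contDiff_const.mul (hD hψ _)))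
    have k2 : ContDiff ℝ ∞ (fun p => Real.exp x.2 * dirDeriv e₂ ψ p) :=
      (contDiff_const.mul (hD hψ _))
    have l1 : ∀ e p, dirDeriv e (fun p => 1 / 2 * dirDeriv e₁ ψ p + 1 / 2 * dirDeriv e₃ ψ p) p =
        1 / 2 * dirDeriv e (dirDeriv e₁ ψ) p + 1 / 2 * dirDeriv e (dirDeriv e₃ ψ) p := by
      intro e p
      have d1 := ((hD hψ e₁).differentiable (by simp)) p
      have d3 := ((hD hψ e₃).differentiable (by simp)) p
      simp only [dirDeriv]
      have := ((d1.hasFDerivAt.const_mul (1 / 2)).add (d3.hasFDerivAt.const_mul (1 / 2))).fderiv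
      erw [this]
      simp
    have l2 : ∀ e p, dirDeriv e (fun p => Real.exp x.2 * dirDeriv e₂ ψ p) p =
        Real.exp x.2 * dirDeriv e (dirDeriv e₂ ψ) p := by
      intro e p
      have d1 := ((hD hψ e₂).differentiable (by simp)) p
      simp only [dirDeriv]
      have := (d1.hasFDerivAt.const_mul (Real.exp x.2)).fderiv
      erw [this]
      simp
    rw [(hchain hψ).2.1, (hchain hψ).2.2, (hchain k1).1, (hchain k2).2.2]
    simp only [Function.comp, l1, l2, conjWave, dirDeriv_comm hψ e₃ e₁]
    have : Real.exp (2 * (T p).2.2) = Real.exp (p.2.1 - p.1) * (Real.exp x.2 * Real.exp x.2) := by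
      rw [← Real.exp_add, ← Real.exp_add]
      congr 1
      simp only [hT]
      ring
    rw [this]
    ring
  set h : ℝ × ℝ → ℝ := fun p => 4 * coneMean 1 (dirDeriv e₁ (dirDeriv e₂ g)) p.1 p.2 -
    Real.exp (p.2 - p.1) * coneMean 1 (dirDeriv e₃ (dirDeriv e₃ g)) p.1 p.2 with hh
  have hc12 : Continuous (dirDeriv e₁ (dirDeriv e₂ g)) := (hD (hD hgc _) _).continuous
  have hc33 : Continuous (dirDeriv e₃ (dirDeriv e₃ g)) := (hD (hD hgc _) _).continuous
  have hhc : Continuous h :=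
    (continuous_const.mul (continuous_coneMean hc12 continuous_one)).sub
      ((by fun_prop : Continuous fun p : ℝ × ℝ => Real.exp (p.2 - p.1)).mul
      (continuous_coneMean hc33 continuous_one))
  have hhs : HasCompactSupport h :=
    (hasCompactSupport_mul_coneMean 1 (hasCompactSupport_dirDeriv
      (hasCompactSupport_dirDeriv hgs _) _) fun _ => 4).sub
      (hasCompactSupport_mul_coneMean 1 (hasCompactSupport_dirDeriv
      (hasCompactSupport_dirDeriv hgs _) _) fun p => Real.exp (p.2 - p.1))
  have hcw : Continuous (conjWave ψ) := by
    have c1 := (hD (hD hψ e₁) e₁).continuous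
    have c2 := (hD (hD hψ e₂) e₂).continuous
    have c3 := (hD (hD hψ e₃) e₃).continuous
    unfold conjWave
    fun_prop
  have hprop : ∀ t, propagator t (fun q => conjWave ψ (s + t, q)) x =
      1 / (2 * Real.pi) * ∫ b in -t..t, h (t - b, t + b) := by
    intro t
    rw [propagator_eq (by fun_prop)]
    congr 1
    refine intervalIntegral.integral_congr fun b _ => ?_
    simp only [hh, coneMean, Pi.one_apply, one_mul]
    have hcw : Continuous fun φ : ℝ => coneWidth (t - b) (t + b) * Real.sin φ := by fun_prop
    rw [← intervalIntegral.integral_const_mul, ← intervalIntegral.integral_const_mul,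
      ← intervalIntegral.integral_sub (Continuous.intervalIntegrable (by fun_prop) _ _)
        (Continuous.intervalIntegrable (by fun_prop) _ _)]
    refine intervalIntegral.integral_congr fun φ _ => ?_
    have := hwave (t - b, t + b, coneWidth (t - b) (t + b) * Real.sin φ)
    dsimp only at this ⊢
    rw [this, halfWidth_eq_coneWidth]
    simp only [hT]
    ring_nf
  simp only [hprop]
  rw [integral_const_mul, integral_Ioi_integral_comp_sub_add hhc hhs]
  have := integral_coneMean_waveOp hgc hgs
  simp only [hh]
  rw [this]
  have hg0 : g (0, 0, 0) = ψ (s, x) := by simp [hg, hT]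
  rw [hg0]
  field_simp
  norm_num

/-! ### Symmetry of the propagator -/

/-- This is the symmetry of the distance in these coordinates. It makes the horizontal displacement
of `node` the same seen from either endpoint, so that reversing `k` goes back. -/
theorem exp_mul_halfWidth_neg (t b : ℝ) : Real.exp b * halfWidth t (-b) = halfWidth t b := by
  unfold halfWidth
  rw [show Real.exp b = √(Real.exp b ^ 2) from (Real.sqrt_sq (Real.exp_pos b).le).symm,
    ← Real.sqrt_mul (by positivity), Real.cosh_neg, Real.sqrt_sq (Real.exp_pos b).le]
  congr 1
  have h3 : Real.exp b * Real.exp (-b) = 1 := by rw [← Real.exp_add]; simp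
  linear_combination 2 * Real.exp b * (Real.cosh t - Real.cosh b) * h3

theorem node_node_neg (t : ℝ) (x k : ℝ × ℝ) : node t (node t x k) (-k) = x := by
  simp only [node, Prod.fst_neg, Prod.snd_neg, Real.sin_neg, mul_neg]
  refine Prod.ext ?_ ?_
  · simp only
    rw [← exp_mul_halfWidth_neg t (t * k.1), Real.exp_add]
    ring
  · simp

theorem node_neg_node (t : ℝ) (x k : ℝ × ℝ) : node t (node t x (-k)) k = x := by
  simpa using node_node_neg t x (-k)

theorem neg_mem_box {k : ℝ × ℝ} : -k ∈ box ↔ k ∈ box := by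
  simp only [box, mem_prod, mem_Icc, Prod.fst_neg, Prod.snd_neg]
  constructor <;> rintro ⟨⟨h1, h2⟩, h3, h4⟩ <;> refine ⟨⟨?_, ?_⟩, ?_, ?_⟩ <;> linarith

/-- `node t · k` as a measurable equivalence. -/
def nodeEquiv (t : ℝ) (k : ℝ × ℝ) : ℝ × ℝ ≃ᵐ ℝ × ℝ where
  toFun x := node t x k
  invFun x := node t x (-k)
  left_inv x := node_node_neg t x k
  right_inv x := node_neg_node t x k
  measurable_toFun := (by fun_prop : Continuous fun x => node t x k).measurable
  measurable_invFun := (by fun_prop : Continuous fun x => node t x (-k)).measurable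

/-- For fixed `k` the map translates `σ` by a constant and then translates `a` by an amount
depending on `σ` alone: a skew product of translations. -/
theorem measurePreserving_node (t : ℝ) (k : ℝ × ℝ) :
    MeasurePreserving (fun x => node t x k) (volume : Measure (ℝ × ℝ)) volume := by
  have h : MeasurePreserving (fun p : ℝ × ℝ => (p.1 + t * k.1,
      p.2 + Real.exp p.1 * halfWidth t (t * k.1) * Real.sin k.2))
      ((volume : Measure ℝ).prod volume) ((volume : Measure ℝ).prod volume) :=
    (measurePreserving_add_right volume (t * k.1)).skew_product
      (g := fun σ a => a + Real.exp σ * halfWidth t (t * k.1) * Real.sin k.2)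
      (by fun_prop) (ae_of_all _ fun σ => (measurePreserving_add_right volume _).map_eq)
  exact (Measure.measurePreserving_swap.comp h).comp Measure.measurePreserving_swap

/-- Finite speed of propagation: `x` is recovered from `node t x k` by the reversed parameter, so it
lies in the continuous image of a compact set, uniformly in `t`. -/
theorem exists_norm_le_of_norm_node_le (T R : ℝ) : ∃ R', ∀ t ∈ Icc (-T) T, ∀ k ∈ box, ∀ x,
    ‖node t x k‖ ≤ R → ‖x‖ ≤ R' := by
  have hK : IsCompact ((fun p : ℝ × (ℝ × ℝ) × (ℝ × ℝ) => node p.1 p.2.1 p.2.2) ''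
      (Icc (-T) T ×ˢ (Metric.closedBall 0 R ×ˢ box))) :=
    (isCompact_Icc.prod ((isCompact_closedBall 0 R).prod isCompact_box)).image (by fun_prop)
  obtain ⟨R', hR'⟩ := hK.isBounded.exists_norm_le
  refine ⟨R', fun t ht k hk x hx => ?_⟩
  rw [← node_node_neg t x k]
  exact hR' _ ⟨(t, node t x k, -k), ⟨ht, by simpa using hx, neg_mem_box.2 hk⟩, rfl⟩

theorem integrable_prod_restrict_of_isCompact {E Y : Type*} [TopologicalSpace E]
    [TopologicalSpace Y] [MeasurableSpace E] [MeasurableSpace Y] [OpensMeasurableSpace (E × Y)]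
    [T2Space Y] [OpensMeasurableSpace Y] {μ : Measure E} {ν : Measure Y} [SFinite μ] [SFinite ν]
    [IsFiniteMeasureOnCompacts (μ.prod ν)] [SecondCountableTopology (E × Y)]
    [T2Space (E × Y)] {F : E × Y → ℝ} (hF : Continuous F) {K₀ : Set E}
    {K : Set Y} (hK₀ : IsCompact K₀) (hK : IsCompact K) (h : ∀ x k, k ∈ K → x ∉ K₀ → F (x, k) = 0) :
    Integrable F (μ.prod (ν.restrict K)) := by
  have h1 : IntegrableOn F (K₀ ×ˢ K) (μ.prod ν) :=
    hF.continuousOn.integrableOn_compact (hK₀.prod hK)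
  have h2 : IntegrableOn F (univ ×ˢ K) (μ.prod ν) :=
    h1.of_forall_sdiff_eq_zero (MeasurableSet.univ.prod hK.measurableSet) fun p hp =>
      h p.1 p.2 hp.1.2 fun hx => hp.2 ⟨hx, hp.1.2⟩
  rwa [IntegrableOn, ← Measure.prod_restrict, Measure.restrict_univ] at h2

/-- Symmetry of the propagator for Lebesgue measure in `(a, σ)`: for each `k` the measure-preserving
change of variables moves the translation from one factor to the other, with `-k` for `k`, and the
box is symmetric. -/
theorem integral_propagator_mul (t : ℝ) {f g : ℝ × ℝ → ℝ} (hf : Continuous f) (hg : Continuous g)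
    (hgs : HasCompactSupport g) :
    ∫ x, propagator t f x * g x = ∫ x, f x * propagator t g x := by
  obtain ⟨R, hR0, hR⟩ := hgs.isBounded.exists_pos_norm_le
  obtain ⟨R', hR'⟩ := exists_norm_le_of_norm_node_le |t| R
  have ht : t ∈ Icc (-|t|) |t| := abs_le.1 le_rfl
  have hg0 : ∀ x, x ∉ Metric.closedBall (0 : ℝ × ℝ) R → g x = 0 := fun x hx => by
    by_contra hne
    exact hx (by simpa using hR x (subset_tsupport g hne))
  have i1 : Integrable (Function.uncurry fun x k => f (node t x k) * g x)
      (volume.prod ((volume : Measure (ℝ × ℝ)).restrict box)) := by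
    refine integrable_prod_restrict_of_isCompact (by simp only [Function.uncurry_def]; fun_prop)
      (isCompact_closedBall 0 R) isCompact_box fun x k _ hx => ?_
    simp [hg0 x hx]
  have i2 : Integrable (Function.uncurry fun x k => f x * g (node t x k))
      (volume.prod ((volume : Measure (ℝ × ℝ)).restrict box)) := by
    refine integrable_prod_restrict_of_isCompact (by simp only [Function.uncurry_def]; fun_prop)
      (isCompact_closedBall 0 R') isCompact_box fun x k hk hx => ?_
    simp only [Function.uncurry_apply_pair]
    rw [hg0, mul_zero]
    intro hmem
    exact hx (by simpa using hR' t ht k hk x (by simpa using hmem))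
  have e1 : ∀ k, ∫ x, f (node t x k) * g x = ∫ x, f x * g (node t x (-k)) := by
    intro k
    have := (measurePreserving_node t k).integral_comp (nodeEquiv t k).measurableEmbedding
      (fun x => f x * g (node t x (-k)))
    rw [← this]
    simp only [node_node_neg]
  have e2 : ∫ k in box, ∫ x, f x * g (node t x (-k)) = ∫ k in box, ∫ x, f x * g (node t x k) := by
    rw [← integral_indicator isCompact_box.measurableSet,
      ← integral_indicator isCompact_box.measurableSet, ← integral_neg_eq_self]
    congr 1 with k
    by_cases hk : k ∈ box
    · rw [indicator_of_mem hk, indicator_of_mem (neg_mem_box.2 hk), neg_neg]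
    · rw [indicator_of_notMem hk, indicator_of_notMem (fun h => hk (neg_mem_box.1 h))]
  calc ∫ x, propagator t f x * g x
      = t / (2 * Real.pi) * ∫ x, ∫ k in box, f (node t x k) * g x := by
        rw [← integral_const_mul]
        congr 1 with x
        rw [propagator, integral_mul_const]
        ring
    _ = t / (2 * Real.pi) * ∫ x, ∫ k in box, f x * g (node t x k) := by
        rw [integral_integral_swap i1, integral_integral_swap i2]
        simp only [e1, e2]
    _ = ∫ x, f x * propagator t g x := by
        rw [← integral_const_mul]
        congr 1 with x
        rw [propagator, integral_const_mul]
        ring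

theorem propagator_eq_zero_of_lt_norm (T R : ℝ) : ∃ R', ∀ t ∈ Icc (-T) T, ∀ v : ℝ × ℝ → ℝ,
    (∀ x, R < ‖x‖ → v x = 0) → ∀ x, R' < ‖x‖ → propagator t v x = 0 := by
  obtain ⟨R', hR'⟩ := exists_norm_le_of_norm_node_le T R
  refine ⟨R', fun t ht v hv x hx => ?_⟩
  rw [propagator, setIntegral_congr_fun (g := fun _ => 0) isCompact_box.measurableSet]
  · simp
  · intro k hk
    refine hv _ ?_
    by_contra! hle
    exact (hR' t ht k hk x hle).not_gt hx

/-! ### Coordinates on the upper half plane -/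

/-- Horocyclic coordinates: the point `a + exp σ i`. -/
def pt (q : ℝ × ℝ) : ℍ := ⟨⟨q.1, Real.exp q.2⟩, Real.exp_pos q.2⟩

@[simp] theorem pt_re (q : ℝ × ℝ) : (pt q).re = q.1 := rfl
@[simp] theorem pt_im (q : ℝ × ℝ) : (pt q).im = Real.exp q.2 := rfl

/-- The point `a + η i` for `η > 0`. -/
def ofRe (p : ℝ × ℝ) : ℍ := pt (p.1, Real.log p.2)

theorem ofRe_exp (a σ : ℝ) : ofRe (a, Real.exp σ) = pt (a, σ) := by simp [ofRe]

theorem continuous_pt : Continuous pt :=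
  UpperHalfPlane.isEmbedding_coe.continuous_iff.2 <| by
    have : (fun q : ℝ × ℝ => ((pt q : ℍ) : ℂ)) =
        fun q => Complex.equivRealProdCLM.symm (q.1, Real.exp q.2) := by
      ext q
      simp [pt, Complex.ext_iff]
    change Continuous (fun q : ℝ × ℝ => ((pt q : ℍ) : ℂ))
    rw [this]
    fun_prop

/-- Horocyclic coordinates as a homeomorphism. -/
def ptHomeo : ℝ × ℝ ≃ₜ ℍ where
  toFun := pt
  invFun z := (z.re, Real.log z.im)
  left_inv q := by simp
  right_inv z := by
    refine UpperHalfPlane.ext_re_im rfl ?_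
    simp [Real.exp_log z.im_pos]
  continuous_toFun := continuous_pt
  continuous_invFun := UpperHalfPlane.continuous_re.prodMk
    (UpperHalfPlane.continuous_im.log fun z => z.im_ne_zero)

theorem pt_ptHomeo_symm (z : ℍ) : pt (ptHomeo.symm z) = z := ptHomeo.apply_symm_apply z

theorem ofRe_re_im (z : ℍ) : ofRe (z.re, z.im) = z := pt_ptHomeo_symm z

theorem measurable_ofRe : Measurable ofRe :=
  continuous_pt.measurable.comp (by fun_prop : Measurable fun p : ℝ × ℝ => (p.1, Real.log p.2))

theorem cosh_dist_pt (x q : ℝ × ℝ) : Real.cosh (dist (pt x) (pt q)) =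
    Real.cosh (q.2 - x.2) + (q.1 - x.1) ^ 2 / (2 * Real.exp (x.2 + q.2)) := by
  rw [UpperHalfPlane.cosh_dist', Real.exp_add, Real.cosh_eq, neg_sub, Real.exp_sub, Real.exp_sub]
  simp only [pt_re, pt_im]
  field_simp
  ring

/-! ### Riemannian measure in horocyclic coordinates: `exp (-σ) da dσ`. -/

theorem lintegral_volume_eq_ofRe {f : ℍ → ℝ≥0∞} (hf : Measurable f) :
    ∫⁻ z, f z = ∫⁻ p in {p : ℝ × ℝ | 0 < p.2}, ENNReal.ofReal (1 / p.2 ^ 2) * f (ofRe p) := by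
  have hpres : MeasurePreserving UpperHalfPlane.coe (volume.comap UpperHalfPlane.coe)
      (volume.restrict (range UpperHalfPlane.coe)) :=
    ⟨measurable_coe, by rw [measurableEmbedding_coe.map_comap]⟩
  have hrange : range UpperHalfPlane.coe = Complex.measurableEquivRealProd ⁻¹' {p | 0 < p.2} := by
    rw [range_coe]; rfl
  have hm : Measurable fun z : ℍ => ((1 / NNReal.mk z.im z.im_pos.le : ℝ≥0) ^ 2) := by
    have : Measurable fun z : ℍ => NNReal.mk z.im z.im_pos.le :=
      UpperHalfPlane.continuous_im.measurable.subtype_mk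
    exact (measurable_const.div this).pow_const 2
  have hval : ∀ z : ℍ, ENNReal.ofReal (1 / z.im ^ 2) =
      ((1 / NNReal.mk z.im z.im_pos.le : ℝ≥0) ^ 2 : ℝ≥0) := by
    intro z
    rw [ENNReal.ofReal_eq_coe_nnreal (by positivity)]
    congr 1
    ext
    simp
  rw [UpperHalfPlane.volume_def, lintegral_withDensity_eq_lintegral_mul _ hm.coe_nnreal_ennreal hf]
  have h1 := hpres.lintegral_comp_emb measurableEmbedding_coe
    (fun w : ℂ => ENNReal.ofReal (1 / w.im ^ 2) * f (ofRe (w.re, w.im)))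
  simp only [coe_re, coe_im, ofRe_re_im, hval] at h1
  simp only [Pi.mul_apply]
  rw [h1, hrange]
  have h2 := (Complex.volume_preserving_equiv_real_prod.restrict_preimage
    (measurableSet_lt measurable_const measurable_snd :
      MeasurableSet {p : ℝ × ℝ | 0 < p.2})).lintegral_comp_emb
    Complex.measurableEquivRealProd.measurableEmbedding
    (fun p => ENNReal.ofReal (1 / p.2 ^ 2) * f (ofRe p))
  rw [← h2]
  rfl

theorem lintegral_volume_eq_pt {f : ℍ → ℝ≥0∞} (hf : Measurable f) :
    ∫⁻ z, f z = ∫⁻ q : ℝ × ℝ, ENNReal.ofReal (Real.exp (-q.2)) * f (pt q) := by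
  rw [lintegral_volume_eq_ofRe hf]
  have hset : {p : ℝ × ℝ | 0 < p.2} = univ ×ˢ Ioi 0 := by ext; simp
  have hfm : Measurable fun p : ℝ × ℝ => f (ofRe p) := hf.comp measurable_ofRe
  have hfp : Measurable fun p : ℝ × ℝ => f (pt p) := hf.comp continuous_pt.measurable
  have hm1 : Measurable fun p : ℝ × ℝ => ENNReal.ofReal (1 / p.2 ^ 2) * f (ofRe p) :=
    (by fun_prop : Measurable fun p : ℝ × ℝ => ENNReal.ofReal (1 / p.2 ^ 2)).mul hfm
  have hm2 : Measurable fun p : ℝ × ℝ => ENNReal.ofReal (Real.exp (-p.2)) * f (pt p) :=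
    (by fun_prop : Measurable fun p : ℝ × ℝ => ENNReal.ofReal (Real.exp (-p.2))).mul hfp
  rw [hset, Measure.volume_eq_prod, ← Measure.prod_restrict, Measure.restrict_univ,
    lintegral_prod _ hm1.aemeasurable, lintegral_prod _ hm2.aemeasurable]
  refine lintegral_congr fun a => ?_
  have hderiv : ∀ x ∈ (univ : Set ℝ), HasDerivWithinAt Real.exp (Real.exp x) univ x :=
    fun x _ => (Real.hasDerivAt_exp x).hasDerivWithinAt
  have h := lintegral_image_eq_lintegral_abs_deriv_mul MeasurableSet.univ hderiv
    Real.exp_injective.injOn (fun η => ENNReal.ofReal (1 / η ^ 2) * f (ofRe (a, η)))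
  rw [image_univ, Real.range_exp, Measure.restrict_univ] at h
  rw [h]
  refine lintegral_congr fun σ => ?_
  rw [← mul_assoc, ← ENNReal.ofReal_mul (by positivity), ofRe_exp, abs_of_pos (Real.exp_pos σ)]
  congr 2
  rw [Real.exp_neg]
  field_simp

/-! ### The propagator as an integral against a rotation invariant kernel -/

/-- The kernel of the propagator. -/
def kernel (t : ℝ) (z w : ℍ) : ℝ := (2 * Real.pi * √(2 * (Real.cosh t - Real.cosh (dist z w))))⁻¹

theorem measurable_kernel (t : ℝ) (z : ℍ) : Measurable (kernel t z) := by
  unfold kernel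
  have : Continuous fun w => √(2 * (Real.cosh t - Real.cosh (dist z w))) := by fun_prop
  fun_prop (disch := exact this.measurable)

/-- The measure against which a function is integrated to obtain the value of the propagator. -/
def diskMeasure (t : ℝ) (z : ℍ) : Measure ℍ :=
  volume.withDensity fun w => ENNReal.ofReal (kernel t z w)

theorem lintegral_diskMeasure (t : ℝ) (z : ℍ) {f : ℍ → ℝ≥0∞} (hf : Measurable f) :
    ∫⁻ w, f w ∂diskMeasure t z = ∫⁻ w, ENNReal.ofReal (kernel t z w) * f w :=
  lintegral_withDensity_eq_lintegral_mul _ (measurable_kernel t z).ennreal_ofReal hf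

/-- The kernel depends on the distance alone and the volume is invariant, so isometries carry disc
measures to disc measures. -/
theorem lintegral_diskMeasure_smul (g : Matrix.SpecialLinearGroup (Fin 2) ℝ) (t : ℝ) (z : ℍ)
    {f : ℍ → ℝ≥0∞} (hf : Measurable f) :
    ∫⁻ w, f w ∂diskMeasure t (g • z) = ∫⁻ w, f (g • w) ∂diskMeasure t z := by
  have hg : Measurable fun w : ℍ => g • w := (isometry_smul ℍ g).continuous.measurable
  rw [lintegral_diskMeasure _ _ hf, lintegral_diskMeasure _ _ (f := fun w => f (g • w)) (hf.comp hg)]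
  rw [← (measurePreserving_smul (g : GL (Fin 2) ℝ) (volume : Measure ℍ)).lintegral_comp_emb
    (measurableEmbedding_const_smul (g : GL (Fin 2) ℝ))]
  refine lintegral_congr fun w => ?_
  have hw : ((g : GL (Fin 2) ℝ) • w) = g • w := rfl
  rw [hw]
  simp only [kernel, dist_smul]

theorem halfWidth_pos {t b : ℝ} (hb : |b| < t) : 0 < halfWidth t b := by
  have : Real.cosh b < Real.cosh t := by
    rw [Real.cosh_lt_cosh]
    exact hb.trans_le (le_abs_self t)
  unfold halfWidth
  have : 0 < Real.cosh t - Real.cosh b := by linarith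
  positivity

theorem halfWidth_sq {t b : ℝ} (hb : |b| < t) :
    halfWidth t b ^ 2 = 2 * Real.exp b * (Real.cosh t - Real.cosh b) := by
  have : Real.cosh b < Real.cosh t := by
    rw [Real.cosh_lt_cosh]
    exact hb.trans_le (le_abs_self t)
  have : 0 < Real.cosh t - Real.cosh b := by linarith
  rw [halfWidth, Real.sq_sqrt (by positivity)]

/-- On a horocycle the radicand of the kernel is quadratic in the displacement `ξ`. With `ξ =
halfWidth t b * sin φ` its root is a multiple of `cos φ`, which cancels the Jacobian. -/
theorem two_mul_cosh_sub_cosh_dist {t b : ℝ} (hb : |b| < t) (x : ℝ × ℝ) (ξ : ℝ) :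
    2 * (Real.cosh t - Real.cosh (dist (pt x) (pt (x.1 + Real.exp x.2 * ξ, x.2 + b)))) =
      Real.exp (-b) * (halfWidth t b ^ 2 - ξ ^ 2) := by
  rw [cosh_dist_pt, halfWidth_sq hb]
  simp only [add_sub_cancel_left]
  have e : Real.exp (x.2 + (x.2 + b)) = Real.exp x.2 ^ 2 * Real.exp b := by
    rw [← Real.exp_nat_mul, ← Real.exp_add]; congr 1; push_cast; ring
  rw [e, Real.exp_neg]
  field_simp
  ring

theorem kernel_eq_zero_of_le {t : ℝ} {z w : ℍ} (h : Real.cosh t ≤ Real.cosh (dist z w)) :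
    kernel t z w = 0 := by
  rw [kernel, Real.sqrt_eq_zero_of_nonpos (by linarith)]
  simp

/-- Fubini over horocycles, then `lintegral_image_eq_lintegral_abs_deriv_mul` with the sine
substitution on each. Outside the resulting interval, and for `|b| ≥ t`, the radicand is nonpositive
and the kernel vanishes, because the real square root and the inverse of zero are both zero. -/
theorem lintegral_diskMeasure_pt {t : ℝ} (ht : 0 < t) (x : ℝ × ℝ) {f : ℍ → ℝ≥0∞}
    (hf : Measurable f) :
    ∫⁻ w, f w ∂diskMeasure t (pt x) =
      ∫⁻ b in Ioo (-t) t, ∫⁻ φ in Ioo (-(Real.pi / 2)) (Real.pi / 2),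
        ENNReal.ofReal (Real.exp (-b / 2) / (2 * Real.pi)) *
          f (pt (x.1 + Real.exp x.2 * (halfWidth t b * Real.sin φ), x.2 + b)) := by
  have hkf : Measurable fun w => ENNReal.ofReal (kernel t (pt x) w) * f w :=
    (measurable_kernel t _).ennreal_ofReal.mul hf
  have hkp : Measurable fun q => ENNReal.ofReal (kernel t (pt x) (pt q)) * f (pt q) :=
    hkf.comp continuous_pt.measurable
  have hm : Measurable fun q : ℝ × ℝ => ENNReal.ofReal (Real.exp (-q.2)) *
      (ENNReal.ofReal (kernel t (pt x) (pt q)) * f (pt q)) :=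
    (by fun_prop : Measurable fun q : ℝ × ℝ => ENNReal.ofReal (Real.exp (-q.2))).mul hkp
  rw [lintegral_diskMeasure _ _ hf, lintegral_volume_eq_pt hkf, Measure.volume_eq_prod,
    lintegral_prod_symm _ hm.aemeasurable, ← lintegral_add_left_eq_self _ x.2,
    ← lintegral_indicator measurableSet_Ioo]
  refine lintegral_congr fun b => ?_
  by_cases hb : b ∈ Ioo (-t) t
  · rw [indicator_of_mem hb]
    have hb' : |b| < t := abs_lt.2 hb
    have hM := halfWidth_pos hb'
    set s : Set ℝ := Ioo (-(Real.pi / 2)) (Real.pi / 2)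
    set F : ℝ → ℝ := fun φ => x.1 + Real.exp x.2 * (halfWidth t b * Real.sin φ) with hF
    have hderiv : ∀ φ ∈ s, HasDerivWithinAt F (Real.exp x.2 * (halfWidth t b * Real.cos φ)) s φ :=
      fun φ _ => ((((Real.hasDerivAt_sin φ).const_mul _).const_mul _).const_add _).hasDerivWithinAt
    have hinj : InjOn F s := by
      intro φ hφ φ' hφ' heq
      have : Real.sin φ = Real.sin φ' := by
        simp only [hF] at heq
        have h1 := add_left_cancel heq
        have h2 := mul_left_cancel₀ (Real.exp_pos _).ne' h1
        exact mul_left_cancel₀ hM.ne' h2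
      exact Real.injOn_sin (Ioo_subset_Icc_self hφ) (Ioo_subset_Icc_self hφ') this
    have himg := lintegral_image_eq_lintegral_abs_deriv_mul measurableSet_Ioo hderiv hinj
      (fun a => ENNReal.ofReal (Real.exp (-(x.2 + b))) *
        (ENNReal.ofReal (kernel t (pt x) (pt (a, x.2 + b))) * f (pt (a, x.2 + b))))
    have hcontF : ContinuousOn F s := fun φ hφ => (hderiv φ hφ).continuousWithinAt
    have hmeas : MeasurableSet (F '' s) := measurableSet_Ioo.image_of_continuousOn_injOn hcontF hinj
    have hzero : ∀ a, a ∉ F '' s → kernel t (pt x) (pt (a, x.2 + b)) = 0 := by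
      intro a ha
      refine kernel_eq_zero_of_le ?_
      by_contra! hlt
      apply ha
      set ξ := Real.exp (-x.2) * (a - x.1) with hξ
      have hxi : a = x.1 + Real.exp x.2 * ξ := by
        rw [hξ, ← mul_assoc, ← Real.exp_add]; simp
      have h1 := two_mul_cosh_sub_cosh_dist hb' x ξ
      rw [← hxi] at h1
      have h2 : 0 < Real.exp (-b) * (halfWidth t b ^ 2 - ξ ^ 2) := by rw [← h1]; linarith
      have h3 : ξ ^ 2 < halfWidth t b ^ 2 := by
        have := (mul_pos_iff_of_pos_left (Real.exp_pos (-b))).1 h2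
        linarith
      have h4 : |ξ| < halfWidth t b := abs_lt_of_sq_lt_sq h3 hM.le
      have h5 : |ξ / halfWidth t b| < 1 := by
        rw [abs_div, abs_of_pos hM, div_lt_one hM]; exact h4
      obtain ⟨h6, h7⟩ := abs_lt.1 h5
      refine ⟨Real.arcsin (ξ / halfWidth t b), ⟨?_, ?_⟩, ?_⟩
      · exact Real.neg_pi_div_two_lt_arcsin.2 h6
      · exact Real.arcsin_lt_pi_div_two.2 h7
      · simp only [hF]
        rw [Real.sin_arcsin h6.le h7.le, hxi]
        field_simp
    calc ∫⁻ a, ENNReal.ofReal (Real.exp (-(x.2 + b))) *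
          (ENNReal.ofReal (kernel t (pt x) (pt (a, x.2 + b))) * f (pt (a, x.2 + b)))
        = ∫⁻ a in F '' s, ENNReal.ofReal (Real.exp (-(x.2 + b))) *
          (ENNReal.ofReal (kernel t (pt x) (pt (a, x.2 + b))) * f (pt (a, x.2 + b))) := by
          rw [← lintegral_indicator hmeas]
          refine lintegral_congr fun a => ?_
          by_cases ha : a ∈ F '' s
          · rw [indicator_of_mem ha]
          · rw [indicator_of_notMem ha, hzero a ha]; simp
      _ = _ := by
          rw [himg]
          refine setLIntegral_congr_fun measurableSet_Ioo fun φ hφ => ?_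
          have hcos : 0 < Real.cos φ := Real.cos_pos_of_mem_Ioo hφ
          have h1 := two_mul_cosh_sub_cosh_dist hb' x (halfWidth t b * Real.sin φ)
          have h2 : Real.exp (-b) * (halfWidth t b ^ 2 - (halfWidth t b * Real.sin φ) ^ 2) =
              (Real.exp (-b / 2) * (halfWidth t b * Real.cos φ)) ^ 2 := by
            have hb2 : Real.exp (-b) = Real.exp (-b / 2) * Real.exp (-b / 2) := by
              rw [← Real.exp_add]; congr 1; ring
            rw [hb2]
            linear_combination (-Real.exp (-b / 2) ^ 2 * halfWidth t b ^ 2) *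
              Real.sin_sq_add_cos_sq φ
          have h3 : kernel t (pt x) (pt (F φ, x.2 + b)) =
              (2 * Real.pi * (Real.exp (-b / 2) * (halfWidth t b * Real.cos φ)))⁻¹ := by
            rw [kernel, h1, h2, Real.sqrt_sq (by positivity)]
          rw [h3, ← mul_assoc, ← mul_assoc, ← ENNReal.ofReal_mul (by positivity),
            ← ENNReal.ofReal_mul (by positivity)]
          congr 2
          rw [abs_of_pos (by positivity), show -(x.2 + b) = -x.2 + (-b / 2 + -b / 2) by ring,
            Real.exp_add, Real.exp_add, Real.exp_neg]
          field_simp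
  · rw [indicator_of_notMem hb, ← lintegral_zero (μ := (volume : Measure ℝ))]
    refine lintegral_congr fun a => ?_
    have : kernel t (pt x) (pt (a, x.2 + b)) = 0 := by
      refine kernel_eq_zero_of_le ?_
      rw [cosh_dist_pt]
      simp only [add_sub_cancel_left]
      have h1 : Real.cosh t ≤ Real.cosh b := by
        rw [Real.cosh_le_cosh, abs_of_pos ht]
        by_contra! hlt
        exact hb (abs_lt.1 hlt)
      have : 0 ≤ (a - x.1) ^ 2 / (2 * Real.exp (x.2 + (x.2 + b))) := by positivity
      linarith
    simp [this]

theorem integral_diskMeasure_pt {t : ℝ} (ht : 0 < t) (x : ℝ × ℝ) {f : ℍ → ℝ} (hf : Continuous f) :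
    ∫ w, f w ∂diskMeasure t (pt x) = Real.exp (x.2 / 2) *
      propagator t (fun q => Real.exp (-q.2 / 2) * f (pt q)) x := by
  set S : Set (ℝ × ℝ) := Ioo (-t) t ×ˢ Ioo (-(Real.pi / 2)) (Real.pi / 2) with hS
  have hSm : MeasurableSet S := measurableSet_Ioo.prod measurableSet_Ioo
  set d : ℝ × ℝ → ℝ := fun p => Real.exp (-p.1 / 2) / (2 * Real.pi) with hd
  have hdm : Measurable d := by fun_prop
  set Φ : ℝ × ℝ → ℍ := fun p =>
    pt (x.1 + Real.exp x.2 * (halfWidth t p.1 * Real.sin p.2), x.2 + p.1) with hΦ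
  have hΦc : Continuous Φ := continuous_pt.comp (by fun_prop)
  have hmap : diskMeasure t (pt x) =
      (((volume : Measure (ℝ × ℝ)).restrict S).withDensity fun p => ENNReal.ofReal (d p)).map Φ := by
    refine Measure.ext_of_lintegral _ fun f hf => ?_
    have hm : Measurable fun p => ENNReal.ofReal (d p) * f (Φ p) :=
      hdm.ennreal_ofReal.mul (hf.comp hΦc.measurable)
    rw [lintegral_diskMeasure_pt ht x hf, lintegral_map hf hΦc.measurable,
      lintegral_withDensity_eq_lintegral_mul _ hdm.ennreal_ofReal (g := fun p => f (Φ p))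
      (hf.comp hΦc.measurable),
      hS, Measure.volume_eq_prod, ← Measure.prod_restrict]
    exact (lintegral_prod _ hm.aemeasurable).symm
  rw [hmap, integral_map hΦc.measurable.aemeasurable hf.aestronglyMeasurable,
    integral_withDensity_eq_integral_toReal_smul hdm.ennreal_ofReal
      (ae_of_all _ fun _ => ENNReal.ofReal_lt_top), propagator_eq (by
        have := continuous_pt
        fun_prop)]
  have hd0 : ∀ p, (ENNReal.ofReal (d p)).toReal = d p := fun p =>
    ENNReal.toReal_ofReal (by positivity)
  simp only [hd0, smul_eq_mul]
  have hint : IntegrableOn (fun p => d p * f (Φ p)) S (volume.prod volume) := by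
    have hc : Continuous fun p => d p * f (Φ p) := by fun_prop
    exact (hc.continuousOn.integrableOn_compact (isCompact_Icc.prod isCompact_Icc)).mono_set
      (Set.prod_mono Ioo_subset_Icc_self Ioo_subset_Icc_self)
  rw [Measure.volume_eq_prod, hS, setIntegral_prod _ hint,
    intervalIntegral.integral_of_le (by linarith), integral_Ioc_eq_integral_Ioo,
    ← integral_const_mul, ← integral_const_mul]
  refine setIntegral_congr_fun measurableSet_Ioo fun b _ => ?_
  rw [intervalIntegral.integral_of_le (by linarith [Real.pi_pos]), integral_Ioc_eq_integral_Ioo,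
    ← integral_const_mul, ← integral_const_mul]
  refine setIntegral_congr_fun measurableSet_Ioo fun φ _ => ?_
  simp only [hd, hΦ]
  rw [show -(x.2 + b) / 2 = -(x.2 / 2) + -b / 2 by ring, Real.exp_add, Real.exp_neg, mul_assoc]
  field_simp

/-! ### Rotations around the origin -/

/-- Rotating by `θ`, the real part of the image has as numerator a continuous function of `θ` equal
to `z.re` at `0` and to `-z.re` at `π / 2`. The intermediate value theorem gives a zero. -/
theorem exists_rotation_re_eq_zero (z : ℍ) : ∃ g : Matrix.SpecialLinearGroup (Fin 2) ℝ,
    g • UpperHalfPlane.I = UpperHalfPlane.I ∧ (g • z).re = 0 := by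
  have hIVT : ∃ θ : ℝ, Real.cos θ * Real.sin θ * (1 - z.re ^ 2 - z.im ^ 2) +
      (Real.cos θ ^ 2 - Real.sin θ ^ 2) * z.re = 0 := by
    have hc : Continuous fun θ : ℝ => Real.cos θ * Real.sin θ * (1 - z.re ^ 2 - z.im ^ 2) +
      (Real.cos θ ^ 2 - Real.sin θ ^ 2) * z.re := by fun_prop
    have h0 := intermediate_value_uIcc (a := 0) (b := Real.pi / 2) hc.continuousOn
    have hm : (0 : ℝ) ∈ uIcc z.re (-z.re) := by
      rw [mem_uIcc]
      rcases le_total z.re 0 with h | h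
      · exact .inl ⟨h, by linarith⟩
      · exact .inr ⟨by linarith, h⟩
    obtain ⟨θ, -, hθ⟩ := h0 (by simpa using hm)
    exact ⟨θ, hθ⟩
  obtain ⟨θ, hθ⟩ := hIVT
  have hdet : Matrix.det !![Real.cos θ, Real.sin θ; -Real.sin θ, Real.cos θ] = 1 := by
    rw [Matrix.det_fin_two_of]
    linear_combination Real.sin_sq_add_cos_sq θ
  set g : Matrix.SpecialLinearGroup (Fin 2) ℝ := ⟨_, hdet⟩ with hg
  have hsmul : ∀ w : ℍ, ((g • w : ℍ) : ℂ) =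
      (Real.cos θ * w + Real.sin θ) / (-Real.sin θ * w + Real.cos θ) := by
    intro w
    rw [coe_specialLinearGroup_apply]
    simp [hg]
  refine ⟨g, ?_, ?_⟩
  · ext
    rw [hsmul, coe_I]
    have hne : (-(Real.sin θ : ℂ) * Complex.I + (Real.cos θ : ℂ)) ≠ 0 := by
      intro h
      have h1 := congrArg Complex.re h
      have h2 := congrArg Complex.im h
      simp only [Complex.add_re, Complex.add_im, Complex.mul_re, Complex.mul_im, Complex.neg_re,
        Complex.neg_im, Complex.ofReal_re, Complex.ofReal_im, Complex.I_re, Complex.I_im,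
        Complex.zero_re, Complex.zero_im] at h1 h2
      have := Real.sin_sq_add_cos_sq θ
      have h3 : Real.cos θ = 0 := by linarith
      have h4 : Real.sin θ = 0 := by linarith
      rw [h3, h4] at this
      norm_num at this
    rw [div_eq_iff hne]
    linear_combination (Real.sin θ : ℂ) * Complex.I_sq
  · rw [← coe_re, hsmul, Complex.div_re, ← add_div]
    refine div_eq_zero_iff.2 (.inl ?_)
    simp only [Complex.add_re, Complex.add_im, Complex.mul_re, Complex.mul_im, Complex.neg_re,
        Complex.neg_im, Complex.ofReal_re, Complex.ofReal_im, coe_re, coe_im]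
    linear_combination hθ

/-- Once on the imaginary axis, the point has height `exp (±r)`. In the upper case the half turn `w
↦ -1 / w` about the origin exchanges the two. -/
theorem exists_rotation (z : ℍ) : ∃ g : Matrix.SpecialLinearGroup (Fin 2) ℝ,
    g • UpperHalfPlane.I = UpperHalfPlane.I ∧ g • z = pt (0, -radius z) := by
  have hrad : ∀ w : ℍ, w.re = 0 → radius w = |Real.log w.im| := by
    intro w hw
    rw [radius, UpperHalfPlane.dist_of_re_eq (by simp [hw]), I_im, Real.log_one, Real.dist_eq,
      sub_zero]
  obtain ⟨g, hgI, hg⟩ := exists_rotation_re_eq_zero z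
  have hr : radius (g • z) = radius z := by
    rw [radius, ← hgI, dist_smul, radius]
  rcases le_total (Real.log (g • z).im) 0 with h | h
  · refine ⟨g, hgI, UpperHalfPlane.ext_re_im (by simpa using hg) ?_⟩
    rw [← hr, hrad _ hg, abs_of_nonpos h, neg_neg, pt_im, Real.exp_log (im_pos _)]
  · have hdet : Matrix.det !![0, (-1 : ℝ); 1, 0] = 1 := by simp [Matrix.det_fin_two_of]
    set S : Matrix.SpecialLinearGroup (Fin 2) ℝ := ⟨_, hdet⟩ with hS
    have hSz : ∀ w : ℍ, ((S • w : ℍ) : ℂ) = -1 / w := by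
      intro w
      rw [coe_specialLinearGroup_apply]
      simp [hS]
    refine ⟨S * g, ?_, ?_⟩
    · rw [mul_smul, hgI]
      ext
      rw [hSz, coe_I]
      field_simp
      simp
    · rw [mul_smul]
      ext
      rw [hSz, ← hr, hrad _ hg, abs_of_nonneg h]
      have hw : ((g • z : ℍ) : ℂ) = ((g • z).im : ℂ) * Complex.I := by
        rw [← re_add_im (g • z), hg]; simp
      have hp : ((pt (0, -Real.log (g • z).im) : ℍ) : ℂ) = (((g • z).im)⁻¹ : ℝ) * Complex.I := by
        apply Complex.ext
        · simp [pt]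
        · simp [pt, Real.exp_neg, Real.exp_log (im_pos _)]
      have hne : (((g • z).im : ℝ) : ℂ) ≠ 0 := by exact_mod_cast im_ne_zero _
      rw [hp, hw]
      push_cast
      field_simp
      simp

theorem radius_smul {g : Matrix.SpecialLinearGroup (Fin 2) ℝ}
    (hg : g • UpperHalfPlane.I = UpperHalfPlane.I) (z : ℍ) : radius (g • z) = radius z := by
  rw [radius]
  nth_rewrite 1 [← hg]
  rw [dist_smul, radius]

theorem continuous_radius : Continuous radius := continuous_id.dist continuous_const

theorem cosh_radius_pt (q : ℝ × ℝ) :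
    Real.cosh (radius (pt q)) = Real.cosh q.2 + q.1 ^ 2 / (2 * Real.exp q.2) := by
  have : UpperHalfPlane.I = pt (0, 0) := UpperHalfPlane.ext_re_im (by simp) (by simp)
  rw [radius, dist_comm, this, cosh_dist_pt]
  simp

/-- Integrals of radial functions only depend on the radius of the centre. -/
theorem lintegral_diskMeasure_radial {F : ℝ → ℝ≥0∞} (hF : Measurable F) (t : ℝ) (z : ℍ) :
    ∫⁻ w, F (radius w) ∂diskMeasure t z =
      ∫⁻ w, F (radius w) ∂diskMeasure t (pt (0, -radius z)) := by
  obtain ⟨g, hgI, hg⟩ := exists_rotation z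
  rw [← hg, lintegral_diskMeasure_smul g t z (f := fun w => F (radius w))
    (hF.comp continuous_radius.measurable)]
  simp only [radius_smul hgI]

/-! ### Geodesic polar coordinates -/

/-- The reciprocal height of the point with geodesic polar coordinates `(d, θ)`. -/
def polarDen (p : ℝ × ℝ) : ℝ := Real.cosh p.1 - Real.sinh p.1 * Real.cos p.2

/-- Horocyclic coordinates of the point with geodesic polar coordinates `(d, θ)`. -/
def geo (p : ℝ × ℝ) : ℝ × ℝ :=
  (Real.sinh p.1 * Real.sin p.2 / polarDen p, -Real.log (polarDen p))

theorem abs_sinh_lt_cosh (d : ℝ) : |Real.sinh d| < Real.cosh d := by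
  refine abs_lt_of_sq_lt_sq ?_ (Real.cosh_pos d).le
  have := Real.cosh_sq d
  linarith

theorem polarDen_pos (p : ℝ × ℝ) : 0 < polarDen p := by
  have h1 := abs_sinh_lt_cosh p.1
  have h2 : |Real.sinh p.1 * Real.cos p.2| ≤ |Real.sinh p.1| := by
    rw [abs_mul]
    exact mul_le_of_le_one_right (abs_nonneg _) (Real.abs_cos_le_one _)
  have h3 := le_abs_self (Real.sinh p.1 * Real.cos p.2)
  unfold polarDen
  linarith

/-- This identity says that the curves of constant `θ` have unit hyperbolic speed. It also evaluates
the Jacobian of `geo`. -/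
theorem sq_add_sq_eq_polarDen_sq (p : ℝ × ℝ) :
    Real.sin p.2 ^ 2 + (Real.cos p.2 * Real.cosh p.1 - Real.sinh p.1) ^ 2 = polarDen p ^ 2 := by
  unfold polarDen
  linear_combination (1 + Real.sinh p.1 ^ 2 - Real.cosh p.1 ^ 2) * Real.sin_sq_add_cos_sq p.2 +
    (Real.cos p.2 ^ 2 - 1 + Real.sin p.2 ^ 2 - 1 + Real.cos p.2 ^ 2) * Real.cosh_sq p.1 +
    Real.sin_sq_add_cos_sq p.2

theorem continuous_polarDen : Continuous polarDen := by unfold polarDen; fun_prop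

theorem continuous_geo : Continuous geo :=
  ((by fun_prop : Continuous fun p : ℝ × ℝ => Real.sinh p.1 * Real.sin p.2).div
    continuous_polarDen fun p => (polarDen_pos p).ne').prodMk
    (continuous_polarDen.log fun p => (polarDen_pos p).ne').neg

/-- The derivative of `geo`. -/
def geoFDeriv (p : ℝ × ℝ) : ℝ × ℝ →L[ℝ] ℝ × ℝ :=
  (Matrix.toLin (.finTwoProd ℝ) (.finTwoProd ℝ)
    !![Real.sin p.2 / polarDen p ^ 2,
        Real.sinh p.1 * (Real.cos p.2 * Real.cosh p.1 - Real.sinh p.1) / polarDen p ^ 2;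
      (Real.cos p.2 * Real.cosh p.1 - Real.sinh p.1) / polarDen p,
        -(Real.sinh p.1 * Real.sin p.2) / polarDen p]).toContinuousLinearMap

theorem hasFDerivAt_geo (p : ℝ × ℝ) : HasFDerivAt geo (geoFDeriv p) p := by
  have hs : HasFDerivAt (fun p : ℝ × ℝ => Real.sinh p.1)
      (Real.cosh p.1 • ContinuousLinearMap.fst ℝ ℝ ℝ) p :=
    (Real.hasDerivAt_sinh p.1).comp_hasFDerivAt p hasFDerivAt_fst
  have hc : HasFDerivAt (fun p : ℝ × ℝ => Real.cosh p.1)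
      (Real.sinh p.1 • ContinuousLinearMap.fst ℝ ℝ ℝ) p :=
    (Real.hasDerivAt_cosh p.1).comp_hasFDerivAt p hasFDerivAt_fst
  have hsin : HasFDerivAt (fun p : ℝ × ℝ => Real.sin p.2)
      (Real.cos p.2 • ContinuousLinearMap.snd ℝ ℝ ℝ) p :=
    (Real.hasDerivAt_sin p.2).comp_hasFDerivAt p hasFDerivAt_snd
  have hcos : HasFDerivAt (fun p : ℝ × ℝ => Real.cos p.2)
      (-Real.sin p.2 • ContinuousLinearMap.snd ℝ ℝ ℝ) p :=
    (Real.hasDerivAt_cos p.2).comp_hasFDerivAt p hasFDerivAt_snd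
  have hD : HasFDerivAt polarDen _ p := hc.sub (hs.mul hcos)
  have hpos := (polarDen_pos p).ne'
  have hinv := (hasDerivAt_inv hpos).comp_hasFDerivAt p hD
  have hlog := (Real.hasDerivAt_log hpos).comp_hasFDerivAt p hD
  have h := ((hs.mul hsin).mul hinv).prodMk hlog.neg
  unfold geoFDeriv
  rw [Matrix.toLin_finTwoProd_toContinuousLinearMap]
  refine (h.congr_of_eventuallyEq (.of_forall fun q => ?_)).congr_fderiv ?_
  · simp [geo, div_eq_mul_inv]
  · refine ContinuousLinearMap.prod_ext ?_ ?_ <;>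
      refine ContinuousLinearMap.ext_ring ?_ <;> refine Prod.ext ?_ ?_ <;> simp <;> field_simp <;>
      try unfold polarDen
    · linear_combination Real.sin p.2 * Real.cosh_sq p.1
    · ring
    · linear_combination (-Real.sinh p.1 ^ 2) * Real.sin_sq_add_cos_sq p.2

theorem det_geoFDeriv (p : ℝ × ℝ) : (geoFDeriv p).det = -(Real.sinh p.1 / polarDen p) := by
  have hpos := (polarDen_pos p).ne'
  unfold geoFDeriv
  simp only [LinearMap.det_toContinuousLinearMap, LinearMap.det_toLin, Matrix.det_fin_two_of]
  field_simp
  rw [← sq_add_sq_eq_polarDen_sq]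
  ring

theorem cosh_radius_geo (p : ℝ × ℝ) : Real.cosh (radius (pt (geo p))) = Real.cosh p.1 := by
  have hpos := polarDen_pos p
  rw [cosh_radius_pt]
  simp only [geo]
  rw [Real.cosh_eq, neg_neg, Real.exp_neg, Real.exp_log hpos]
  field_simp
  unfold polarDen
  linear_combination Real.sinh p.1 ^ 2 * Real.sin_sq_add_cos_sq p.2 - Real.cosh_sq p.1

theorem injOn_geo : InjOn geo (Ioi 0 ×ˢ Ioo (-Real.pi) Real.pi) := by
  rintro p ⟨hp1, hp2⟩ q ⟨hq1, hq2⟩ h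
  have h1 : p.1 = q.1 := by
    have := cosh_radius_geo p
    rw [h, cosh_radius_geo] at this
    exact Real.cosh_strictMonoOn.injOn (mem_Ici.2 (le_of_lt hp1)) (mem_Ici.2 (le_of_lt hq1))
      this.symm
  have hs : Real.sinh q.1 ≠ 0 := (Real.sinh_pos_iff.2 hq1).ne'
  have hD : polarDen p = polarDen q := by
    have := congrArg Prod.snd h
    simp only [geo, neg_inj] at this
    exact Real.log_injOn_pos (polarDen_pos p) (polarDen_pos q) this
  have hcos : Real.cos p.2 = Real.cos q.2 := by
    simp only [polarDen, h1, sub_right_inj] at hD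
    exact mul_left_cancel₀ hs hD
  have hsin : Real.sin p.2 = Real.sin q.2 := by
    have := congrArg Prod.fst h
    simp only [geo, hD, h1] at this
    rw [div_left_inj' (polarDen_pos q).ne'] at this
    exact mul_left_cancel₀ hs this
  refine Prod.ext h1 ?_
  rw [← Complex.arg_cos_add_sin_mul_I (Ioo_subset_Ioc_self hp2),
    ← Complex.arg_cos_add_sin_mul_I (Ioo_subset_Ioc_self hq2), ← Complex.ofReal_cos,
    ← Complex.ofReal_sin, hcos, hsin, Complex.ofReal_cos, Complex.ofReal_sin]

/-- Radius and angle are solved for explicitly, and the identity for `cosh (radius (pt q))` puts the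
resulting direction `w` on the unit circle. The missing angle `π` occurs only on the null set `q.1 =
0`. -/
theorem mem_image_geo {q : ℝ × ℝ} (hq : q.1 ≠ 0) :
    q ∈ geo '' (Ioi 0 ×ˢ Ioo (-Real.pi) Real.pi) := by
  set d := radius (pt q) with hd
  have hcosh : Real.cosh d = Real.cosh q.2 + q.1 ^ 2 / (2 * Real.exp q.2) := cosh_radius_pt q
  have hd0 : 0 < d := by
    refine (dist_nonneg (x := pt q) (y := UpperHalfPlane.I)).lt_of_ne fun h0 => ?_
    have h1 := Real.one_le_cosh q.2
    have h2 : 0 < q.1 ^ 2 / (2 * Real.exp q.2) := by positivity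
    rw [hd, radius, ← h0, Real.cosh_zero] at hcosh
    linarith
  have hs := Real.sinh_pos_iff.2 hd0
  set w : ℂ := ⟨(Real.cosh d - Real.exp (-q.2)) / Real.sinh d,
    q.1 * Real.exp (-q.2) / Real.sinh d⟩ with hw
  have hnorm : ‖w‖ = 1 := by
    rw [Complex.norm_def, Real.sqrt_eq_one, Complex.normSq_mk]
    field_simp
    have h1 := Real.cosh_sq d
    have h2 : 2 * Real.exp (-q.2) * Real.cosh d = 1 + Real.exp (-q.2) ^ 2 +
        q.1 ^ 2 * Real.exp (-q.2) ^ 2 := by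
      rw [hcosh, Real.cosh_eq, Real.exp_neg]
      field_simp
    linear_combination h1 - h2
  have hw0 : w ≠ 0 := by
    intro h
    rw [h] at hnorm
    simp at hnorm
  have hcos : Real.cos w.arg = (Real.cosh d - Real.exp (-q.2)) / Real.sinh d := by
    rw [Complex.cos_arg hw0, hnorm, div_one]
  have hsin : Real.sin w.arg = q.1 * Real.exp (-q.2) / Real.sinh d := by
    rw [Complex.sin_arg, hnorm, div_one]
  have hden : polarDen (d, w.arg) = Real.exp (-q.2) := by
    simp only [polarDen, hcos]
    field_simp
    ring
  refine ⟨(d, w.arg), ⟨hd0, Complex.neg_pi_lt_arg w, (Complex.arg_le_pi w).lt_of_ne ?_⟩, ?_⟩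
  · intro hpi
    rw [Complex.arg_eq_pi_iff] at hpi
    have : q.1 * Real.exp (-q.2) / Real.sinh d = 0 := hpi.2
    have h3 : q.1 * Real.exp (-q.2) / Real.sinh d ≠ 0 := by positivity
    exact h3 this
  · refine Prod.ext ?_ ?_
    · simp only [geo, hden, hsin]
      field_simp
    · simp only [geo, hden, Real.log_exp, neg_neg]

theorem lintegral_volume_eq_geo {f : ℍ → ℝ≥0∞} (hf : Measurable f) :
    ∫⁻ z, f z = ∫⁻ d in Ioi (0 : ℝ), ∫⁻ θ in Ioo (-Real.pi) Real.pi,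
      ENNReal.ofReal (Real.sinh d) * f (pt (geo (d, θ))) := by
  set T : Set (ℝ × ℝ) := Ioi 0 ×ˢ Ioo (-Real.pi) Real.pi with hT
  have hTm : MeasurableSet T := measurableSet_Ioi.prod measurableSet_Ioo
  have hae : geo '' T =ᵐ[volume] (univ : Set (ℝ × ℝ)) := by
    have A : (geo '' T)ᶜ ⊆ LinearMap.ker (LinearMap.fst ℝ ℝ ℝ) := by
      intro q hq
      by_contra hne
      exact hq (mem_image_geo hne)
    have B : volume (LinearMap.ker (LinearMap.fst ℝ ℝ ℝ) : Set (ℝ × ℝ)) = 0 := by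
      apply Measure.addHaar_submodule
      rw [Ne, LinearMap.ker_eq_top]
      intro h
      have : (LinearMap.fst ℝ ℝ ℝ) (1, 0) = (0 : ℝ × ℝ →ₗ[ℝ] ℝ) (1, 0) := by rw [h]
      simp at this
    simp only [ae_eq_univ]
    exact le_antisymm ((measure_mono A).trans (le_of_eq B)) bot_le
  have hm : Measurable fun p : ℝ × ℝ => ENNReal.ofReal (Real.sinh p.1) * f (pt (geo p)) :=
    (by fun_prop : Measurable fun p : ℝ × ℝ => ENNReal.ofReal (Real.sinh p.1)).mul
      (hf.comp (continuous_pt.comp continuous_geo).measurable)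
  rw [lintegral_volume_eq_pt hf, ← setLIntegral_univ, ← setLIntegral_congr hae,
    lintegral_image_eq_lintegral_abs_det_fderiv_mul _ hTm
      (fun p _ => (hasFDerivAt_geo p).hasFDerivWithinAt) injOn_geo]
  have e : ∀ p ∈ T, ENNReal.ofReal |(geoFDeriv p).det| *
      (ENNReal.ofReal (Real.exp (-(geo p).2)) * f (pt (geo p))) =
      ENNReal.ofReal (Real.sinh p.1) * f (pt (geo p)) := by
    intro p hp
    have hs := Real.sinh_pos_iff.2 hp.1
    have hpos := polarDen_pos p
    rw [det_geoFDeriv, abs_neg, abs_of_pos (by positivity), ← mul_assoc,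
      ← ENNReal.ofReal_mul (by positivity)]
    congr 2
    simp only [geo, neg_neg]
    rw [Real.exp_log hpos]
    field_simp
  rw [setLIntegral_congr_fun hTm e, hT, Measure.volume_eq_prod, ← Measure.prod_restrict,
    lintegral_prod _ hm.aemeasurable]

/-- The radius of the point of a geodesic disc of radius `t` with latitude `α`. -/
def latRadius (t α : ℝ) : ℝ := 2 * Real.arsinh (Real.sinh (t / 2) * Real.sin α)

theorem sinh_latRadius (t α : ℝ) : Real.sinh (latRadius t α) =
    2 * (Real.sinh (t / 2) * Real.sin α) * √(1 + (Real.sinh (t / 2) * Real.sin α) ^ 2) := by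
  rw [latRadius, Real.sinh_two_mul, Real.sinh_arsinh, Real.cosh_arsinh]

theorem cosh_latRadius (t α : ℝ) : Real.cosh (latRadius t α) =
    1 + 2 * (Real.sinh (t / 2) * Real.sin α) ^ 2 := by
  rw [latRadius, Real.cosh_two_mul, Real.sinh_arsinh, Real.cosh_arsinh,
    Real.sq_sqrt (by positivity)]
  ring

/-- The substitution `sinh (d / 2) = sinh (t / 2) sin α` turns `2 (cosh t - cosh d)` into the square
of `2 sinh (t / 2) cos α`, and the cosine cancels against the Jacobian. What remains is smooth in
`t`. -/
theorem lintegral_diskMeasure_geo {t : ℝ} (ht : 0 < t) {f : ℍ → ℝ≥0∞} (hf : Measurable f) :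
    ∫⁻ w, f w ∂diskMeasure t UpperHalfPlane.I =
      ∫⁻ α in Ioo 0 (Real.pi / 2), ∫⁻ θ in Ioo (-Real.pi) Real.pi,
        ENNReal.ofReal (Real.sinh (t / 2) * Real.sin α / Real.pi) *
          f (pt (geo (latRadius t α, θ))) := by
  have hS : 0 < Real.sinh (t / 2) := Real.sinh_pos_iff.2 (by linarith)
  set s : Set ℝ := Ioo 0 (Real.pi / 2) with hs
  have hcosht : Real.cosh t = 1 + 2 * Real.sinh (t / 2) ^ 2 := by
    have := Real.cosh_two_mul (t / 2)
    rw [mul_div_cancel₀ _ two_ne_zero, Real.cosh_sq] at this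
    linarith
  have hderiv : ∀ α ∈ s, HasDerivWithinAt (latRadius t)
      (2 * ((√(1 + (Real.sinh (t / 2) * Real.sin α) ^ 2))⁻¹ *
        (Real.sinh (t / 2) * Real.cos α))) s α := fun α _ => by
    have := (((Real.hasDerivAt_sin α).const_mul (Real.sinh (t / 2))).arsinh).const_mul 2
    exact (this.congr_deriv (by simp)).hasDerivWithinAt
  have hinj : InjOn (latRadius t) s := by
    intro α hα β hβ h
    have h1 := Real.arsinh_injective (mul_left_cancel₀ two_ne_zero h)
    have h2 := mul_left_cancel₀ hS.ne' h1
    have hpi := Real.pi_pos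
    exact Real.injOn_sin ⟨by linarith [hα.1], hα.2.le⟩ ⟨by linarith [hβ.1], hβ.2.le⟩ h2
  have himg : latRadius t '' s = Ioo 0 t := by
    ext d
    constructor
    · rintro ⟨α, hα, rfl⟩
      have h1 : 0 < Real.sin α := Real.sin_pos_of_pos_of_lt_pi hα.1 (by linarith [hα.2, Real.pi_pos])
      have h2 : Real.sin α < 1 := by
        rw [← Real.sin_pi_div_two]
        exact Real.sin_lt_sin_of_lt_of_le_pi_div_two (by linarith [hα.1, Real.pi_pos]) le_rfl hα.2
      refine ⟨by have := Real.arsinh_pos_iff.2 (mul_pos hS h1); unfold latRadius; linarith, ?_⟩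
      have : Real.arsinh (Real.sinh (t / 2) * Real.sin α) < Real.arsinh (Real.sinh (t / 2)) :=
        Real.arsinh_lt_arsinh.2 (mul_lt_of_lt_one_right hS h2)
      rw [Real.arsinh_sinh] at this
      unfold latRadius; linarith
    · rintro ⟨h0, h1⟩
      have a1 : 0 < Real.sinh (d / 2) := Real.sinh_pos_iff.2 (by linarith)
      have a2 : Real.sinh (d / 2) < Real.sinh (t / 2) := Real.sinh_lt_sinh.2 (by linarith)
      have a3 : 0 < Real.sinh (d / 2) / Real.sinh (t / 2) := by positivity
      have a4 : Real.sinh (d / 2) / Real.sinh (t / 2) < 1 := (div_lt_one hS).2 a2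
      refine ⟨Real.arcsin (Real.sinh (d / 2) / Real.sinh (t / 2)),
        ⟨Real.arcsin_pos.2 a3, Real.arcsin_lt_pi_div_two.2 a4⟩, ?_⟩
      rw [latRadius, Real.sin_arcsin (by linarith) a4.le, mul_div_cancel₀ _ hS.ne',
        Real.arsinh_sinh]
      ring
  have hker : ∀ p : ℝ × ℝ, kernel t UpperHalfPlane.I (pt (geo p)) =
      (2 * Real.pi * √(2 * (Real.cosh t - Real.cosh p.1)))⁻¹ := by
    intro p
    rw [kernel, dist_comm, ← radius, cosh_radius_geo]
  have hkf : Measurable fun w => ENNReal.ofReal (kernel t UpperHalfPlane.I w) * f w :=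
    (measurable_kernel t _).ennreal_ofReal.mul hf
  set g : ℝ → ℝ≥0∞ := fun d => ∫⁻ θ in Ioo (-Real.pi) Real.pi, ENNReal.ofReal (Real.sinh d) *
    (ENNReal.ofReal (kernel t UpperHalfPlane.I (pt (geo (d, θ)))) * f (pt (geo (d, θ)))) with hg
  have hzero : ∀ d, t ≤ d → g d = 0 := by
    intro d hd
    simp only [hg]
    rw [← lintegral_zero]
    refine lintegral_congr fun θ => ?_
    rw [hker, Real.sqrt_eq_zero_of_nonpos]
    · simp
    · have : Real.cosh t ≤ Real.cosh d := by
        rw [Real.cosh_le_cosh, abs_of_pos ht, abs_of_pos (ht.trans_le hd)]; exact hd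
      simp only
      linarith
  rw [lintegral_diskMeasure _ _ hf, lintegral_volume_eq_geo hkf]
  have hsplit : ∫⁻ d in Ioi (0 : ℝ), g d = ∫⁻ d in Ioo 0 t, g d := by
    rw [← lintegral_indicator measurableSet_Ioi, ← lintegral_indicator measurableSet_Ioo]
    refine lintegral_congr fun d => ?_
    by_cases h0 : d ∈ Ioi (0 : ℝ)
    · by_cases h1 : d < t
      · rw [indicator_of_mem h0, indicator_of_mem (show d ∈ Ioo 0 t from ⟨h0, h1⟩)]
      · rw [indicator_of_mem h0, indicator_of_notMem (fun h => h1 h.2), hzero d (not_lt.1 h1)]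
    · rw [indicator_of_notMem h0, indicator_of_notMem (fun h => h0 h.1)]
  change ∫⁻ d in Ioi (0 : ℝ), g d = _
  rw [hsplit, ← himg, lintegral_image_eq_lintegral_abs_deriv_mul measurableSet_Ioo hderiv hinj]
  refine setLIntegral_congr_fun measurableSet_Ioo fun α hα => ?_
  have hsin : 0 < Real.sin α := Real.sin_pos_of_pos_of_lt_pi hα.1 (by linarith [hα.2, Real.pi_pos])
  have hcos : 0 < Real.cos α := Real.cos_pos_of_mem_Ioo ⟨by linarith [hα.1, Real.pi_pos], hα.2⟩
  set R := Real.sinh (t / 2) * Real.sin α with hR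
  have hR0 : 0 < R := by positivity
  simp only [hg]
  rw [← lintegral_const_mul' _ _ ENNReal.ofReal_ne_top]
  refine lintegral_congr fun θ => ?_
  have hsq : 2 * (Real.cosh t - Real.cosh (latRadius t α)) =
      (2 * (Real.sinh (t / 2) * Real.cos α)) ^ 2 := by
    rw [cosh_latRadius, hcosht]
    linear_combination (-4 * Real.sinh (t / 2) ^ 2) * Real.sin_sq_add_cos_sq α
  rw [hker, hsq, Real.sqrt_sq (by positivity), sinh_latRadius, ← mul_assoc, ← mul_assoc,
    ← ENNReal.ofReal_mul (by positivity), ← ENNReal.ofReal_mul (by positivity)]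
  congr 2
  rw [abs_of_pos (by positivity), ← hR]
  have : 0 < √(1 + R ^ 2) := by positivity
  field_simp

/-! ### Polar coordinates around an arbitrary centre -/

/-- The isometry `z ↦ exp x.2 * z + x.1` in horocyclic coordinates. -/
def move (x q : ℝ × ℝ) : ℝ × ℝ := (x.1 + Real.exp x.2 * q.1, x.2 + q.2)

@[fun_prop]
theorem Continuous.move {X : Type*} [TopologicalSpace X] {f g : X → ℝ × ℝ} (hf : Continuous f)
    (hg : Continuous g) : Continuous fun x => move (f x) (g x) := by
  unfold HypWave.move
  fun_prop

theorem pt_zero : pt 0 = UpperHalfPlane.I := by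
  ext
  rw [coe_I]
  apply Complex.ext <;> simp [pt]

theorem dist_pt_move (x q : ℝ × ℝ) : dist (pt x) (pt (move x q)) = radius (pt q) := by
  have h : Real.cosh (dist (pt x) (pt (move x q))) = Real.cosh (radius (pt q)) := by
    rw [cosh_radius_pt, cosh_dist_pt]
    have h2 := Real.exp_pos x.2
    have h3 := Real.exp_pos q.2
    simp only [move, Real.exp_add, Real.cosh_eq, Real.exp_neg, Real.exp_sub, neg_sub]
    field_simp
    ring
  exact Real.cosh_strictMonoOn.injOn (mem_Ici.2 dist_nonneg) (mem_Ici.2 dist_nonneg) h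

/-- The point of the disc of radius `t` around `x` with latitude `k.1` and direction `k.2`. -/
def polar (t : ℝ) (x k : ℝ × ℝ) : ℝ × ℝ := move x (geo (latRadius t k.1, k.2))

@[fun_prop]
theorem Continuous.latRadius {X : Type*} [TopologicalSpace X] {f g : X → ℝ} (hf : Continuous f)
    (hg : Continuous g) : Continuous fun x => latRadius (f x) (g x) := by
  unfold HypWave.latRadius
  exact ((Real.continuous_arsinh).comp (by fun_prop :
    Continuous fun x => Real.sinh (f x / 2) * Real.sin (g x))).const_mul 2

@[fun_prop]
theorem Continuous.polar {X : Type*} [TopologicalSpace X] {f : X → ℝ} {g h : X → ℝ × ℝ}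
    (hf : Continuous f) (hg : Continuous g) (hh : Continuous h) :
    Continuous fun x => polar (f x) (g x) (h x) := by
  unfold HypWave.polar
  have := continuous_geo
  fun_prop

/-- The parameter domain of `polar`. -/
def latBox : Set (ℝ × ℝ) := Icc 0 (Real.pi / 2) ×ˢ Icc (-Real.pi) Real.pi

theorem isCompact_latBox : IsCompact latBox := isCompact_Icc.prod isCompact_Icc

/-- Obtained from the centred case by comparing the horocyclic form of both sides, in which moving
the centre is visibly the map `move x`. -/
theorem lintegral_diskMeasure_polar {t : ℝ} (ht : 0 < t) (x : ℝ × ℝ) {f : ℍ → ℝ≥0∞}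
    (hf : Measurable f) :
    ∫⁻ w, f w ∂diskMeasure t (pt x) =
      ∫⁻ α in Ioo 0 (Real.pi / 2), ∫⁻ θ in Ioo (-Real.pi) Real.pi,
        ENNReal.ofReal (Real.sinh (t / 2) * Real.sin α / Real.pi) *
          f (pt (polar t x (α, θ))) := by
  have hg : Measurable fun w => f (pt (move x (ptHomeo.symm w))) :=
    hf.comp (continuous_pt.comp (by
      have := ptHomeo.symm.continuous
      fun_prop)).measurable
  have hsymm : ∀ q, ptHomeo.symm (pt q) = q := ptHomeo.symm_apply_apply
  have h1 := lintegral_diskMeasure_geo ht hg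
  simp only [hsymm] at h1
  unfold polar
  rw [← h1, ← pt_zero, lintegral_diskMeasure_pt ht _ hg, lintegral_diskMeasure_pt ht _ hf]
  refine lintegral_congr fun b => lintegral_congr fun φ => ?_
  simp [hsymm, move]

/-- The propagator in geodesic polar coordinates. -/
def diskIntegral (t : ℝ) (f : ℝ × ℝ → ℝ) (x : ℝ × ℝ) : ℝ :=
  1 / Real.pi * ∫ k in latBox, Real.sinh (t / 2) * Real.sin k.1 * f (polar t x k)

theorem integral_diskMeasure_polar {t : ℝ} (ht : 0 < t) (x : ℝ × ℝ) {f : ℍ → ℝ}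
    (hf : Continuous f) :
    ∫ w, f w ∂diskMeasure t (pt x) = diskIntegral t (fun q => f (pt q)) x := by
  have hsh : 0 < Real.sinh (t / 2) := Real.sinh_pos_iff.2 (by linarith)
  set S : Set (ℝ × ℝ) := Ioo 0 (Real.pi / 2) ×ˢ Ioo (-Real.pi) Real.pi with hS
  have hSm : MeasurableSet S := measurableSet_Ioo.prod measurableSet_Ioo
  set d : ℝ × ℝ → ℝ := fun p => Real.sinh (t / 2) * Real.sin p.1 / Real.pi with hd
  have hdm : Measurable d := by fun_prop
  set Φ : ℝ × ℝ → ℍ := fun p => pt (polar t x p) with hΦ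
  have hΦc : Continuous Φ := continuous_pt.comp (by fun_prop)
  have hmap : diskMeasure t (pt x) =
      (((volume : Measure (ℝ × ℝ)).restrict S).withDensity fun p => ENNReal.ofReal (d p)).map Φ := by
    refine Measure.ext_of_lintegral _ fun f hf => ?_
    have hm : Measurable fun p => ENNReal.ofReal (d p) * f (Φ p) :=
      hdm.ennreal_ofReal.mul (hf.comp hΦc.measurable)
    rw [lintegral_diskMeasure_polar ht x hf, lintegral_map hf hΦc.measurable,
      lintegral_withDensity_eq_lintegral_mul _ hdm.ennreal_ofReal (g := fun p => f (Φ p))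
      (hf.comp hΦc.measurable),
      hS, Measure.volume_eq_prod, ← Measure.prod_restrict]
    exact (lintegral_prod _ hm.aemeasurable).symm
  rw [hmap, integral_map hΦc.measurable.aemeasurable hf.aestronglyMeasurable,
    integral_withDensity_eq_integral_toReal_smul hdm.ennreal_ofReal
      (ae_of_all _ fun _ => ENNReal.ofReal_lt_top), diskIntegral, ← integral_const_mul]
  have hae : latBox =ᵐ[volume] S := by
    rw [latBox, hS, Measure.volume_eq_prod]
    exact (Measure.set_prod_ae_eq Ioo_ae_eq_Icc Ioo_ae_eq_Icc).symm
  rw [setIntegral_congr_set hae]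
  refine setIntegral_congr_fun hSm fun p hp => ?_
  have hsin : 0 < Real.sin p.1 :=
    Real.sin_pos_of_pos_of_lt_pi hp.1.1 (by linarith [hp.1.2, Real.pi_pos])
  have hd0 : (ENNReal.ofReal (d p)).toReal = d p := ENNReal.toReal_ofReal (by positivity)
  rw [hd0]
  simp only [smul_eq_mul, hd, hΦ]
  ring

/-- Both sides are integrals against `diskMeasure`. The polar side is the one that can be
differentiated in `t` with only `C¹` data, while the horocyclic side is the one with a simple dual.
-/
theorem diskIntegral_eq_propagator {t : ℝ} (ht : 0 ≤ t) {f : ℝ × ℝ → ℝ} (hf : Continuous f)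
    (x : ℝ × ℝ) : diskIntegral t f x =
      Real.exp (x.2 / 2) * propagator t (fun q => Real.exp (-q.2 / 2) * f q) x := by
  rcases ht.eq_or_lt with rfl | ht
  · simp [diskIntegral, propagator]
  · have hg : Continuous fun w => f (ptHomeo.symm w) := hf.comp ptHomeo.symm.continuous
    have hsymm : ∀ q, ptHomeo.symm (pt q) = q := ptHomeo.symm_apply_apply
    have h1 := integral_diskMeasure_polar ht x hg
    rw [integral_diskMeasure_pt ht x hg] at h1
    simp only [hsymm] at h1
    exact h1.symm

/-! ### The time derivative of the propagator -/

/-- The derivative of `latRadius` in the radius. -/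
def latSpeed (t α : ℝ) : ℝ :=
  Real.cosh (t / 2) * Real.sin α / √(1 + (Real.sinh (t / 2) * Real.sin α) ^ 2)

theorem hasDerivAt_latRadius (t α : ℝ) :
    HasDerivAt (fun s => latRadius s α) (latSpeed t α) t := by
  have h1 := (((hasDerivAt_id t).div_const 2).sinh.mul_const (Real.sin α)).arsinh.const_mul 2
  refine h1.congr_deriv ?_
  simp only [latSpeed, id, smul_eq_mul]
  field_simp

theorem abs_latSpeed_le (t α : ℝ) : |latSpeed t α| ≤ 1 := by
  have h0 : 0 < √(1 + (Real.sinh (t / 2) * Real.sin α) ^ 2) := by positivity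
  rw [latSpeed, abs_div, abs_of_pos h0, div_le_one h0]
  apply Real.abs_le_sqrt
  rw [mul_pow, mul_pow, Real.cosh_sq]
  have := Real.sin_sq_le_one α
  linarith

theorem geoFDeriv_apply_fst (p : ℝ × ℝ) (a : ℝ) : geoFDeriv p (a, 0) =
    (a * (Real.sin p.2 / polarDen p ^ 2),
      a * ((Real.cos p.2 * Real.cosh p.1 - Real.sinh p.1) / polarDen p)) := by
  unfold geoFDeriv
  rw [Matrix.toLin_finTwoProd_toContinuousLinearMap]
  simp [mul_comm]

/-- The derivative of `polar` in the radius. -/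
def polarVel (t : ℝ) (x k : ℝ × ℝ) : ℝ × ℝ :=
  (Real.exp x.2 * (latSpeed t k.1 * (Real.sin k.2 / polarDen (latRadius t k.1, k.2) ^ 2)),
    latSpeed t k.1 * ((Real.cos k.2 * Real.cosh (latRadius t k.1) - Real.sinh (latRadius t k.1)) /
      polarDen (latRadius t k.1, k.2)))

theorem hasDerivAt_polar (t : ℝ) (x k : ℝ × ℝ) :
    HasDerivAt (fun s => polar s x k) (polarVel t x k) t := by
  have h1 := (hasFDerivAt_geo (latRadius t k.1, k.2)).comp_hasDerivAt t
    ((hasDerivAt_latRadius t k.1).prodMk (hasDerivAt_const t k.2))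
  rw [geoFDeriv_apply_fst] at h1
  have ha := ((hasFDerivAt_fst (𝕜 := ℝ)).comp_hasDerivAt t h1).const_mul (Real.exp x.2)
    |>.const_add x.1
  have hb := ((hasFDerivAt_snd (𝕜 := ℝ)).comp_hasDerivAt t h1).const_add x.2
  exact ha.prodMk hb

@[fun_prop]
theorem Continuous.latSpeed {X : Type*} [TopologicalSpace X] {f g : X → ℝ} (hf : Continuous f)
    (hg : Continuous g) : Continuous fun x => latSpeed (f x) (g x) := by
  unfold HypWave.latSpeed
  refine Continuous.div (by fun_prop) (by fun_prop) fun x => ?_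
  positivity

@[fun_prop]
theorem Continuous.polarVel {X : Type*} [TopologicalSpace X] {f : X → ℝ} {g h : X → ℝ × ℝ}
    (hf : Continuous f) (hg : Continuous g) (hh : Continuous h) :
    Continuous fun x => polarVel (f x) (g x) (h x) := by
  unfold HypWave.polarVel
  have h1 : Continuous fun x => polarDen (HypWave.latRadius (f x) (h x).1, (h x).2) :=
    continuous_polarDen.comp (by fun_prop)
  refine Continuous.prodMk ?_ ?_
  · exact (by fun_prop : Continuous fun x => Real.exp (g x).2).mul
      ((by fun_prop : Continuous fun x => HypWave.latSpeed (f x) (h x).1).mul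
      ((by fun_prop : Continuous fun x => Real.sin (h x).2).div (h1.pow 2)
        fun x => (pow_pos (polarDen_pos _) 2).ne'))
  · exact (by fun_prop : Continuous fun x => HypWave.latSpeed (f x) (h x).1).mul
      ((by fun_prop : Continuous fun x => Real.cos (h x).2 *
        Real.cosh (HypWave.latRadius (f x) (h x).1) - Real.sinh (HypWave.latRadius (f x) (h x).1)).div
        h1 fun x => (polarDen_pos _).ne')

/-- The left side is the squared hyperbolic length of the velocity and equals `latSpeed t k.1 ^ 2`.
-/
theorem polarVel_sq_add_sq_le (t : ℝ) (x k : ℝ × ℝ) :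
    (Real.exp (-(polar t x k).2) * (polarVel t x k).1) ^ 2 + (polarVel t x k).2 ^ 2 ≤ 1 := by
  have h0 := polarDen_pos (latRadius t k.1, k.2)
  have h1 := sq_add_sq_eq_polarDen_sq (latRadius t k.1, k.2)
  have h2 := abs_latSpeed_le t k.1
  have h3 : latSpeed t k.1 ^ 2 ≤ 1 := (sq_le_one_iff_abs_le_one _).2 h2
  refine le_trans (le_of_eq ?_) h3
  simp only [polar, move, geo, polarVel, neg_add, neg_neg]
  rw [Real.exp_add, Real.exp_log h0, Real.exp_neg]
  simp only at h1
  have hx := Real.exp_pos x.2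
  field_simp
  rw [h1]
  ring

/-- `cos (t √A)`, the time derivative of the propagator. -/
def diskIntegralDeriv (t : ℝ) (f : ℝ × ℝ → ℝ) (x : ℝ × ℝ) : ℝ :=
  1 / Real.pi * ∫ k in latBox, Real.sin k.1 * (Real.cosh (t / 2) / 2 * f (polar t x k) +
    Real.sinh (t / 2) * fderiv ℝ f (polar t x k) (polarVel t x k))

theorem hasDerivAt_diskIntegral {f : ℝ × ℝ → ℝ} (hf : ContDiff ℝ 1 f) (t : ℝ) (x : ℝ × ℝ) :
    HasDerivAt (fun s => diskIntegral s f x) (diskIntegralDeriv t f x) t := by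
  have hf0 := hf.continuous
  have hf1 := hf.continuous_fderiv one_ne_zero
  refine HasDerivAt.const_mul _ (hasDerivAt_setIntegral_of_isCompact (U := univ) (μ := volume)
    (F := fun s k => Real.sinh (s / 2) * Real.sin k.1 * f (polar s x k))
    (F' := fun s k => Real.sin k.1 * (Real.cosh (s / 2) / 2 * f (polar s x k) +
      Real.sinh (s / 2) * fderiv ℝ f (polar s x k) (polarVel s x k)))
    isCompact_latBox isOpen_univ ?_ ?_ (fun s _ k _ => ?_) (mem_univ t))
  · apply Continuous.continuousOn
    unfold Function.uncurry
    fun_prop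
  · apply Continuous.continuousOn
    unfold Function.uncurry
    fun_prop
  · have h1 := (hf.differentiable one_ne_zero (polar s x k)).hasFDerivAt.comp_hasDerivAt s
      (hasDerivAt_polar s x k)
    have h2 := (((hasDerivAt_id s).div_const 2).sinh.mul_const (Real.sin k.1)).mul h1
    refine h2.congr_deriv ?_
    simp
    ring

theorem continuous_diskIntegralDeriv {f : ℝ × ℝ → ℝ} (hf : ContDiff ℝ 1 f) :
    Continuous fun p : ℝ × ℝ × ℝ => diskIntegralDeriv p.1 f p.2 := by
  have hf0 := hf.continuous
  have hf1 := hf.continuous_fderiv one_ne_zero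
  refine Continuous.const_mul (continuous_parametric_integral_of_continuous ?_ isCompact_latBox) _
  unfold Function.uncurry
  fun_prop

theorem integral_latBox_sin : ∫ k in latBox, Real.sin k.1 = 2 * Real.pi := by
  have hpi := Real.pi_pos
  have h := setIntegral_prod_mul (μ := volume) (ν := volume) (fun a : ℝ => Real.sin a)
    (fun _ : ℝ => (1 : ℝ)) (Icc 0 (Real.pi / 2)) (Icc (-Real.pi) Real.pi)
  simp only [mul_one] at h
  rw [latBox, Measure.volume_eq_prod, h, integral_Icc_eq_integral_Ioc,
    ← intervalIntegral.integral_of_le (by linarith), integral_sin]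
  simp
  ring_nf
  exact max_eq_left (by linarith)

theorem polar_zero (x k : ℝ × ℝ) : polar 0 x k = x := by
  simp [polar, latRadius, geo, polarDen, move]

theorem diskIntegralDeriv_zero (f : ℝ × ℝ → ℝ) (x : ℝ × ℝ) : diskIntegralDeriv 0 f x = f x := by
  simp only [diskIntegralDeriv, polar_zero, zero_div, Real.sinh_zero, Real.cosh_zero, zero_mul,
    add_zero]
  rw [integral_mul_const, integral_latBox_sin]
  field_simp

/-! ### The gradient in horocyclic coordinates -/

theorem coe_pt (q : ℝ × ℝ) : ((pt q : ℍ) : ℂ) = Complex.equivRealProdCLM.symm (q.1, Real.exp q.2) := by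
  apply Complex.ext <;> simp

theorem comp_pt_eq (f : ℍ → ℝ) : (fun q => f (pt q)) =
    inChart f ∘ fun q => Complex.equivRealProdCLM.symm (q.1, Real.exp q.2) := by
  ext q
  simp only [Function.comp, inChart, ← coe_pt, ofComplex_apply]

theorem contDiff_comp_pt {f : ℍ → ℝ} (hf : IsC1 f) : ContDiff ℝ 1 fun q => f (pt q) := by
  rw [comp_pt_eq, ← contDiffOn_univ]
  refine hf.comp (ContDiff.contDiffOn (by fun_prop)) fun q _ => ?_
  simp [Real.exp_pos]

theorem continuous_of_isC1 {f : ℍ → ℝ} (hf : IsC1 f) : Continuous f := by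
  have := (contDiff_comp_pt hf).continuous.comp ptHomeo.symm.continuous
  refine this.congr fun z => ?_
  simp only [Function.comp, pt_ptHomeo_symm]

/-- The hypothesis on `v` says that its hyperbolic length is at most one. In the chart it becomes a
vector of Euclidean length at most the height, which is the factor in `gradNorm`. -/
theorem abs_fderiv_comp_pt_le {f : ℍ → ℝ} (hf : IsC1 f) (q v : ℝ × ℝ)
    (hv : (Real.exp (-q.2) * v.1) ^ 2 + v.2 ^ 2 ≤ 1) :
    |fderiv ℝ (fun q => f (pt q)) q v| ≤ gradNorm f (pt q) := by
  have hopen : IsOpen {w : ℂ | 0 < w.im} := isOpen_lt continuous_const Complex.continuous_im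
  have hmem : (Complex.equivRealProdCLM.symm (q.1, Real.exp q.2)) ∈ {w : ℂ | 0 < w.im} := by
    simp [Real.exp_pos]
  have h1 := ((hf.contDiffAt (hopen.mem_nhds hmem)).differentiableAt one_ne_zero).hasFDerivAt
  have h2 : HasFDerivAt (fun q : ℝ × ℝ => (q.1, Real.exp q.2)) ((ContinuousLinearMap.fst ℝ ℝ ℝ).prod
      (Real.exp q.2 • ContinuousLinearMap.snd ℝ ℝ ℝ)) q :=
    hasFDerivAt_fst.prodMk (hasFDerivAt_snd.exp)
  have h3 := h1.comp q (Complex.equivRealProdCLM.symm.hasFDerivAt.comp q h2)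
  rw [comp_pt_eq]
  rw [show inChart f ∘ (fun q : ℝ × ℝ => Complex.equivRealProdCLM.symm (q.1, Real.exp q.2)) =
    inChart f ∘ (⇑Complex.equivRealProdCLM.symm ∘ fun q : ℝ × ℝ => (q.1, Real.exp q.2)) from rfl,
    h3.fderiv, gradNorm, coe_pt, ← Real.norm_eq_abs]
  refine (ContinuousLinearMap.le_opNorm (fderiv ℝ (inChart f) _)
    (Complex.equivRealProdCLM.symm (v.1, Real.exp q.2 * v.2))).trans ?_
  rw [mul_comm]
  gcongr
  rw [pt_im, Complex.norm_def]
  apply Real.sqrt_le_iff.2 ⟨(Real.exp_pos _).le, ?_⟩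
  rw [Real.exp_neg] at hv
  have := Real.exp_pos q.2
  simp [Complex.normSq_apply]
  field_simp at hv
  nlinarith

theorem abs_diskIntegralDeriv_le {f : ℍ → ℝ} (hf : IsC1 f) {g : ℍ → ℝ} (hg : Continuous g)
    (hfg : ∀ z, |f z| + gradNorm f z ≤ g z) {t : ℝ} (ht : 0 ≤ t) (x : ℝ × ℝ) :
    |diskIntegralDeriv t (fun q => f (pt q)) x| ≤
      Real.cosh (t / 2) / Real.pi * ∫ k in latBox, Real.sin k.1 * g (pt (polar t x k)) := by
  have hpi := Real.pi_pos
  have hF := contDiff_comp_pt hf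
  have hF0 := hF.continuous
  have hF1 := hF.continuous_fderiv one_ne_zero
  have hgc := hg.comp continuous_pt
  have hsh : 0 ≤ Real.sinh (t / 2) := Real.sinh_nonneg_iff.2 (by linarith)
  have hsc : Real.sinh (t / 2) ≤ Real.cosh (t / 2) := Real.sinh_lt_cosh _ |>.le
  have hch := Real.cosh_pos (t / 2)
  rw [diskIntegralDeriv, abs_mul, abs_of_pos (by positivity : 0 < 1 / Real.pi),
    show Real.cosh (t / 2) / Real.pi = 1 / Real.pi * Real.cosh (t / 2) by ring, mul_assoc]
  refine mul_le_mul_of_nonneg_left ?_ (by positivity)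
  rw [← integral_const_mul]
  refine abs_integral_le_integral_abs.trans ?_
  refine setIntegral_mono_on ?_ ?_ isCompact_latBox.measurableSet fun k hk => ?_
  · refine ContinuousOn.integrableOn_compact isCompact_latBox (Continuous.continuousOn ?_)
    have hcont : ∀ G : ℝ × ℝ → ℝ, Continuous G → Continuous (fderiv ℝ G) → Continuous fun k =>
        |Real.sin k.1 * (Real.cosh (t / 2) / 2 * G (polar t x k) +
          Real.sinh (t / 2) * fderiv ℝ G (polar t x k) (polarVel t x k))| := by
      intro G _ _
      fun_prop
    exact hcont _ hF0 hF1
  · refine ContinuousOn.integrableOn_compact isCompact_latBox (Continuous.continuousOn ?_)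
    exact continuous_const.mul ((by fun_prop : Continuous fun k : ℝ × ℝ => Real.sin k.1).mul
      (hgc.comp (by fun_prop)))
  · have hsin : 0 ≤ Real.sin k.1 := Real.sin_nonneg_of_mem_Icc ⟨hk.1.1, by linarith [hk.1.2]⟩
    rw [abs_mul, abs_of_nonneg hsin, mul_left_comm]
    refine mul_le_mul_of_nonneg_left ?_ hsin
    refine (abs_add_le _ _).trans ?_
    rw [abs_mul, abs_mul, abs_of_nonneg hsh, abs_of_pos (by positivity : 0 < Real.cosh (t / 2) / 2)]
    have h1 := abs_fderiv_comp_pt_le hf _ _ (polarVel_sq_add_sq_le t x k)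
    have h2 := hfg (pt (polar t x k))
    have h3 := abs_nonneg (f (pt (polar t x k)))
    have h4 := abs_nonneg (fderiv ℝ (fun q => f (pt q)) (polar t x k) (polarVel t x k))
    calc _ ≤ Real.cosh (t / 2) * |f (pt (polar t x k))| +
        Real.cosh (t / 2) * |fderiv ℝ (fun q => f (pt q)) (polar t x k) (polarVel t x k)| := by
          gcongr
          linarith
      _ ≤ _ := by
        rw [← mul_add]
        gcongr
        linarith

theorem dist_pt_polar_le {t : ℝ} (ht : 0 ≤ t) (x k : ℝ × ℝ) : dist (pt x) (pt (polar t x k)) ≤ t := by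
  rw [polar, dist_pt_move]
  have h1 := cosh_radius_geo (latRadius t k.1, k.2)
  have hS : 0 ≤ Real.sinh (t / 2) := Real.sinh_nonneg_iff.2 (by linarith)
  have h2 : Real.cosh (latRadius t k.1) ≤ Real.cosh t := by
    rw [cosh_latRadius, mul_pow]
    have h3 := Real.cosh_two_mul (t / 2)
    rw [mul_div_cancel₀ _ two_ne_zero, Real.cosh_sq] at h3
    have := mul_le_of_le_one_right (sq_nonneg (Real.sinh (t / 2))) (Real.sin_sq_le_one k.1)
    linarith
  rw [← h1, Real.cosh_le_cosh, abs_of_nonneg ht] at h2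
  exact (le_abs_self _).trans h2

/-! ### The Japanese bracket -/

/-- The bracket `⟨x⟩ = (1 + x²)^(1/2)`. -/
def jap (x : ℝ) : ℝ := √(1 + x ^ 2)

theorem one_le_jap (x : ℝ) : 1 ≤ jap x := Real.one_le_sqrt.2 (by nlinarith [sq_nonneg x])

theorem jap_pos (x : ℝ) : 0 < jap x := zero_lt_one.trans_le (one_le_jap x)

theorem continuous_jap : Continuous jap := by unfold jap; fun_prop

theorem jap_neg (x : ℝ) : jap (-x) = jap x := by simp [jap]

theorem jap_abs (x : ℝ) : jap |x| = jap x := by simp [jap]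

theorem jap_le_jap {x y : ℝ} (h : |x| ≤ |y|) : jap x ≤ jap y :=
  Real.sqrt_le_sqrt (by linarith [sq_le_sq.2 h])

theorem jap_le_one_add (x : ℝ) : jap x ≤ 1 + |x| := by
  refine Real.sqrt_le_iff.2 ⟨by positivity, ?_⟩
  have h1 := abs_nonneg x
  have h2 := sq_abs x
  nlinarith

theorem jap_add_le (x y : ℝ) : jap (x + y) ≤ 2 * jap x * jap y := by
  unfold jap
  rw [mul_assoc, ← Real.sqrt_mul (by positivity)]
  refine Real.sqrt_le_iff.2 ⟨by positivity, ?_⟩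
  rw [mul_pow, Real.sq_sqrt (by positivity)]
  nlinarith [sq_nonneg (x - y), sq_nonneg x, sq_nonneg y, mul_nonneg (sq_nonneg x) (sq_nonneg y)]

theorem jap_two_mul_le (x : ℝ) : jap (2 * x) ≤ 2 * jap x := by
  refine Real.sqrt_le_iff.2 ⟨by have := jap_pos x; positivity, ?_⟩
  rw [jap, mul_pow, mul_pow, Real.sq_sqrt (by positivity)]
  linarith

/-- From `1 + x ≤ (1 + h / a) (a x / h + 1)` and `y + 1 ≤ exp y`, raised to the power `h`. -/
theorem jap_rpow_le_exp {a h : ℝ} (ha : 0 < a) (hh : 0 < h) {x : ℝ} (hx : 0 ≤ x) :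
    jap x ^ h ≤ (1 + h / a) ^ h * Real.exp (a * x) := by
  have h1 : jap x ≤ (1 + h / a) * Real.exp (a * x / h) := by
    have h2 := jap_le_one_add x
    rw [abs_of_nonneg hx] at h2
    have h3 := Real.add_one_le_exp (a * x / h)
    have h4 : 1 + x ≤ (1 + h / a) * (a * x / h + 1) := by
      have : (1 + h / a) * (a * x / h + 1) = 1 + x + (a * x / h + h / a) := by field_simp; ring
      rw [this]
      have : 0 ≤ a * x / h + h / a := by positivity
      linarith
    exact h2.trans (h4.trans (mul_le_mul_of_nonneg_left h3 (by positivity)))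
  refine (Real.rpow_le_rpow (jap_pos x).le h1 hh.le).trans (le_of_eq ?_)
  rw [Real.mul_rpow (by positivity) (Real.exp_pos _).le, ← Real.exp_mul]
  congr 2
  field_simp

theorem exp_le_jap_rpow {a h : ℝ} (ha : 0 < a) (hh : 0 < h) {x : ℝ} (hx : 0 ≤ x) :
    Real.exp (-(a * x)) ≤ (1 + h / a) ^ h * jap x ^ (-h) := by
  have h1 := jap_rpow_le_exp ha hh hx
  have h2 := Real.rpow_pos_of_pos (jap_pos x) h
  rw [Real.exp_neg, Real.rpow_neg (jap_pos x).le, ← div_eq_mul_inv, inv_eq_one_div,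
    div_le_div_iff₀ (Real.exp_pos _) h2]
  linarith

theorem integrable_jap_rpow {h : ℝ} (hh : 1 < h) : Integrable fun x => jap x ^ (-h) := by
  have h1 := integrable_rpow_neg_one_add_norm_sq (E := ℝ) (μ := volume) (r := h) (by simpa using hh)
  refine h1.congr (.of_forall fun x => ?_)
  simp only [jap, Real.norm_eq_abs, sq_abs]
  rw [Real.sqrt_eq_rpow, ← Real.rpow_mul (by positivity)]
  congr 1
  ring

/-- The argument that is larger in absolute value has a bracket at least half that of the sum. Its
negative power is replaced by that of the sum, and the other factor survives for integration. -/
theorem jap_rpow_neg_mul_le {h : ℝ} (hh : 0 ≤ h) (x y : ℝ) :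
    jap x ^ (-h) * jap y ^ (-h) ≤ 2 ^ h * jap (x + y) ^ (-h) * (jap x ^ (-h) + jap y ^ (-h)) := by
  have hx := Real.rpow_pos_of_pos (jap_pos x) (-h)
  have hy := Real.rpow_pos_of_pos (jap_pos y) (-h)
  have hz := Real.rpow_pos_of_pos (jap_pos (x + y)) (-h)
  have key : ∀ u v : ℝ, |u| ≤ |v| → jap v ^ (-h) ≤ 2 ^ h * jap (u + v) ^ (-h) := by
    intro u v huv
    have h1 : jap (u + v) ≤ 2 * jap v := by
      refine (jap_le_jap ?_).trans (jap_two_mul_le v)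
      rw [abs_mul, abs_two]
      linarith [abs_add_le u v]
    have h2 := Real.rpow_le_rpow_of_nonpos (jap_pos (u + v)) h1 (neg_nonpos.2 hh)
    rw [Real.mul_rpow two_pos.le (jap_pos v).le, Real.rpow_neg two_pos.le] at h2
    have h3 : (0 : ℝ) < 2 ^ h := by positivity
    rw [inv_mul_eq_div, div_le_iff₀ h3] at h2
    linarith
  have h2 : (0 : ℝ) < 2 ^ h := by positivity
  rcases le_total |x| |y| with hxy | hxy
  · have := mul_le_mul_of_nonneg_left (key x y hxy) hx.le
    nlinarith [mul_pos (mul_pos h2 hz) hy]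
  · have := mul_le_mul_of_nonneg_left (key y x hxy) hy.le
    rw [add_comm y x] at this
    nlinarith [mul_pos (mul_pos h2 hz) hx]

/-! ### Averages of radial functions -/

/-- Jordan's inequality `sin φ ≥ 2 φ / π` on `(0, π / 2]`, and reflection on the other side. -/
theorem lintegral_abs_sin_rpow_lt_top :
    ∫⁻ φ in Ioo (-(Real.pi / 2)) (Real.pi / 2), ENNReal.ofReal (|Real.sin φ| ^ (-(1 / 2) : ℝ)) < ⊤ := by
  have hpi := Real.pi_pos
  have hi : IntegrableOn (fun φ : ℝ => (2 / Real.pi * φ) ^ (-(1 / 2) : ℝ)) (Ioc 0 (Real.pi / 2)) := by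
    have h1 := (intervalIntegral.intervalIntegrable_rpow' (a := 0) (b := Real.pi / 2)
      (r := -(1 / 2)) (by norm_num)).const_mul ((2 / Real.pi) ^ (-(1 / 2) : ℝ))
    rw [intervalIntegrable_iff_integrableOn_Ioc_of_le (by positivity)] at h1
    refine h1.congr_fun (fun φ hφ => ?_) measurableSet_Ioc
    rw [Real.mul_rpow (by positivity) hφ.1.le]
  have hpos : ∫⁻ φ in Ioc 0 (Real.pi / 2), ENNReal.ofReal (|Real.sin φ| ^ (-(1 / 2) : ℝ)) < ⊤ := by
    refine lt_of_le_of_lt ?_ hi.lintegral_lt_top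
    refine setLIntegral_mono' measurableSet_Ioc fun φ hφ => ENNReal.ofReal_le_ofReal ?_
    have h1 := Real.mul_le_sin hφ.1.le hφ.2
    have h2 : 0 < 2 / Real.pi * φ := by have := hφ.1; positivity
    rw [abs_of_pos (h2.trans_le h1)]
    exact Real.rpow_le_rpow_of_nonpos h2 h1 (by norm_num)
  have hneg : ∫⁻ φ in Ico (-(Real.pi / 2)) 0, ENNReal.ofReal (|Real.sin φ| ^ (-(1 / 2) : ℝ)) < ⊤ := by
    refine lt_of_le_of_lt (le_of_eq ?_) hpos
    rw [← lintegral_indicator measurableSet_Ioc, ← lintegral_indicator measurableSet_Ico,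
      ← lintegral_neg_eq_self (f := indicator (Ioc 0 (Real.pi / 2)) _)]
    refine lintegral_congr fun φ => ?_
    by_cases h : φ ∈ Ico (-(Real.pi / 2)) 0
    · rw [indicator_of_mem h, indicator_of_mem (show -φ ∈ Ioc 0 (Real.pi / 2) from
        ⟨by linarith [h.2], by linarith [h.1]⟩), Real.sin_neg, abs_neg]
    · rw [indicator_of_notMem h, indicator_of_notMem fun h' =>
        h ⟨by linarith [h'.2], by linarith [h'.1]⟩]
  have hsub : Ioo (-(Real.pi / 2)) (Real.pi / 2) ⊆
      Ico (-(Real.pi / 2)) 0 ∪ ({0} ∪ Ioc 0 (Real.pi / 2)) := by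
    intro φ hφ
    rcases lt_trichotomy φ 0 with h | h | h
    · exact .inl ⟨hφ.1.le, h⟩
    · exact .inr (.inl h)
    · exact .inr (.inr ⟨h, hφ.2.le⟩)
  refine (lintegral_mono_set hsub).trans_lt ((lintegral_union_le _ _ _).trans_lt ?_)
  refine ENNReal.add_lt_top.2 ⟨hneg, (lintegral_union_le _ _ _).trans_lt ?_⟩
  refine ENNReal.add_lt_top.2 ⟨?_, hpos⟩
  simp

/-- Here `ρ` is the radius of the point at logarithmic height `b - r` in the disc of radius `τ`
about `exp (-r) i`. Away from `b = ±τ` one has `cosh τ - cosh b ≥ exp τ / 8`, so the displacement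
along the horocycle forces `exp ρ ≥ exp (τ - r) sin² φ / 8`. When `τ - 2 r + b < 1` or `τ - b < 1`,
the bound `ρ ≥ |r - b|` alone is enough. -/
theorem sin_sq_mul_exp_le {τ r b ρ φ : ℝ} (hr : 0 ≤ r) (hb : |b| < τ) (hρ : 0 ≤ ρ)
    (h : Real.cosh ρ = Real.cosh (r - b) +
      Real.exp (-r) * (Real.cosh τ - Real.cosh b) * Real.sin φ ^ 2) :
    |r - b| ≤ ρ ∧ Real.sin φ ^ 2 * Real.exp (max 0 (τ - 2 * r + b)) ≤ 8 * Real.exp (ρ - (r - b)) := by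
  have hs1 := Real.sin_sq_le_one φ
  have hs0 := sq_nonneg (Real.sin φ)
  have hτb : Real.cosh b < Real.cosh τ := by
    rw [Real.cosh_lt_cosh]; exact hb.trans_le (le_abs_self τ)
  have hρc : |r - b| ≤ ρ := by
    have : Real.cosh (r - b) ≤ Real.cosh ρ := by
      have : 0 ≤ Real.exp (-r) * (Real.cosh τ - Real.cosh b) * Real.sin φ ^ 2 :=
        mul_nonneg (mul_nonneg (Real.exp_pos _).le (by linarith)) hs0
      linarith
    rwa [Real.cosh_le_cosh, abs_of_nonneg hρ] at this
  refine ⟨hρc, ?_⟩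
  have he1 : Real.exp 1 ≤ 8 := by linarith [Real.exp_one_lt_d9]
  have hle := le_abs_self (r - b)
  have hle' := neg_abs_le (r - b)
  by_cases h1 : τ - 2 * r + b < 1
  · have h2 : Real.exp (max 0 (τ - 2 * r + b)) ≤ Real.exp 1 :=
      Real.exp_le_exp.2 (max_le zero_le_one h1.le)
    have h3 : 1 ≤ Real.exp (ρ - (r - b)) := Real.one_le_exp (by linarith)
    have := Real.exp_pos (max 0 (τ - 2 * r + b))
    nlinarith
  push Not at h1
  rw [max_eq_right (by linarith)]
  have hpos := Real.exp_pos (τ - 2 * r + b)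
  by_cases h2 : τ - b < 1
  · have h3 : Real.exp (τ - 2 * r + b - 1) ≤ Real.exp (ρ - (r - b)) :=
      Real.exp_le_exp.2 (by linarith)
    have h4 : Real.exp (τ - 2 * r + b) = Real.exp 1 * Real.exp (τ - 2 * r + b - 1) := by
      rw [← Real.exp_add]; ring_nf
    have h5 := Real.exp_pos (τ - 2 * r + b - 1)
    nlinarith
  push Not at h2
  have hm1 : Real.exp (-1) ≤ 1 / 2 := by
    rw [Real.exp_neg, inv_eq_one_div]
    exact one_div_le_one_div_of_le two_pos (by linarith [Real.exp_one_gt_d9])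
  have hm : Real.exp (-(τ - b)) ≤ 1 / 2 := (Real.exp_le_exp.2 (by linarith)).trans hm1
  have hn : Real.exp (-(τ + b)) ≤ 1 / 2 := (Real.exp_le_exp.2 (by linarith)).trans hm1
  have hfac : Real.cosh τ - Real.cosh b =
      1 / 2 * Real.exp τ * ((1 - Real.exp (-(τ - b))) * (1 - Real.exp (-(τ + b)))) := by
    have e1 : Real.exp (-(τ - b)) = Real.exp (-τ) * Real.exp b := by rw [← Real.exp_add]; ring_nf
    have e2 : Real.exp (-(τ + b)) = Real.exp (-τ) * Real.exp (-b) := by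
      rw [← Real.exp_add]; ring_nf
    have e3 : Real.exp τ * Real.exp (-τ) = 1 := by rw [← Real.exp_add]; simp
    have e4 : Real.exp b * Real.exp (-b) = 1 := by rw [← Real.exp_add]; simp
    rw [e1, e2, Real.cosh_eq, Real.cosh_eq]
    linear_combination (1 / 2 * (Real.exp b + Real.exp (-b)) -
      1 / 2 * Real.exp (-τ) * Real.exp b * Real.exp (-b)) * e3 - 1 / 2 * Real.exp (-τ) * e4
  have hprod : 1 / 4 ≤ (1 - Real.exp (-(τ - b))) * (1 - Real.exp (-(τ + b))) := by nlinarith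
  have hdiff : Real.exp τ / 8 ≤ Real.cosh τ - Real.cosh b := by
    rw [hfac]
    nlinarith [Real.exp_pos τ]
  have hcosh : Real.cosh ρ ≤ Real.exp ρ := by
    rw [Real.cosh_eq]
    linarith [Real.exp_le_exp.2 (by linarith : -ρ ≤ ρ)]
  have h6 : Real.exp (-r) * (Real.exp τ / 8) * Real.sin φ ^ 2 ≤ Real.exp ρ := by
    have h7 : Real.exp (-r) * (Real.exp τ / 8) * Real.sin φ ^ 2 ≤
        Real.exp (-r) * (Real.cosh τ - Real.cosh b) * Real.sin φ ^ 2 := by gcongr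
    linarith [Real.cosh_pos (r - b)]
  have e5 : Real.exp (τ - 2 * r + b) = Real.exp (-r) * Real.exp τ * Real.exp (-(r - b)) := by
    rw [← Real.exp_add, ← Real.exp_add]; ring_nf
  rw [e5, sub_eq_add_neg ρ, Real.exp_add]
  have := Real.exp_pos (-(r - b))
  nlinarith

/-- The fourth root of `sin_sq_mul_exp_le`, taken through logarithms. The root is chosen so that the
singularity `|sin φ|^(-1/2)` is integrable. The constant `2` comes from `8^(1/4) ≤ 2`. -/
theorem exp_le_abs_sin_rpow {τ r b ρ φ : ℝ} (hr : 0 ≤ r) (hb : |b| < τ) (hρ : 0 ≤ ρ)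
    (h : Real.cosh ρ = Real.cosh (r - b) +
      Real.exp (-r) * (Real.cosh τ - Real.cosh b) * Real.sin φ ^ 2) (hφ : Real.sin φ ≠ 0) :
    Real.exp (-(ρ - (r - b)) / 4) ≤
      2 * Real.exp (-(max 0 (τ - 2 * r + b)) / 4) * |Real.sin φ| ^ (-(1 / 2) : ℝ) := by
  have h1 := (sin_sq_mul_exp_le hr hb hρ h).2
  have hs : 0 < |Real.sin φ| := abs_pos.2 hφ
  rw [← sq_abs] at h1
  have h2 := Real.log_le_log (by positivity) h1
  rw [Real.log_mul (by positivity) (Real.exp_pos _).ne', Real.log_exp,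
    Real.log_mul (by norm_num) (Real.exp_pos _).ne', Real.log_exp, Real.log_pow] at h2
  have h3 : Real.log 8 ≤ 4 * Real.log 2 := by
    rw [show (8 : ℝ) = 2 ^ 3 by norm_num, Real.log_pow]
    have := Real.log_pos one_lt_two
    push_cast
    linarith
  rw [Real.rpow_def_of_pos hs, mul_assoc, ← Real.exp_add]
  rw [show ∀ x, 2 * Real.exp x = Real.exp (Real.log 2 + x) from fun x => by
    rw [Real.exp_add, Real.exp_log two_pos]]
  apply Real.exp_le_exp.2
  push_cast at h2
  linarith

/-- With `c = r - b` the exponentials `exp (r / 2)`, `exp (-b / 2)` and `exp (-ρ / 2)` combine to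
`exp (-(ρ - c) / 2)`. Half of this pays for the loss `exp ((ρ - c) / 4)` allowed in the hypothesis
on `F`. The other half is bounded by `exp_le_abs_sin_rpow`, whose right side separates into a
function of `φ`, integrated away, and one of `c`. -/
theorem lintegral_diskMeasure_radial_le : ∃ K : ℝ, 0 < K ∧ ∀ τ > 0, ∀ z : ℍ,
    ∀ F : ℝ → ℝ≥0∞, Measurable F → ∀ g : ℝ → ℝ≥0∞,
    (∀ c ρ, |c| ≤ ρ → F ρ ≤ ENNReal.ofReal (Real.exp (-ρ / 2) * Real.exp ((ρ - c) / 4)) * g c) →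
    ENNReal.ofReal (Real.exp (radius z / 2)) * ∫⁻ w, F (radius w) ∂diskMeasure τ z ≤
      ENNReal.ofReal K * ∫⁻ c in Ioi (radius z - τ),
        ENNReal.ofReal (Real.exp (-(max 0 (τ - radius z - c)) / 4)) * g c := by
  set S := ∫⁻ φ in Ioo (-(Real.pi / 2)) (Real.pi / 2),
    ENNReal.ofReal (|Real.sin φ| ^ (-(1 / 2) : ℝ)) with hS
  have hStop := lintegral_abs_sin_rpow_lt_top
  have hpi := Real.pi_pos
  have hpi3 := Real.pi_gt_three
  refine ⟨S.toReal + 1, by positivity, fun τ hτ z F hF g hFg => ?_⟩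
  have hSK : S ≤ ENNReal.ofReal (S.toReal + 1) := by
    rw [ENNReal.le_ofReal_iff_toReal_le hStop.ne (by positivity)]; linarith
  set r := radius z with hr
  have hr0 : 0 ≤ r := dist_nonneg
  have hrad : Measurable fun w => F (radius w) := hF.comp continuous_radius.measurable
  rw [lintegral_diskMeasure_radial hF, lintegral_diskMeasure_pt hτ _ hrad,
    ← lintegral_const_mul' _ _ ENNReal.ofReal_ne_top]
  set G : ℝ → ℝ≥0∞ := fun c => ENNReal.ofReal (Real.exp (-(max 0 (τ - r - c)) / 4)) * g c with hG
  have hstep : ∀ b ∈ Ioo (-τ) τ, ENNReal.ofReal (Real.exp (r / 2)) *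
      ∫⁻ φ in Ioo (-(Real.pi / 2)) (Real.pi / 2),
        ENNReal.ofReal (Real.exp (-b / 2) / (2 * Real.pi)) *
          F (radius (pt ((0, -r).1 + Real.exp (0, -r).2 * (halfWidth τ b * Real.sin φ),
            (0, -r).2 + b))) ≤ ENNReal.ofReal (S.toReal + 1) * G (r - b) := by
    intro b hb
    have hb' : |b| < τ := abs_lt.2 hb
    rw [← lintegral_const_mul' _ _ ENNReal.ofReal_ne_top]
    refine le_trans ?_ (mul_le_mul_left hSK (G (r - b)))
    rw [hS]
    rw [← lintegral_mul_const _ (by fun_prop)]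
    refine lintegral_mono_ae ?_
    have hne : ∀ᵐ φ : ℝ, φ ≠ 0 := Measure.ae_ne volume 0
    filter_upwards [ae_restrict_of_ae hne, ae_restrict_mem measurableSet_Ioo] with φ hφ0 hφ
    have hsin : Real.sin φ ≠ 0 := by
      intro h
      rcases lt_or_gt_of_ne hφ0 with h' | h'
      · exact (Real.sin_neg_of_neg_of_neg_pi_lt h' (by linarith [hφ.1])).ne h
      · exact (Real.sin_pos_of_pos_of_lt_pi h' (by linarith [hφ.2])).ne' h
    set ρ := radius (pt ((0, -r).1 + Real.exp (0, -r).2 * (halfWidth τ b * Real.sin φ),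
      (0, -r).2 + b)) with hρ
    have hρ0 : 0 ≤ ρ := dist_nonneg
    have hcosh : Real.cosh ρ = Real.cosh (r - b) +
        Real.exp (-r) * (Real.cosh τ - Real.cosh b) * Real.sin φ ^ 2 := by
      rw [hρ, cosh_radius_pt]
      simp only [zero_add]
      rw [mul_pow, mul_pow, halfWidth_sq hb', show -r + b = -(r - b) by ring, Real.cosh_neg]
      congr 1
      rw [show -(r - b) = -r + b by ring, Real.exp_add]
      field_simp
    have h1 := (sin_sq_mul_exp_le hr0 hb' hρ0 hcosh).1
    have h2 := exp_le_abs_sin_rpow hr0 hb' hρ0 hcosh hsin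
    refine (mul_le_mul_right (mul_le_mul_right (hFg (r - b) ρ h1) _) _).trans ?_
    rw [← mul_assoc, ← mul_assoc, ← ENNReal.ofReal_mul (by positivity),
      ← ENNReal.ofReal_mul (by positivity)]
    simp only [hG]
    rw [← mul_assoc (ENNReal.ofReal (_ ^ _)), ← ENNReal.ofReal_mul (by positivity)]
    refine mul_le_mul_left (ENNReal.ofReal_le_ofReal ?_) _
    rw [show τ - r - (r - b) = τ - 2 * r + b by ring]
    have e : Real.exp (r / 2) * (Real.exp (-b / 2) / (2 * Real.pi)) *
        (Real.exp (-ρ / 2) * Real.exp ((ρ - (r - b)) / 4)) =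
        1 / (2 * Real.pi) * Real.exp (-(ρ - (r - b)) / 4) := by
      have : Real.exp (-(ρ - (r - b)) / 4) = Real.exp (r / 2) * Real.exp (-b / 2) *
        (Real.exp (-ρ / 2) * Real.exp ((ρ - (r - b)) / 4)) := by
        rw [← Real.exp_add, ← Real.exp_add, ← Real.exp_add]; ring_nf
      rw [this]; ring
    rw [e]
    have h3 : 1 / (2 * Real.pi) ≤ 1 / 2 := one_div_le_one_div_of_le two_pos (by linarith)
    have h4 := mul_le_mul h3 h2 (Real.exp_pos _).le (by norm_num)
    refine h4.trans (le_of_eq ?_)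
    ring
  refine (setLIntegral_mono' measurableSet_Ioo hstep).trans ?_
  rw [lintegral_const_mul' _ _ ENNReal.ofReal_ne_top]
  refine mul_le_mul_right ?_ _
  rw [← lintegral_indicator measurableSet_Ioo, ← lintegral_indicator measurableSet_Ioi,
    ← lintegral_sub_left_eq_self _ r]
  refine lintegral_mono fun b => ?_
  by_cases hb : r - b ∈ Ioo (-τ) τ
  · rw [indicator_of_mem hb, indicator_of_mem (mem_Ioi.2 (by linarith [hb.2])), sub_sub_cancel]
  · rw [indicator_of_notMem hb]; exact zero_le

/-! ### Weighted bounds for the free evolution -/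

theorem weight_eq (h t r : ℝ) : weight h t r = Real.exp (r / 2) * jap (t - r) ^ h := rfl

theorem weight_pos (h t r : ℝ) : 0 < weight h t r :=
  mul_pos (Real.exp_pos _) (Real.rpow_pos_of_pos (jap_pos _) _)

theorem continuous_theta (k : ℝ) : Continuous (theta k) := by
  unfold theta
  refine Continuous.rpow_const (by have := continuous_radius; fun_prop) fun z => .inl ?_
  exact (Real.cosh_pos _).ne'

theorem theta_pos (k : ℝ) (z : ℍ) : 0 < theta k z := Real.rpow_pos_of_pos (Real.cosh_pos _) _

theorem cosh_rpow_le {k ρ : ℝ} (hk : 0 < k) :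
    Real.cosh ρ ^ (-k - 1 / 2) ≤ 2 ^ (k + 1 / 2) * Real.exp (-(k * ρ)) * Real.exp (-ρ / 2) := by
  have h1 : Real.exp ρ / 2 ≤ Real.cosh ρ := by
    rw [Real.cosh_eq]; linarith [Real.exp_pos (-ρ)]
  refine (Real.rpow_le_rpow_of_nonpos (by positivity) h1 (by linarith)).trans (le_of_eq ?_)
  rw [Real.div_rpow (Real.exp_pos _).le two_pos.le, ← Real.exp_mul, mul_assoc, ← Real.exp_add,
    show (-k - 1 / 2 : ℝ) = -(k + 1 / 2) by ring, Real.rpow_neg two_pos.le, div_inv_eq_mul, mul_comm]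
  congr 2
  ring

theorem lintegral_jap_rpow_lt_top {h : ℝ} (hh : 1 < h) :
    ∫⁻ x, ENNReal.ofReal (jap x ^ (-h)) < ⊤ :=
  (integrable_jap_rpow hh).lintegral_lt_top

/-- For `c > -T` one has `|T| ≤ max 0 (T - c) + |c|`, so the two exponentials dominate the
polynomial growth in `T` and half of the decay in `c` is left over. The exceptional case lies
outside the range of integration `c > r - t`. -/
theorem jap_rpow_mul_exp_mul_exp_le {h k : ℝ} (hh : 0 < h) (hk : 0 < k) : ∃ K : ℝ, 0 < K ∧
    ∀ T c : ℝ, jap T ^ h * (Real.exp (-(max 0 (T - c)) / 4) * Real.exp (-(k * |c|))) ≤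
      K * jap c ^ (-2 : ℝ) ∨ c ≤ -T := by
  set κ := min (1 / 4) (k / 2) with hκ
  have hκ0 : 0 < κ := lt_min (by norm_num) (by linarith)
  have hκ1 : κ ≤ 1 / 4 := min_le_left _ _
  have hκ2 : κ ≤ k / 2 := min_le_right _ _
  refine ⟨(1 + h / κ) ^ h * (1 + 2 / (k / 2)) ^ (2 : ℝ), by positivity, fun T c => ?_⟩
  by_cases hc : c ≤ -T
  · exact .inr hc
  left
  push Not at hc
  have h1 := jap_rpow_le_exp hκ0 hh (abs_nonneg T)
  have h2 := exp_le_jap_rpow (half_pos hk) two_pos (abs_nonneg c)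
  rw [jap_abs] at h1 h2
  have h3 : Real.exp (κ * |T|) * (Real.exp (-(max 0 (T - c)) / 4) * Real.exp (-(k * |c|))) ≤
      Real.exp (-(k / 2 * |c|)) := by
    rw [← Real.exp_add, ← Real.exp_add]
    apply Real.exp_le_exp.2
    have h4 : κ * |T| ≤ max 0 (T - c) / 4 + k / 2 * |c| := by
      have h5 : |T| ≤ max 0 (T - c) + |c| := by
        rcases abs_cases T with ⟨h, _⟩ | ⟨h, _⟩
        · linarith [le_max_right 0 (T - c), le_abs_self c]
        · linarith [le_max_left 0 (T - c), le_abs_self c]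
      have h6 : κ * max 0 (T - c) ≤ 1 / 4 * max 0 (T - c) :=
        mul_le_mul_of_nonneg_right hκ1 (le_max_left _ _)
      have h7 : κ * |c| ≤ k / 2 * |c| := mul_le_mul_of_nonneg_right hκ2 (abs_nonneg _)
      have h8 := mul_le_mul_of_nonneg_left h5 hκ0.le
      linarith
    linarith
  have hE : 0 ≤ Real.exp (-(max 0 (T - c)) / 4) * Real.exp (-(k * |c|)) := by positivity
  have hC : 0 ≤ (1 + h / κ) ^ h := by positivity
  calc _ ≤ (1 + h / κ) ^ h * Real.exp (κ * |T|) *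
        (Real.exp (-(max 0 (T - c)) / 4) * Real.exp (-(k * |c|))) :=
        mul_le_mul_of_nonneg_right h1 hE
    _ ≤ (1 + h / κ) ^ h * Real.exp (-(k / 2 * |c|)) := by
        rw [mul_assoc]; exact mul_le_mul_of_nonneg_left h3 hC
    _ ≤ _ := by rw [mul_assoc]; exact mul_le_mul_of_nonneg_left h2 hC

theorem weight_mul_lintegral_theta_le {h k : ℝ} (hh : 0 < h) (hk : 0 < k) : ∃ K : ℝ, 0 < K ∧
    ∀ t > 0, ∀ z : ℍ, ENNReal.ofReal (weight h t (radius z)) *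
      ∫⁻ w, ENNReal.ofReal (theta k w) ∂diskMeasure t z ≤ ENNReal.ofReal K := by
  obtain ⟨K₁, hK₁, H₁⟩ := lintegral_diskMeasure_radial_le
  obtain ⟨K₂, hK₂, H₂⟩ := jap_rpow_mul_exp_mul_exp_le hh hk
  have hL := lintegral_jap_rpow_lt_top (h := 2) one_lt_two
  set L := ∫⁻ x, ENNReal.ofReal (jap x ^ (-2 : ℝ)) with hLdef
  set D : ℝ := 2 ^ (k + 1 / 2) with hD
  have hD0 : 0 < D := by positivity
  refine ⟨K₁ * (D * K₂ * (L.toReal + 1)), by positivity, fun t ht z => ?_⟩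
  have hLK : L ≤ ENNReal.ofReal (L.toReal + 1) := by
    rw [ENNReal.le_ofReal_iff_toReal_le hL.ne (by positivity)]; linarith
  set r := radius z with hr
  have hF : Measurable fun ρ : ℝ => ENNReal.ofReal (Real.cosh ρ ^ (-k - 1 / 2)) := by fun_prop
  have h1 := H₁ t ht z _ hF (fun c => ENNReal.ofReal (D * Real.exp (-(k * |c|)))) (by
    intro c ρ hc
    rw [← ENNReal.ofReal_mul (by positivity)]
    refine ENNReal.ofReal_le_ofReal ((cosh_rpow_le hk).trans ?_)
    have e1 : Real.exp (-(k * ρ)) ≤ Real.exp (-(k * |c|)) :=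
      Real.exp_le_exp.2 (neg_le_neg (mul_le_mul_of_nonneg_left hc hk.le))
    have e2 : 1 ≤ Real.exp ((ρ - c) / 4) := Real.one_le_exp (by linarith [le_abs_self c])
    calc D * Real.exp (-(k * ρ)) * Real.exp (-ρ / 2)
        ≤ D * Real.exp (-(k * |c|)) * Real.exp (-ρ / 2) * Real.exp ((ρ - c) / 4) := by
          refine le_trans ?_ (le_mul_of_one_le_right (by positivity) e2)
          gcongr
      _ = _ := by ring)
  rw [weight_eq, mul_comm (Real.exp _), ENNReal.ofReal_mul (by have := jap_pos (t - r); positivity),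
    mul_assoc]
  refine (mul_le_mul_right h1 _).trans ?_
  rw [← mul_assoc, mul_comm (ENNReal.ofReal (jap _ ^ h)), mul_assoc, ENNReal.ofReal_mul hK₁.le]
  refine mul_le_mul_right ?_ _
  rw [← lintegral_const_mul' _ _ ENNReal.ofReal_ne_top]
  have h2 : ∀ c ∈ Ioi (r - t), ENNReal.ofReal (jap (t - r) ^ h) *
      (ENNReal.ofReal (Real.exp (-(max 0 (t - r - c)) / 4)) *
        ENNReal.ofReal (D * Real.exp (-(k * |c|)))) ≤
      ENNReal.ofReal (D * K₂) * ENNReal.ofReal (jap c ^ (-2 : ℝ)) := by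
    intro c hc
    have h3 := (H₂ (t - r) c).resolve_right (by have := mem_Ioi.1 hc; linarith)
    have hj := Real.rpow_pos_of_pos (jap_pos (t - r)) h
    rw [← ENNReal.ofReal_mul (by positivity), ← ENNReal.ofReal_mul (by positivity),
      ← ENNReal.ofReal_mul (by positivity)]
    refine ENNReal.ofReal_le_ofReal ?_
    have := mul_le_mul_of_nonneg_left h3 hD0.le
    linarith
  refine (setLIntegral_mono' measurableSet_Ioi h2).trans ?_
  rw [lintegral_const_mul' _ _ ENNReal.ofReal_ne_top, ENNReal.ofReal_mul (by positivity : 0 ≤ D * K₂)]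
  exact mul_le_mul_right ((setLIntegral_le_lintegral _ _).trans hLK) _

theorem weight_mul_integral_theta_le {h k : ℝ} (hh : 0 < h) (hk : 0 < k) : ∃ K : ℝ, 0 < K ∧
    ∀ t > 0, ∀ z : ℍ, Integrable (theta k) (diskMeasure t z) ∧
      weight h t (radius z) * ∫ w, theta k w ∂diskMeasure t z ≤ K := by
  obtain ⟨K, hK, H⟩ := weight_mul_lintegral_theta_le hh hk
  refine ⟨K, hK, fun t ht z => ?_⟩
  have h1 := H t ht z
  have hw := weight_pos h t (radius z)
  have hne : ∫⁻ w, ENNReal.ofReal (theta k w) ∂diskMeasure t z ≠ ⊤ := by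
    intro htop
    rw [htop, ENNReal.mul_top (by simpa using hw)] at h1
    exact absurd h1 (by simp)
  have hm : AEStronglyMeasurable (theta k) (diskMeasure t z) :=
    (continuous_theta k).aestronglyMeasurable
  have h0 : 0 ≤ᵐ[diskMeasure t z] theta k := .of_forall fun w => (theta_pos k w).le
  refine ⟨⟨hm, ?_⟩, ?_⟩
  · rw [hasFiniteIntegral_iff_ofReal h0]; exact hne.lt_top
  · rw [integral_eq_lintegral_of_nonneg_ae h0 hm, ← ENNReal.toReal_ofReal hw.le,
      ← ENNReal.toReal_mul]
    exact ENNReal.toReal_le_of_le_ofReal hK.le h1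

/-- Moving by at most one changes `cosh` of the radius by at most the factor `exp 1`, because `cosh
(r + 1) ≤ exp 1 * cosh r`. -/
theorem theta_le_of_dist_le {k : ℝ} (hk : 0 < k) {z w : ℍ} (hzw : dist z w ≤ 1) :
    theta k w ≤ Real.exp (k + 1 / 2) * theta k z := by
  have hw0 : 0 ≤ radius w := dist_nonneg
  have hz0 : 0 ≤ radius z := dist_nonneg
  have h1 : radius z ≤ radius w + 1 := by
    have := dist_triangle z w UpperHalfPlane.I
    unfold radius
    linarith
  have h2 : Real.cosh (radius z) ≤ Real.exp 1 * Real.cosh (radius w) := by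
    have h3 : Real.cosh (radius z) ≤ Real.cosh (radius w + 1) := by
      rw [Real.cosh_le_cosh, abs_of_nonneg hz0, abs_of_nonneg (by linarith)]; exact h1
    have h4 := (Real.sinh_lt_cosh (radius w)).le
    have h5 : 0 ≤ Real.sinh 1 := Real.sinh_nonneg_iff.2 zero_le_one
    rw [Real.cosh_add] at h3
    rw [← Real.cosh_add_sinh]
    nlinarith
  have h3 := Real.rpow_le_rpow_of_nonpos (Real.cosh_pos (radius z)) h2
    (by linarith : -k - 1 / 2 ≤ 0)
  rw [Real.mul_rpow (Real.exp_pos _).le (Real.cosh_pos _).le, ← Real.exp_mul, one_mul] at h3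
  have h4 := mul_le_mul_of_nonneg_left h3 (Real.exp_pos (k + 1 / 2)).le
  rw [← mul_assoc, ← Real.exp_add, show k + 1 / 2 + (-k - 1 / 2) = 0 by ring, Real.exp_zero,
    one_mul] at h4
  exact h4

/-- For bounded times `exp (r / 2)` is cancelled by half a power of `cosh`, and `exp (-k r)` absorbs
the bracket. -/
theorem weight_mul_theta_le {h k : ℝ} (hh : 0 < h) (hk : 0 < k) : ∃ K : ℝ, 0 < K ∧
    ∀ t ∈ Icc (0 : ℝ) 1, ∀ z : ℍ, weight h t (radius z) * theta k z ≤ K := by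
  refine ⟨4 ^ h * (1 + h / k) ^ h * 2 ^ (k + 1 / 2), by positivity, fun t ht z => ?_⟩
  set r := radius z with hr
  have hr0 : 0 ≤ r := dist_nonneg
  have h1 : jap (t - r) ^ h ≤ 4 ^ h * ((1 + h / k) ^ h * Real.exp (k * r)) := by
    have h2 : jap (t - r) ≤ 4 * jap r := by
      have h3 := jap_add_le t (-r)
      rw [jap_neg, ← sub_eq_add_neg] at h3
      have h4 := jap_le_one_add t
      rw [abs_of_nonneg ht.1] at h4
      have := jap_pos r
      nlinarith [ht.2]
    refine (Real.rpow_le_rpow (jap_pos _).le h2 hh.le).trans ?_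
    rw [Real.mul_rpow (by norm_num) (jap_pos _).le]
    exact mul_le_mul_of_nonneg_left (jap_rpow_le_exp hk hh hr0) (by positivity)
  have h2 : theta k z ≤ 2 ^ (k + 1 / 2) * Real.exp (-(k * r)) * Real.exp (-r / 2) := cosh_rpow_le hk
  have e1 : Real.exp (k * r) * Real.exp (-(k * r)) = 1 := by rw [← Real.exp_add]; simp
  have e2 : Real.exp (r / 2) * Real.exp (-r / 2) = 1 := by rw [← Real.exp_add, neg_div]; simp
  rw [weight_eq]
  calc _ ≤ Real.exp (r / 2) * (4 ^ h * ((1 + h / k) ^ h * Real.exp (k * r))) *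
        (2 ^ (k + 1 / 2) * Real.exp (-(k * r)) * Real.exp (-r / 2)) := by
        have := theta_pos k z
        gcongr
    _ = 4 ^ h * (1 + h / k) ^ h * 2 ^ (k + 1 / 2) * (Real.exp (k * r) * Real.exp (-(k * r))) *
        (Real.exp (r / 2) * Real.exp (-r / 2)) := by ring
    _ = _ := by rw [e1, e2]; ring

/-- The majorant of the time derivative has `cosh (t / 2)` where the propagator has `sinh (t / 2)`.
For `t > 1` the two are comparable and the bound for the propagator of `theta k` applies. For `t ≤
1` the averaging points stay within distance one of the centre, so `theta k` is comparable to its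
value there. -/
theorem weight_mul_abs_diskIntegralDeriv_le {h k : ℝ} (hh : 0 < h) (hk : 0 < k) : ∃ K : ℝ, 0 < K ∧
    ∀ f : ℍ → ℝ, IsC1 f → (∀ z, |f z| + gradNorm f z ≤ theta k z) → ∀ t, 0 ≤ t → ∀ x,
      weight h t (radius (pt x)) * |diskIntegralDeriv t (fun q => f (pt q)) x| ≤ K := by
  obtain ⟨K₁, hK₁, H₁⟩ := weight_mul_integral_theta_le hh hk
  obtain ⟨K₂, hK₂, H₂⟩ := weight_mul_theta_le hh hk
  have hpi := Real.pi_pos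
  set D := Real.cosh (1 / 2) / Real.pi * (2 * Real.pi * Real.exp (k + 1 / 2)) with hD
  have hD0 : 0 < D := by have := Real.cosh_pos (1 / 2); positivity
  refine ⟨3 * K₁ + D * K₂, by positivity, fun f hf hfk t ht x => ?_⟩
  have h0 := abs_diskIntegralDeriv_le hf (continuous_theta k) hfk ht x
  have hw := weight_pos h t (radius (pt x))
  refine (mul_le_mul_of_nonneg_left h0 hw.le).trans ?_
  set J := ∫ k_1 in latBox, Real.sin k_1.1 * theta k (pt (polar t x k_1)) with hJ
  have hsin : ∀ κ ∈ latBox, 0 ≤ Real.sin κ.1 := fun κ hκ =>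
    Real.sin_nonneg_of_mem_Icc ⟨hκ.1.1, by linarith [hκ.1.2]⟩
  have hJ0 : 0 ≤ J := setIntegral_nonneg isCompact_latBox.measurableSet fun κ hκ =>
    mul_nonneg (hsin κ hκ) (theta_pos k _).le
  rcases le_or_gt t 1 with ht1 | ht1
  · have h1 : J ≤ 2 * Real.pi * (Real.exp (k + 1 / 2) * theta k (pt x)) := by
      rw [← integral_latBox_sin, ← integral_mul_const]
      refine setIntegral_mono_on ?_ ?_ isCompact_latBox.measurableSet fun κ hκ => ?_
      · refine ContinuousOn.integrableOn_compact isCompact_latBox (Continuous.continuousOn ?_)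
        exact (by fun_prop : Continuous fun κ : ℝ × ℝ => Real.sin κ.1).mul
          (((continuous_theta k).comp continuous_pt).comp (by fun_prop))
      · exact ContinuousOn.integrableOn_compact isCompact_latBox
          (Continuous.continuousOn (by fun_prop))
      · exact mul_le_mul_of_nonneg_left
          (theta_le_of_dist_le hk ((dist_pt_polar_le ht x κ).trans ht1)) (hsin κ hκ)
    have h2 : Real.cosh (t / 2) ≤ Real.cosh (1 / 2) := by
      rw [Real.cosh_le_cosh, abs_of_nonneg (by linarith), abs_of_pos (by norm_num)]
      linarith
    have h3 := H₂ t ⟨ht, ht1⟩ (pt x)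
    have h4 : Real.cosh (t / 2) / Real.pi * J ≤ D * theta k (pt x) := by
      calc _ ≤ Real.cosh (1 / 2) / Real.pi * (2 * Real.pi * (Real.exp (k + 1 / 2) * theta k (pt x))) := by
            gcongr
        _ = _ := by rw [hD]; ring
    have h5 := mul_le_mul_of_nonneg_left h4 hw.le
    have h6 := mul_le_mul_of_nonneg_left h3 hD0.le
    linarith
  · have h1 := (H₁ t (by linarith) (pt x)).2
    rw [integral_diskMeasure_polar (by linarith) x (continuous_theta k), diskIntegral] at h1
    have h2 : (∫ κ in latBox, Real.sinh (t / 2) * Real.sin κ.1 * theta k (pt (polar t x κ))) =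
        Real.sinh (t / 2) * J := by
      rw [hJ, ← integral_const_mul]
      simp only [mul_assoc]
    rw [h2] at h1
    have h3 : Real.cosh (t / 2) ≤ 3 * Real.sinh (t / 2) := by
      have e1 : 2 ≤ Real.exp t := by linarith [Real.add_one_le_exp t]
      have e2 : Real.exp (t / 2) * Real.exp (t / 2) = Real.exp t := by
        rw [← Real.exp_add]; ring_nf
      have e3 : Real.exp (t / 2) * Real.exp (-(t / 2)) = 1 := by rw [← Real.exp_add]; simp
      have e4 := Real.exp_pos (-(t / 2))
      rw [Real.cosh_eq, Real.sinh_eq]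
      nlinarith
    have h4 : Real.cosh (t / 2) / Real.pi * J ≤ 3 * (1 / Real.pi * (Real.sinh (t / 2) * J)) := by
      rw [show Real.cosh (t / 2) / Real.pi * J = Real.cosh (t / 2) * (J / Real.pi) by ring,
        show 3 * (1 / Real.pi * (Real.sinh (t / 2) * J)) = 3 * Real.sinh (t / 2) * (J / Real.pi) by
          ring]
      exact mul_le_mul_of_nonneg_right h3 (by positivity)
    have h5 := mul_le_mul_of_nonneg_left h4 hw.le
    have h6 : 0 < D * K₂ := by positivity
    linarith

/-! ### Weighted bounds for the Duhamel term -/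

/-- The size of the nonlinearity along a solution with the asserted decay. -/
def source (h A s ρ : ℝ) : ℝ := (A + ρ / 2) ^ (-(2 * h)) * (Real.exp (-ρ / 2) * jap (s - ρ) ^ (-h))

theorem jap_rpow_neg_le {h : ℝ} (hh : 0 ≤ h) (x y : ℝ) :
    jap x ^ (-h) ≤ 2 ^ h * jap y ^ h * jap (x + y) ^ (-h) := by
  have h1 := Real.rpow_le_rpow_of_nonpos (jap_pos _) (jap_add_le x y) (neg_nonpos.2 hh)
  have hx := jap_pos x
  have hy := Real.rpow_pos_of_pos (jap_pos y) h
  have h2 : (0 : ℝ) < 2 ^ h := by positivity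
  rw [Real.mul_rpow (by positivity) (jap_pos _).le, Real.mul_rpow two_pos.le hx.le,
    Real.rpow_neg two_pos.le, Real.rpow_neg (jap_pos y).le] at h1
  have h3 := mul_le_mul_of_nonneg_left h1 (mul_pos h2 hy).le
  refine le_trans (le_of_eq ?_) h3
  field_simp

/-- Passing from `ρ` to `c` in the bracket costs `⟨ρ - c⟩^h`, which the permitted factor `exp ((ρ -
c) / 4)` absorbs. The first factor is decreasing in `ρ ≥ |c|`. -/
theorem source_le {h : ℝ} (hh : 0 < h) : ∃ K : ℝ, 0 < K ∧ ∀ A ≥ 1, ∀ s c ρ, |c| ≤ ρ →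
    source h A s ρ ≤ Real.exp (-ρ / 2) * Real.exp ((ρ - c) / 4) *
      (K * ((A + |c| / 2) ^ (-(2 * h)) * jap (s - c) ^ (-h))) := by
  refine ⟨2 ^ h * (1 + h / (1 / 4)) ^ h, by positivity, fun A hA s c ρ hc => ?_⟩
  have h1 : (A + ρ / 2) ^ (-(2 * h)) ≤ (A + |c| / 2) ^ (-(2 * h)) := by
    refine Real.rpow_le_rpow_of_nonpos ?_ (by linarith) (by linarith)
    have := abs_nonneg c
    linarith
  have h2 := jap_rpow_neg_le hh.le (s - ρ) (ρ - c)
  rw [sub_add_sub_cancel] at h2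
  have h3 := jap_rpow_le_exp (by norm_num : (0 : ℝ) < 1 / 4) hh
    (by linarith [le_abs_self c] : 0 ≤ ρ - c)
  rw [one_div_mul_eq_div] at h3
  have hj1 := Real.rpow_pos_of_pos (jap_pos (s - c)) (-h)
  have hj2 := Real.rpow_pos_of_pos (jap_pos (s - ρ)) (-h)
  have hA' : 0 ≤ (A + |c| / 2) ^ (-(2 * h)) := by
    have := abs_nonneg c
    exact Real.rpow_nonneg (by linarith) _
  unfold source
  calc _ ≤ (A + |c| / 2) ^ (-(2 * h)) * (Real.exp (-ρ / 2) *
        (2 ^ h * ((1 + h / (1 / 4)) ^ h * Real.exp ((ρ - c) / 4)) * jap (s - c) ^ (-h))) := by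
        refine mul_le_mul h1 (mul_le_mul_of_nonneg_left (h2.trans ?_) (Real.exp_pos _).le)
          (by positivity) hA'
        gcongr
    _ = _ := by ring

/-- Put `β = s - c` and `M = T - β > 0`, so `β + M = T`. The power `-2h` of `A + |c| / 2` is split
as `-(h - 1) / 2`, for smallness in `A`, plus `-h`, plus `-(h + 1) / 2`, for integrability in `c`.
The middle part and the exponential give `⟨M⟩^(-h)`, because `⟨M⟩` is at most `4` times the brackets
of `max 0 (M - 2c)` and `c`. Finally `⟨β⟩^(-h) ⟨M⟩^(-h)` yields `⟨T⟩^(-h)` and one integrable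
factor. -/
theorem jap_rpow_mul_source_le {h : ℝ} (hh : 1 < h) : ∃ K : ℝ, 0 < K ∧ ∀ A ≥ 1, ∀ T s c, s - T < c →
    jap T ^ h * (Real.exp (-(max 0 (T - s - c)) / 4) *
      ((A + |c| / 2) ^ (-(2 * h)) * jap (s - c) ^ (-h))) ≤
    K * A ^ (-((h - 1) / 2)) * (jap c ^ (-((h + 1) / 2)) *
      (jap (s - c) ^ (-h) + jap (T - (s - c)) ^ (-h))) := by
  have hh0 : 0 < h := by linarith
  refine ⟨2 ^ h * 4 ^ h * (1 + h / (1 / 4)) ^ h * 2 ^ h * 2 ^ ((h + 1) / 2), by positivity,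
    fun A hA T s c hc => ?_⟩
  set β := s - c with hβ
  set M := T - β with hM
  have hTsc : T - s - c = M - 2 * c := by rw [hM, hβ]; ring
  rw [hTsc]
  have hM0 : 0 < M := by rw [hM, hβ]; linarith
  set m := max 0 (M - 2 * c) with hm
  have hm0 : 0 ≤ m := le_max_left _ _
  have hjc := jap_pos c
  have hB : jap c / 2 ≤ A + |c| / 2 := by have := jap_le_one_add c; linarith
  have hB0 : 0 < A + |c| / 2 := by have := abs_nonneg c; linarith
  have hBA : A ≤ A + |c| / 2 := by have := abs_nonneg c; linarith
  have h1 : (A + |c| / 2) ^ (-(2 * h)) ≤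
      A ^ (-((h - 1) / 2)) * (2 ^ h * jap c ^ (-h) * (2 ^ ((h + 1) / 2) * jap c ^ (-((h + 1) / 2)))) := by
    have e : ∀ a : ℝ, 0 ≤ a → (A + |c| / 2) ^ (-a) ≤ 2 ^ a * jap c ^ (-a) := by
      intro a ha
      have := Real.rpow_le_rpow_of_nonpos (by positivity) hB (neg_nonpos.2 ha)
      rw [Real.div_rpow hjc.le two_pos.le, Real.rpow_neg two_pos.le, div_inv_eq_mul] at this
      linarith
    have e1 := Real.rpow_le_rpow_of_nonpos (by linarith) hBA (by linarith : -((h - 1) / 2) ≤ 0)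
    have e2 := e h hh0.le
    have e3 := e ((h + 1) / 2) (by linarith)
    rw [show -(2 * h) = -((h - 1) / 2) + (-h + -((h + 1) / 2)) by ring, Real.rpow_add hB0,
      Real.rpow_add hB0]
    have := Real.rpow_pos_of_pos hB0 (-h)
    have := Real.rpow_pos_of_pos hB0 (-((h + 1) / 2))
    have := Real.rpow_pos_of_pos hB0 (-((h - 1) / 2))
    gcongr
  have h2 : jap M ≤ 4 * jap m * jap c := by
    have hm1 := one_le_jap m
    rcases le_or_gt 0 (M - 2 * c) with h | h
    · have h3 := jap_add_le (M - 2 * c) (2 * c)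
      rw [sub_add_cancel] at h3
      have h4 := jap_two_mul_le c
      rw [hm, max_eq_right h] at hm1 ⊢
      nlinarith
    · have h3 : jap M ≤ jap (2 * c) :=
        jap_le_jap (by rw [abs_of_pos hM0, abs_of_pos (by linarith)]; linarith)
      have h4 := jap_two_mul_le c
      nlinarith
  have h3 : Real.exp (-m / 4) * jap c ^ (-h) ≤ 4 ^ h * (1 + h / (1 / 4)) ^ h * jap M ^ (-h) := by
    have e1 := exp_le_jap_rpow (by norm_num : (0 : ℝ) < 1 / 4) hh0 hm0
    have e2 := Real.rpow_le_rpow_of_nonpos (jap_pos M) h2 (by linarith : -h ≤ 0)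
    have hjm := jap_pos m
    rw [Real.mul_rpow (by positivity) hjc.le, Real.mul_rpow (by norm_num) hjm.le,
      Real.rpow_neg (by norm_num : (0 : ℝ) ≤ 4)] at e2
    have h4 : (0 : ℝ) < 4 ^ h := by positivity
    have hp1 := Real.rpow_pos_of_pos hjc (-h)
    have e3 := mul_le_mul_of_nonneg_left e2 h4.le
    rw [← mul_assoc, ← mul_assoc, mul_inv_cancel₀ h4.ne', one_mul] at e3
    rw [show -m / 4 = -(1 / 4 * m) by ring]
    calc _ ≤ (1 + h / (1 / 4)) ^ h * jap m ^ (-h) * jap c ^ (-h) := by gcongr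
      _ = (1 + h / (1 / 4)) ^ h * (jap m ^ (-h) * jap c ^ (-h)) := by ring
      _ ≤ (1 + h / (1 / 4)) ^ h * (4 ^ h * jap M ^ (-h)) := by gcongr
      _ = _ := by ring
  have h4 := jap_rpow_neg_mul_le hh0.le β M
  rw [show β + M = T by rw [hM]; ring] at h4
  have hT : jap T ^ h * jap T ^ (-h) = 1 := by
    rw [← Real.rpow_add (jap_pos T)]; simp
  have hTp := Real.rpow_pos_of_pos (jap_pos T) h
  have hβp := Real.rpow_pos_of_pos (jap_pos β) (-h)
  have hAp := Real.rpow_pos_of_pos (by linarith : 0 < A) (-((h - 1) / 2))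
  have hcp := Real.rpow_pos_of_pos hjc (-((h + 1) / 2))
  have hcp' := Real.rpow_pos_of_pos hjc (-h)
  set Q := jap c ^ (-((h + 1) / 2)) with hQ
  set N := A ^ (-((h - 1) / 2)) with hN
  calc _ ≤ jap T ^ h * (Real.exp (-m / 4) *
        (N * (2 ^ h * jap c ^ (-h) * (2 ^ ((h + 1) / 2) * Q)) * jap β ^ (-h))) := by gcongr
    _ = N * 2 ^ h * 2 ^ ((h + 1) / 2) * Q * jap T ^ h * jap β ^ (-h) *
        (Real.exp (-m / 4) * jap c ^ (-h)) := by ring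
    _ ≤ N * 2 ^ h * 2 ^ ((h + 1) / 2) * Q * jap T ^ h * jap β ^ (-h) *
        (4 ^ h * (1 + h / (1 / 4)) ^ h * jap M ^ (-h)) := by gcongr
    _ = N * 2 ^ h * 2 ^ ((h + 1) / 2) * Q * (4 ^ h * (1 + h / (1 / 4)) ^ h) * jap T ^ h *
        (jap β ^ (-h) * jap M ^ (-h)) := by ring
    _ ≤ N * 2 ^ h * 2 ^ ((h + 1) / 2) * Q * (4 ^ h * (1 + h / (1 / 4)) ^ h) * jap T ^ h *
        (2 ^ h * jap T ^ (-h) * (jap β ^ (-h) + jap M ^ (-h))) := by gcongr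
    _ = N * 2 ^ h * 2 ^ ((h + 1) / 2) * Q * (4 ^ h * (1 + h / (1 / 4)) ^ h) *
        (2 ^ h * (jap β ^ (-h) + jap M ^ (-h))) * (jap T ^ h * jap T ^ (-h)) := by ring
    _ = _ := by rw [hT]; ring

theorem measurable_jap_rpow (a : ℝ) : Measurable fun x => jap x ^ a :=
  (continuous_jap.measurable).pow_const a

theorem measurable_source (h A s : ℝ) : Measurable (source h A s) := by
  unfold source
  have := (measurable_jap_rpow (-h)).comp (by fun_prop : Measurable fun ρ => s - ρ)
  fun_prop

/-- After `jap_rpow_mul_source_le` the integrand in `(s, c)` is, for fixed `c`, a sum of two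
translates or reflections of `⟨s⟩^(-h)`. Integrating over all `s` first makes the bound uniform in
`T`. The `c`-integral converges since `(h + 1) / 2 > 1`. -/
theorem weight_mul_lintegral_source_le {h : ℝ} (hh : 1 < h) : ∃ K : ℝ, 0 < K ∧ ∀ A ≥ 1, ∀ t, ∀ z : ℍ,
    ENNReal.ofReal (weight h t (radius z)) * ∫⁻ s in Ioo 0 t,
      ∫⁻ w, ENNReal.ofReal (source h A s (radius w)) ∂diskMeasure (t - s) z ≤
        ENNReal.ofReal (K * A ^ (-((h - 1) / 2))) := by
  obtain ⟨K₁, hK₁, H₁⟩ := lintegral_diskMeasure_radial_le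
  obtain ⟨K₂, hK₂, H₂⟩ := source_le (by linarith : 0 < h)
  obtain ⟨K₃, hK₃, H₃⟩ := jap_rpow_mul_source_le hh
  have hL := lintegral_jap_rpow_lt_top hh
  have hL' := lintegral_jap_rpow_lt_top (h := (h + 1) / 2) (by linarith)
  set L := ∫⁻ x, ENNReal.ofReal (jap x ^ (-h)) with hLdef
  set L' := ∫⁻ x, ENNReal.ofReal (jap x ^ (-((h + 1) / 2))) with hLdef'
  refine ⟨K₁ * K₂ * K₃ * (L'.toReal * (L + L).toReal + 1), by positivity, fun A hA t z => ?_⟩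
  have hLL : L' * (L + L) ≤ ENNReal.ofReal (L'.toReal * (L + L).toReal + 1) := by
    have h1 : L + L < ⊤ := ENNReal.add_lt_top.2 ⟨hL, hL⟩
    rw [ENNReal.le_ofReal_iff_toReal_le (ENNReal.mul_lt_top hL' h1).ne (by positivity),
      ENNReal.toReal_mul]
    linarith
  set r := radius z with hr
  set T := t - r with hT
  have hA0 : 0 < A := by linarith
  have hjT := Real.rpow_pos_of_pos (jap_pos T) h
  have hAp := Real.rpow_pos_of_pos hA0 (-((h - 1) / 2))
  set P : ℝ := K₁ * (K₂ * (K₃ * A ^ (-((h - 1) / 2)))) with hP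
  have hP0 : 0 < P := by positivity
  set G : ℝ → ℝ → ℝ≥0∞ := fun s c => ENNReal.ofReal (jap c ^ (-((h + 1) / 2))) *
    (ENNReal.ofReal (jap (s - c) ^ (-h)) + ENNReal.ofReal (jap (T - (s - c)) ^ (-h))) with hG
  have hGm : Measurable (Function.uncurry G) := by
    have m1 := (measurable_jap_rpow (-((h + 1) / 2))).comp (by fun_prop : Measurable fun p : ℝ × ℝ => p.2)
    have m2 := (measurable_jap_rpow (-h)).comp (by fun_prop : Measurable fun p : ℝ × ℝ => p.1 - p.2)
    have m3 := (measurable_jap_rpow (-h)).comp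
      (by fun_prop : Measurable fun p : ℝ × ℝ => T - (p.1 - p.2))
    exact m1.ennreal_ofReal.mul (m2.ennreal_ofReal.add m3.ennreal_ofReal)
  have hstep : ∀ s ∈ Ioo 0 t, ENNReal.ofReal (weight h t r) *
      ∫⁻ w, ENNReal.ofReal (source h A s (radius w)) ∂diskMeasure (t - s) z ≤
      ENNReal.ofReal P * ∫⁻ c, G s c := by
    intro s hs
    have h1 := H₁ (t - s) (by linarith [hs.2]) z _ (measurable_source h A s).ennreal_ofReal
      (fun c => ENNReal.ofReal (K₂ * ((A + |c| / 2) ^ (-(2 * h)) * jap (s - c) ^ (-h)))) (by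
        intro c ρ hc
        rw [← ENNReal.ofReal_mul (by positivity)]
        exact ENNReal.ofReal_le_ofReal (H₂ A hA s c ρ hc))
    rw [weight_eq, mul_comm (Real.exp _), ENNReal.ofReal_mul hjT.le, mul_assoc]
    refine (mul_le_mul_right h1 _).trans ?_
    rw [← mul_assoc, mul_comm (ENNReal.ofReal (jap _ ^ h)), mul_assoc, hP, ENNReal.ofReal_mul hK₁.le,
      mul_assoc]
    refine mul_le_mul_right ?_ _
    rw [← lintegral_const_mul' _ _ ENNReal.ofReal_ne_top, ← lintegral_const_mul' _ _ ENNReal.ofReal_ne_top]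
    refine le_trans (setLIntegral_mono' measurableSet_Ioi fun c hc => ?_) (setLIntegral_le_lintegral (Ioi (r - (t - s))) _)
    have hc' := mem_Ioi.1 hc
    have h2 := H₃ A hA T s c (by rw [hT]; linarith)
    have hj1 := Real.rpow_pos_of_pos (jap_pos c) (-((h + 1) / 2))
    have hj2 := Real.rpow_pos_of_pos (jap_pos (s - c)) (-h)
    have hj3 := Real.rpow_pos_of_pos (jap_pos (T - (s - c))) (-h)
    have hAc : 0 < (A + |c| / 2) ^ (-(2 * h)) :=
      Real.rpow_pos_of_pos (by have := abs_nonneg c; linarith) _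
    simp only [hG]
    rw [← ENNReal.ofReal_add hj2.le hj3.le, ← ENNReal.ofReal_mul hj1.le,
      ← ENNReal.ofReal_mul (by positivity), ← ENNReal.ofReal_mul (by positivity),
      ← ENNReal.ofReal_mul (by positivity), show t - s - r - c = T - s - c by rw [hT]; ring]
    refine ENNReal.ofReal_le_ofReal ?_
    have := mul_le_mul_of_nonneg_left h2 hK₂.le
    linarith
  rw [← lintegral_const_mul' _ _ ENNReal.ofReal_ne_top]
  refine (setLIntegral_mono' measurableSet_Ioo hstep).trans ?_
  rw [lintegral_const_mul' _ _ ENNReal.ofReal_ne_top]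
  have hswap : ∫⁻ s in Ioo 0 t, ∫⁻ c, G s c ≤ L' * (L + L) := by
    refine (setLIntegral_le_lintegral _ _).trans (le_of_eq ?_)
    rw [lintegral_lintegral_swap hGm.aemeasurable]
    have h1 : ∀ c, ∫⁻ s, G s c = ENNReal.ofReal (jap c ^ (-((h + 1) / 2))) * (L + L) := by
      intro c
      simp only [hG]
      have m2 : Measurable fun s => ENNReal.ofReal (jap (s - c) ^ (-h)) :=
        ((measurable_jap_rpow (-h)).comp (by fun_prop : Measurable fun s => s - c)).ennreal_ofReal
      rw [lintegral_const_mul' _ _ ENNReal.ofReal_ne_top, lintegral_add_left m2,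
        lintegral_sub_right_eq_self (fun x => ENNReal.ofReal (jap x ^ (-h))) c,
        lintegral_sub_right_eq_self (fun x => ENNReal.ofReal (jap (T - x) ^ (-h))) c,
        lintegral_sub_left_eq_self (fun x => ENNReal.ofReal (jap x ^ (-h))) T]
    simp only [h1]
    rw [lintegral_mul_const _ (measurable_jap_rpow _).ennreal_ofReal]
  refine (mul_le_mul_right (hswap.trans hLL) _).trans ?_
  rw [← ENNReal.ofReal_mul hP0.le]
  refine ENNReal.ofReal_le_ofReal (le_of_eq ?_)
  rw [hP]
  ring

/-! ### Mild solutions -/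

/-- `sin (t √A) / √A` acting on functions of the horocyclic coordinates. -/
def evol (t : ℝ) (f : ℝ × ℝ → ℝ) (x : ℝ × ℝ) : ℝ :=
  Real.exp (x.2 / 2) * propagator t (fun q => Real.exp (-q.2 / 2) * f q) x

theorem continuous_evol {X : Type*} [TopologicalSpace X] [FirstCountableTopology X]
    [LocallyCompactSpace X] {v : X → ℝ × ℝ → ℝ} (hv : Continuous (Function.uncurry v))
    {f : X → ℝ} {g : X → ℝ × ℝ} (hf : Continuous f) (hg : Continuous g) :
    Continuous fun x => evol (f x) (v x) (g x) := by
  unfold evol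
  refine Continuous.mul (by fun_prop) (continuous_propagator ?_ hf hg)
  unfold Function.uncurry at hv ⊢
  fun_prop

theorem evol_eq_integral {t : ℝ} (ht : 0 < t) {f : ℝ × ℝ → ℝ} (hf : Continuous f) (x : ℝ × ℝ) :
    evol t f x = ∫ w, f (ptHomeo.symm w) ∂diskMeasure t (pt x) := by
  have hg : Continuous fun w => f (ptHomeo.symm w) := hf.comp ptHomeo.symm.continuous
  have hsymm : ∀ q, ptHomeo.symm (pt q) = q := ptHomeo.symm_apply_apply
  rw [integral_diskMeasure_pt ht x hg]
  simp only [hsymm, evol]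

theorem evol_zero (f : ℝ × ℝ → ℝ) (x : ℝ × ℝ) : evol 0 f x = 0 := by simp [evol, propagator]

theorem evol_sub (t : ℝ) {f g : ℝ × ℝ → ℝ} (hf : Continuous f) (hg : Continuous g) (x : ℝ × ℝ) :
    evol t (fun q => f q - g q) x = evol t f x - evol t g x := by
  unfold evol propagator
  rw [← mul_sub, ← mul_sub, ← integral_sub]
  · simp only [mul_sub]
  · exact ContinuousOn.integrableOn_compact isCompact_box (Continuous.continuousOn (by fun_prop))
  · exact ContinuousOn.integrableOn_compact isCompact_box (Continuous.continuousOn (by fun_prop))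

/-- Positivity of the kernel: pointwise majorants pass through the evolution. -/
theorem ofReal_abs_evol_le {t : ℝ} (ht : 0 < t) {f : ℝ × ℝ → ℝ} (hf : Continuous f) {g : ℍ → ℝ}
    (hfg : ∀ q, |f q| ≤ g (pt q)) (x : ℝ × ℝ) :
    ENNReal.ofReal |evol t f x| ≤ ∫⁻ w, ENNReal.ofReal (g w) ∂diskMeasure t (pt x) := by
  rw [evol_eq_integral ht hf, ← Real.enorm_eq_ofReal_abs]
  refine (enorm_integral_le_lintegral_enorm _).trans (lintegral_mono fun w => ?_)
  rw [Real.enorm_eq_ofReal_abs]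
  refine ENNReal.ofReal_le_ofReal ((hfg _).trans ?_)
  rw [pt_ptHomeo_symm]

/-- The Duhamel integral. -/
def duhamel (f : ℝ → ℝ × ℝ → ℝ) (t : ℝ) (x : ℝ × ℝ) : ℝ := ∫ s in (0 : ℝ)..t, evol (t - s) (f s) x

theorem continuous_duhamel {f : ℝ → ℝ × ℝ → ℝ} (hf : Continuous (Function.uncurry f)) {X : Type*}
    [TopologicalSpace X] [FirstCountableTopology X] [LocallyCompactSpace X]
    {τ : X → ℝ} {g : X → ℝ × ℝ} (hτ : Continuous τ) (hg : Continuous g) :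
    Continuous fun x => duhamel f (τ x) (g x) := by
  unfold duhamel
  refine intervalIntegral.continuous_parametric_intervalIntegral_of_continuous
    (f := fun x s => evol (τ x - s) (f s) (g x)) ?_ hτ
  refine continuous_evol (v := fun p : X × ℝ => f p.2) (f := fun p => τ p.1 - p.2)
    (g := fun p => g p.1) ?_ (by fun_prop) (by fun_prop)
  exact hf.comp (by fun_prop : Continuous fun p : (X × ℝ) × (ℝ × ℝ) => (p.1.2, p.2))

theorem continuous_evol_sub {f : ℝ → ℝ × ℝ → ℝ} (hf : Continuous (Function.uncurry f)) (t : ℝ)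
    (x : ℝ × ℝ) : Continuous fun s => evol (t - s) (f s) x :=
  continuous_evol (v := f) hf (by fun_prop) continuous_const

theorem duhamel_sub {f g : ℝ → ℝ × ℝ → ℝ} (hf : Continuous (Function.uncurry f))
    (hg : Continuous (Function.uncurry g)) (t : ℝ) (x : ℝ × ℝ) :
    duhamel (fun s q => f s q - g s q) t x = duhamel f t x - duhamel g t x := by
  unfold duhamel
  rw [← intervalIntegral.integral_sub ((continuous_evol_sub hf t x).intervalIntegrable _ _)
    ((continuous_evol_sub hg t x).intervalIntegrable _ _)]
  refine intervalIntegral.integral_congr fun s _ => ?_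
  exact evol_sub _ (hf.comp (by fun_prop : Continuous fun q : ℝ × ℝ => (s, q)))
    (hg.comp (by fun_prop : Continuous fun q : ℝ × ℝ => (s, q))) x

theorem weight_mul_abs_duhamel_le {h : ℝ} (hh : 1 < h) : ∃ K : ℝ, 0 < K ∧ ∀ A ≥ 1, ∀ B, 0 ≤ B →
    ∀ f : ℝ → ℝ × ℝ → ℝ, Continuous (Function.uncurry f) →
    (∀ s, 0 ≤ s → ∀ q, |f s q| ≤ B * source h A s (radius (pt q))) →
    ∀ t, 0 ≤ t → ∀ x, weight h t (radius (pt x)) * |duhamel f t x| ≤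
      K * A ^ (-((h - 1) / 2)) * B := by
  obtain ⟨K, hK, H⟩ := weight_mul_lintegral_source_le hh
  refine ⟨K, hK, fun A hA B hB f hf hfs t ht x => ?_⟩
  have hw := weight_pos h t (radius (pt x))
  have hA0 : 0 < A := by linarith
  have hAp := Real.rpow_pos_of_pos hA0 (-((h - 1) / 2))
  rw [← ENNReal.ofReal_le_ofReal_iff (by positivity), ENNReal.ofReal_mul hw.le]
  have h1 : ENNReal.ofReal |duhamel f t x| ≤ ENNReal.ofReal B * ∫⁻ s in Ioo 0 t,
      ∫⁻ w, ENNReal.ofReal (source h A s (radius w)) ∂diskMeasure (t - s) (pt x) := by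
    rw [duhamel, intervalIntegral.integral_of_le ht, integral_Ioc_eq_integral_Ioo,
      ← Real.enorm_eq_ofReal_abs, ← lintegral_const_mul' _ _ ENNReal.ofReal_ne_top]
    refine (enorm_integral_le_lintegral_enorm _).trans
      (setLIntegral_mono' measurableSet_Ioo fun s hs => ?_)
    rw [Real.enorm_eq_ofReal_abs, ← lintegral_const_mul' _ _ ENNReal.ofReal_ne_top]
    simp only [← ENNReal.ofReal_mul hB]
    exact ofReal_abs_evol_le (by linarith [hs.2])
      (hf.comp (by fun_prop : Continuous fun q : ℝ × ℝ => (s, q)))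
      (g := fun w => B * source h A s (radius w)) (hfs s hs.1.le) x
  refine (mul_le_mul_right h1 _).trans ?_
  rw [mul_left_comm, mul_comm (K * _), ENNReal.ofReal_mul hB]
  exact mul_le_mul_right (H A hA t (pt x)) _

theorem weight_mul_abs_evol_le {h k : ℝ} (hh : 0 < h) (hk : 0 < k) : ∃ K : ℝ, 0 < K ∧
    ∀ f : ℍ → ℝ, Continuous f → (∀ z, |f z| ≤ theta k z) → ∀ t, 0 ≤ t → ∀ x,
      weight h t (radius (pt x)) * |evol t (fun q => f (pt q)) x| ≤ K := by
  obtain ⟨K, hK, H⟩ := weight_mul_lintegral_theta_le hh hk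
  refine ⟨K, hK, fun f hf hfk t ht x => ?_⟩
  have hw := weight_pos h t (radius (pt x))
  rcases ht.eq_or_lt with rfl | ht
  · rw [evol_zero]; simpa using hK.le
  rw [← ENNReal.ofReal_le_ofReal_iff hK.le, ENNReal.ofReal_mul hw.le]
  exact (mul_le_mul_right (ofReal_abs_evol_le ht (hf.comp continuous_pt)
    (fun q => hfk (pt q)) x) _).trans (H t ht (pt x))

/-! ### The nonlinearity on small values and the contraction argument. -/

theorem IsLogNonlinearity.abs_sub_le {p C δ : ℝ} {F : ℝ → ℝ} (hF : IsLogNonlinearity p C δ F)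
    (hp : 1 ≤ p) {a : ℝ} (ha : 0 < a) (haδ : Real.exp (-a) < δ) {v v' : ℝ}
    (hv : |v| ≤ Real.exp (-a)) (hv' : |v'| ≤ Real.exp (-a)) :
    |F v - F v'| ≤ |C| * a ^ (1 - p) * |v - v'| := by
  have hd : Differentiable ℝ F := hF.c1.differentiable one_ne_zero
  have h := Convex.norm_image_sub_le_of_norm_deriv_le (f := F) (s := Icc (-Real.exp (-a)) (Real.exp (-a)))
    (C := |C| * a ^ (1 - p)) (x := v') (y := v) (fun x _ => hd x) ?_ (convex_Icc _ _) (abs_le.1 hv')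
    (abs_le.1 hv)
  · simpa only [Real.norm_eq_abs] using h
  intro x hx
  have hap := Real.rpow_nonneg ha.le (1 - p)
  have hxa := abs_le.2 hx
  rcases eq_or_ne x 0 with rfl | hx0
  · rw [hF.deriv_zero, norm_zero]; positivity
  have hx1 : 0 < |x| := abs_pos.2 hx0
  refine (hF.deriv_bound x hx1 (hxa.trans_lt haδ)).trans ?_
  have hlog : a ≤ Real.log (1 / |x|) := by
    rw [one_div, Real.log_inv, le_neg, ← Real.log_exp (-a)]
    exact Real.log_le_log hx1 hxa
  have h1 := Real.rpow_le_rpow_of_nonpos ha hlog (by linarith : 1 - p ≤ 0)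
  have h2 := Real.rpow_nonneg (ha.le.trans hlog) (1 - p)
  calc _ ≤ |C| * Real.log (1 / |x|) ^ (1 - p) := mul_le_mul_of_nonneg_right (le_abs_self C) h2
    _ ≤ _ := mul_le_mul_of_nonneg_left h1 (abs_nonneg C)

theorem continuous_weight {X : Type*} [TopologicalSpace X] {f g : X → ℝ} (h : ℝ)
    (hf : Continuous f) (hg : Continuous g) : Continuous fun x => weight h (f x) (g x) := by
  simp only [weight_eq]
  refine Continuous.mul (by fun_prop) (Continuous.rpow_const
    (continuous_jap.comp (hf.sub hg)) fun x => .inl (jap_pos _).ne')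

theorem exists_mild_solution {p : ℝ} (hp : 3 < p) {k : ℝ} (hk : 0 < k) (C : ℝ) {δ : ℝ} (hδ : 0 < δ) :
    ∃ ε₀ > 0, ∃ N > 0, ∀ F : ℝ → ℝ, IsLogNonlinearity p C δ F → ∀ u₀ u₁ : ℍ → ℝ,
      IsAdmissibleData k u₀ u₁ → ∀ ε : ℝ, |ε| < ε₀ → ∃ u : ℝ → ℝ × ℝ → ℝ,
        Continuous (Function.uncurry u) ∧
        (∀ t x, weight ((p - 1) / 2) |t| (radius (pt x)) * |u t x| ≤ N * |ε|) ∧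
        ∀ t, 0 ≤ t → ∀ x, u t x = ε * evol t (fun q => u₁ (pt q)) x +
          ε * diskIntegralDeriv t (fun q => u₀ (pt q)) x + duhamel (fun s q => F (u s q)) t x := by
  -- The midpoint of `1` and `p - 2`. It makes the power `1 - p` of the logarithm equal to the power
  -- `-2h` in `source`.
  set h := (p - 1) / 2 with hh
  have hh1 : 1 < h := by rw [hh]; linarith
  have hh0 : 0 < h := by linarith
  have hp2 : 1 - p = -(2 * h) := by rw [hh]; ring
  obtain ⟨K₁, hK₁, H₁⟩ := weight_mul_abs_evol_le hh0 hk
  obtain ⟨K₂, hK₂, H₂⟩ := weight_mul_abs_diskIntegralDeriv_le hh0 hk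
  obtain ⟨K₃, hK₃, H₃⟩ := weight_mul_abs_duhamel_le hh1
  -- `A` makes the Duhamel term a contraction with factor `1/2` and brings all values into the range
  -- `|v| < δ` where the bound on the derivative holds. It is chosen before the data, from `p`, `k`,
  -- `C` and `δ` alone.
  obtain ⟨A, hA1, hAδ, hAK⟩ : ∃ A : ℝ, 1 ≤ A ∧ Real.exp (-A) < δ ∧
      K₃ * A ^ (-((h - 1) / 2)) * |C| ≤ 1 / 2 := by
    have l1 : ∀ᶠ A : ℝ in atTop, Real.exp (-A) < δ :=
      (Real.tendsto_exp_neg_atTop_nhds_zero).eventually_lt_const hδ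
    have l2 : Tendsto (fun A : ℝ => K₃ * A ^ (-((h - 1) / 2)) * |C|) atTop (𝓝 (K₃ * 0 * |C|)) :=
      ((tendsto_rpow_neg_atTop (by linarith : 0 < (h - 1) / 2)).const_mul K₃).mul_const |C|
    have l3 := l2.eventually_le_const (by norm_num : K₃ * 0 * |C| < 1 / 2)
    exact ((eventually_ge_atTop 1).and (l1.and l3)).exists
  have hA0 : 0 < A := by linarith
  -- The linear evolution then fills half of the ball of radius `N * |ε|`, which leaves the other
  -- half for the Duhamel term.
  set N : ℝ := 2 * (K₁ + K₂) with hN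
  have hN0 : 0 < N := by positivity
  refine ⟨Real.exp (-A) / N, by positivity, N, hN0, fun F hF u₀ u₁ hu ε hε => ?_⟩
  have hNε : N * |ε| ≤ Real.exp (-A) := by
    rw [lt_div_iff₀ hN0] at hε; linarith
  have hNε0 : 0 ≤ N * |ε| := by positivity
  set κ : ℝ × ℝ × ℝ → ℝ := fun y => weight h |y.1| (radius (pt y.2)) with hκ
  have hκ0 : ∀ y, 0 < κ y := fun y => weight_pos _ _ _
  have hκc : Continuous κ := continuous_weight h (by fun_prop)
    (continuous_radius.comp (continuous_pt.comp continuous_snd))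
  set E := BoundedContinuousFunction (ℝ × ℝ × ℝ) ℝ with hE
  let U : E → ℝ → ℝ × ℝ → ℝ := fun w s q => w (s, q) / κ (s, q)
  have hUc : ∀ w, Continuous (Function.uncurry (U w)) := fun w =>
    w.continuous.div hκc fun y => (hκ0 y).ne'
  have hFc : Continuous F := hF.c1.continuous
  have hFU : ∀ w, Continuous (Function.uncurry fun s q => F (U w s q)) := fun w =>
    hFc.comp (hUc w)
  set B : Set E := Metric.closedBall 0 (N * |ε|) with hB
  have hinv : ∀ s, 0 ≤ s → ∀ q, 1 / κ (s, q) =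
      Real.exp (-radius (pt q) / 2) * jap (s - radius (pt q)) ^ (-h) := by
    intro s hs q
    simp only [hκ, weight_eq, abs_of_nonneg hs]
    rw [Real.rpow_neg (jap_pos _).le, neg_div, Real.exp_neg, one_div, mul_inv]
  have hsmall : ∀ w ∈ B, ∀ s, 0 ≤ s → ∀ q, |U w s q| ≤ Real.exp (-(A + radius (pt q) / 2)) := by
    intro w hw s hs q
    have h1 : |w (s, q)| ≤ N * |ε| := (w.norm_coe_le_norm _).trans (mem_closedBall_zero_iff.1 hw)
    have h2 : jap (s - radius (pt q)) ^ (-h) ≤ 1 :=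
      Real.rpow_le_one_of_one_le_of_nonpos (one_le_jap _) (by linarith)
    have h3 := Real.rpow_pos_of_pos (jap_pos (s - radius (pt q))) (-h)
    calc |U w s q| = |w (s, q)| * (1 / κ (s, q)) := by
          simp only [U]; rw [abs_div, abs_of_pos (hκ0 _)]; ring
      _ ≤ Real.exp (-A) * (Real.exp (-radius (pt q) / 2) * 1) := by
          rw [hinv s hs]
          have := h1.trans hNε
          gcongr
      _ = _ := by rw [mul_one, ← Real.exp_add]; ring_nf
  have hlip : ∀ w ∈ B, ∀ w' ∈ B, ∀ s, 0 ≤ s → ∀ q, |F (U w s q) - F (U w' s q)| ≤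
      |C| * dist w w' * source h A s (radius (pt q)) := by
    intro w hw w' hw' s hs q
    have hr : 0 ≤ radius (pt q) := dist_nonneg
    have ha : 0 < A + radius (pt q) / 2 := by linarith
    have h1 := hF.abs_sub_le (by linarith) ha
      ((Real.exp_le_exp.2 (by linarith)).trans_lt hAδ) (hsmall w hw s hs q) (hsmall w' hw' s hs q)
    have h2 : |U w s q - U w' s q| ≤ dist w w' * (1 / κ (s, q)) := by
      simp only [U]
      rw [← sub_div, abs_div, abs_of_pos (hκ0 _), div_eq_mul_one_div]
      exact mul_le_mul_of_nonneg_right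
        ((Real.dist_eq _ _).ge.trans (BoundedContinuousFunction.dist_coe_le_dist _))
        (by have := hκ0 (s, q); positivity)
    have h3 := Real.rpow_nonneg ha.le (1 - p)
    refine h1.trans ((mul_le_mul_of_nonneg_left h2 (by positivity)).trans (le_of_eq ?_))
    rw [hinv s hs, hp2, source]
    ring
  let lin : ℝ → ℝ × ℝ → ℝ := fun t x => ε * evol t (fun q => u₁ (pt q)) x +
    ε * diskIntegralDeriv t (fun q => u₀ (pt q)) x
  -- The unknown `w` is the solution times its weight. Using `|y.1|` extends everything evenly to
  -- negative times, so that bounded continuous functions on the whole space can be used. The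
  -- Duhamel equation is read off for nonnegative times only.
  let Φ : E → ℝ × ℝ × ℝ → ℝ := fun w y =>
    κ y * (lin |y.1| y.2 + duhamel (fun s q => F (U w s q)) |y.1| y.2)
  have hgrad : ∀ z, 0 ≤ gradNorm u₀ z := fun z => mul_nonneg z.im_pos.le (norm_nonneg _)
  have hu₀k : ∀ z, |u₀ z| + gradNorm u₀ z ≤ theta k z := fun z => by
    have := hu.bound z
    have := abs_nonneg (u₁ z)
    linarith
  have hu₁k : ∀ z, |u₁ z| ≤ theta k z := fun z => by
    have := hu.bound z
    have := abs_nonneg (u₀ z)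
    have := hgrad z
    linarith
  have hlinc : Continuous fun y : ℝ × ℝ × ℝ => lin |y.1| y.2 := by
    have c1 := continuous_evol (X := ℝ × ℝ × ℝ) (v := fun _ q => u₁ (pt q)) (f := fun y => |y.1|)
      (g := fun y => y.2)
      ((hu.continuous.comp continuous_pt).comp continuous_snd) (by fun_prop) (by fun_prop)
    have c2 := (continuous_diskIntegralDeriv (contDiff_comp_pt hu.c1)).comp
      (by fun_prop : Continuous fun y : ℝ × ℝ × ℝ => (|y.1|, y.2))
    exact (c1.const_mul ε).add (c2.const_mul ε)
  have hΦc : ∀ w, Continuous (Φ w) := fun w =>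
    hκc.mul (hlinc.add (continuous_duhamel (hFU w) (by fun_prop) (by fun_prop)))
  have hlin : ∀ y, |κ y * lin |y.1| y.2| ≤ 1 / 2 * (N * |ε|) := by
    intro y
    have h1 := H₁ u₁ hu.continuous hu₁k |y.1| (abs_nonneg _) y.2
    have h2 := H₂ u₀ hu.c1 hu₀k |y.1| (abs_nonneg _) y.2
    have h3 := abs_add_le (ε * evol |y.1| (fun q => u₁ (pt q)) y.2)
      (ε * diskIntegralDeriv |y.1| (fun q => u₀ (pt q)) y.2)
    rw [abs_mul, abs_mul] at h3
    rw [abs_mul, abs_of_pos (hκ0 y)]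
    calc κ y * |lin |y.1| y.2| ≤ κ y * (|ε| * |evol |y.1| (fun q => u₁ (pt q)) y.2| +
          |ε| * |diskIntegralDeriv |y.1| (fun q => u₀ (pt q)) y.2|) :=
          mul_le_mul_of_nonneg_left h3 (hκ0 y).le
      _ = |ε| * (κ y * |evol |y.1| (fun q => u₁ (pt q)) y.2| +
          κ y * |diskIntegralDeriv |y.1| (fun q => u₀ (pt q)) y.2|) := by ring
      _ ≤ |ε| * (K₁ + K₂) := mul_le_mul_of_nonneg_left (add_le_add h1 h2) (abs_nonneg ε)
      _ = _ := by rw [hN]; ring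
  have hdiff : ∀ w ∈ B, ∀ w' ∈ B, ∀ y, |Φ w y - Φ w' y| ≤ 1 / 2 * dist w w' := by
    intro w hw w' hw' y
    have h1 := H₃ A hA1 (|C| * dist w w') (by positivity)
      (fun s q => F (U w s q) - F (U w' s q)) ((hFU w).sub (hFU w'))
      (hlip w hw w' hw') |y.1| (abs_nonneg _) y.2
    have h2 : Φ w y - Φ w' y = κ y * duhamel
        (fun s q => F (U w s q) - F (U w' s q)) |y.1| y.2 := by
      rw [duhamel_sub (hFU w) (hFU w')]
      simp only [Φ]
      ring
    rw [h2, abs_mul, abs_of_pos (hκ0 y)]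
    refine h1.trans ?_
    have := mul_le_mul_of_nonneg_right hAK (dist_nonneg (x := w) (y := w'))
    linarith
  have h0B : (0 : E) ∈ B := Metric.mem_closedBall_self hNε0
  have hU0 : ∀ s q, U 0 s q = 0 := fun s q => by
    change (0 : ℝ) / κ (s, q) = 0
    rw [zero_div]
  have hbound : ∀ w ∈ B, ∀ y, |Φ w y| ≤ N * |ε| := by
    intro w hw y
    have h1 := hdiff w hw 0 h0B y
    have h2 : Φ 0 y = κ y * lin |y.1| y.2 := by
      simp only [Φ, hU0, hF.zero]
      simp [duhamel, evol, propagator]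
    have h3 := hlin y
    have h4 : dist w 0 ≤ N * |ε| := hw
    rw [← h2] at h3
    have h5 := abs_add_le (Φ w y - Φ 0 y) (Φ 0 y)
    rw [sub_add_cancel] at h5
    linarith
  let T : B → B := fun w => ⟨BoundedContinuousFunction.ofNormedAddCommGroup (Φ w) (hΦc w) (N * |ε|)
    (hbound w w.2), mem_closedBall_zero_iff.2
      (BoundedContinuousFunction.norm_ofNormedAddCommGroup_le _ hNε0 _)⟩
  have hT : ContractingWith (1 / 2) T := by
    refine ⟨by norm_num, LipschitzWith.of_dist_le_mul fun w w' => ?_⟩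
    refine (BoundedContinuousFunction.dist_le (by positivity)).2 fun y => ?_
    have := hdiff w w.2 w' w'.2 y
    rw [Real.dist_eq]
    refine this.trans (le_of_eq ?_)
    simp [Subtype.dist_eq]
  have : CompleteSpace B := Metric.isClosed_closedBall.completeSpace_coe
  obtain ⟨w, hw, -⟩ := hT.exists_fixedPoint ⟨0, h0B⟩ (edist_ne_top _ _)
  refine ⟨U w, hUc w, fun t x => ?_, fun t ht x => ?_⟩
  · have h1 : |(w : E) (t, x)| ≤ N * |ε| :=
      ((w : E).norm_coe_le_norm _).trans (mem_closedBall_zero_iff.1 w.2)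
    have h2 : weight h |t| (radius (pt x)) * |U w t x| = |(w : E) (t, x)| := by
      have := hκ0 (t, x)
      change κ (t, x) * |(w : E) (t, x) / κ (t, x)| = _
      rw [abs_div, abs_of_pos this]
      field_simp
    rw [h2]
    exact h1
  · have h1 : (w : E) (t, x) = Φ w (t, x) := by
      conv_lhs => rw [← hw]
      rfl
    have h2 := hκ0 (t, x)
    change (w : E) (t, x) / κ (t, x) = _
    rw [h1]
    simp only [Φ, abs_of_nonneg ht, lin]
    field_simp

/-! ### The weak formulation in horocyclic coordinates -/

theorem continuous_conjWave {ψ : ℝ × ℝ × ℝ → ℝ} (hψ : ContDiff ℝ ∞ ψ) : Continuous (conjWave ψ) := by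
  have hD : ∀ e, Continuous (dirDeriv e (dirDeriv e ψ)) := fun e =>
    (contDiff_dirDeriv (contDiff_dirDeriv hψ e) e).continuous
  have c1 := hD e₁
  have c2 := hD e₂
  have c3 := hD e₃
  unfold conjWave
  fun_prop

theorem hasCompactSupport_conjWave {ψ : ℝ × ℝ × ℝ → ℝ} (hs : HasCompactSupport ψ) :
    HasCompactSupport (conjWave ψ) := by
  have hD : ∀ e, HasCompactSupport (dirDeriv e (dirDeriv e ψ)) := fun e =>
    hasCompactSupport_dirDeriv (hasCompactSupport_dirDeriv hs e) e
  exact ((hD e₁).sub (hD e₃)).sub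
    ((hD e₂).mul_left (f := fun p : ℝ × ℝ × ℝ => Real.exp (2 * p.2.2)))

theorem hasDerivAt_time {f : ℝ × ℝ × ℝ → ℝ} (hf : ContDiff ℝ ∞ f) (q : ℝ × ℝ) (t : ℝ) :
    HasDerivAt (fun s => f (s, q)) (dirDeriv e₁ f (t, q)) t :=
  dirDeriv_comp_hasDerivAt hf ((hasDerivAt_id t).prodMk (hasDerivAt_const t q))

/-- The coefficients do not depend on time, so the time derivative commutes with the operator. -/
theorem hasDerivAt_conjWave {ψ : ℝ × ℝ × ℝ → ℝ} (hψ : ContDiff ℝ ∞ ψ) (q : ℝ × ℝ) (t : ℝ) :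
    HasDerivAt (fun s => conjWave ψ (s, q)) (conjWave (dirDeriv e₁ ψ) (t, q)) t := by
  have h : ∀ e, HasDerivAt (fun s => dirDeriv e (dirDeriv e ψ) (s, q))
      (dirDeriv e (dirDeriv e (dirDeriv e₁ ψ)) (t, q)) t := fun e => by
    have := hasDerivAt_time (contDiff_dirDeriv (contDiff_dirDeriv hψ e) e) q t
    rwa [dirDeriv_comm (contDiff_dirDeriv hψ e) e₁ e, dirDeriv_comm hψ e₁ e] at this
  exact ((h e₁).sub (h e₃)).sub ((h e₂).const_mul (Real.exp (2 * q.2)))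

theorem exists_eq_zero_of_hasCompactSupport {χ : ℝ × ℝ × ℝ → ℝ} (hs : HasCompactSupport χ) :
    ∃ R > 0, ∀ t q, (R < |t| ∨ R < ‖q‖) → χ (t, q) = 0 := by
  obtain ⟨R, hR, h⟩ := hs.isBounded.exists_pos_norm_le
  refine ⟨R, hR, fun t q htq => ?_⟩
  by_contra hne
  have := h (t, q) (subset_tsupport χ hne)
  simp only [Prod.norm_mk, Real.norm_eq_abs, sup_le_iff] at this
  grind

theorem hasCompactSupport_slice {χ : ℝ × ℝ × ℝ → ℝ} (hs : HasCompactSupport χ) (t : ℝ) :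
    HasCompactSupport fun q => χ (t, q) := by
  obtain ⟨R, _, hR⟩ := exists_eq_zero_of_hasCompactSupport hs
  refine HasCompactSupport.of_support_subset_isCompact (isCompact_closedBall 0 R) fun q hq => ?_
  rw [mem_closedBall_zero_iff]
  by_contra! hlt
  exact hq (hR t q (.inr hlt))

theorem integrable_prod_of_restrict {f : ℝ × ℝ × ℝ → ℝ} (hf : Continuous f) (hs : HasCompactSupport f)
    (S : Set ℝ) : Integrable f ((volume.restrict S).prod volume) := by
  have h : Integrable f (volume.prod volume) := by
    rw [← Measure.volume_eq_prod]; exact hf.integrable_of_hasCompactSupport hs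
  exact h.mono_measure (Measure.prod_mono Measure.restrict_le_self le_rfl)

theorem continuous_propagator_slice {χ : ℝ × ℝ × ℝ → ℝ} (hχ : Continuous χ) :
    Continuous fun y : ℝ × ℝ × ℝ => propagator y.1 (fun q => χ (y.1, q)) y.2 :=
  continuous_propagator (v := fun (y : ℝ × ℝ × ℝ) q => χ (y.1, q))
    (hχ.comp (by fun_prop : Continuous fun p : (ℝ × ℝ × ℝ) × (ℝ × ℝ) => (p.1.1, p.2)))
    (by fun_prop) (by fun_prop)

/-- Fubini, justified by finite speed: on the bounded range of times where `χ` lives, the propagated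
functions have a common compact support. -/
theorem integral_mul_integral_propagator {χ : ℝ × ℝ × ℝ → ℝ} (hχ : Continuous χ)
    (hs : HasCompactSupport χ) {g : ℝ × ℝ → ℝ} (hg : Continuous g) :
    ∫ t in Ioi (0 : ℝ), ∫ q, g q * propagator t (fun q => χ (t, q)) q =
      ∫ q, g q * ∫ t in Ioi (0 : ℝ), propagator t (fun q => χ (t, q)) q := by
  obtain ⟨R, hR0, hR⟩ := exists_eq_zero_of_hasCompactSupport hs
  obtain ⟨R', hR'⟩ := propagator_eq_zero_of_lt_norm R R
  have hc : Continuous fun y : ℝ × ℝ × ℝ => g y.2 * propagator y.1 (fun q => χ (y.1, q)) y.2 :=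
    (by fun_prop : Continuous fun y : ℝ × ℝ × ℝ => g y.2).mul (continuous_propagator_slice hχ)
  have hsupp : HasCompactSupport fun y : ℝ × ℝ × ℝ =>
      g y.2 * propagator y.1 (fun q => χ (y.1, q)) y.2 := by
    refine HasCompactSupport.of_support_subset_isCompact (isCompact_closedBall 0 (max R R'))
      fun y hy => ?_
    rw [mem_closedBall_zero_iff]
    by_contra! hlt
    apply hy
    have h0 : propagator y.1 (fun q => χ (y.1, q)) y.2 = 0 := by
      by_cases hy1 : |y.1| ≤ R
      · refine hR' y.1 (abs_le.1 hy1) _ (fun q hq => hR _ _ (.inr hq)) _ ?_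
        rw [Prod.norm_def, Real.norm_eq_abs] at hlt
        rcases lt_max_iff.1 hlt with h | h
        · exact absurd (le_max_left R R') (by linarith)
        · exact (le_max_right R R').trans_lt h
      · push Not at hy1
        have : (fun q => χ (y.1, q)) = fun _ => 0 := funext fun q => hR _ _ (.inl hy1)
        rw [this]
        simp [propagator]
    simp only [h0, mul_zero]
  rw [integral_integral_swap (f := fun t q => g q * propagator t (fun q => χ (t, q)) q)
    (integrable_prod_of_restrict hc hsupp _)]
  simp only [integral_const_mul]

/-- Move the propagator onto the test function by symmetry and apply Duhamel's formula for test
functions at time zero. This is the weak equation for an initial velocity `g`. -/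
theorem integral_propagator_mul_conjWave {ψ : ℝ × ℝ × ℝ → ℝ} (hψ : ContDiff ℝ ∞ ψ)
    (hs : HasCompactSupport ψ) {g : ℝ × ℝ → ℝ} (hg : Continuous g) :
    ∫ t in Ioi (0 : ℝ), ∫ q, propagator t g q * conjWave ψ (t, q) = ∫ q, g q * ψ (0, q) := by
  have hχ := continuous_conjWave hψ
  have hχs := hasCompactSupport_conjWave hs
  have h1 : ∀ t, ∫ q, propagator t g q * conjWave ψ (t, q) =
      ∫ q, g q * propagator t (fun q => conjWave ψ (t, q)) q := fun t =>
    integral_propagator_mul t hg (by fun_prop) (hasCompactSupport_slice hχs t)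
  simp only [h1]
  rw [integral_mul_integral_propagator hχ hχs hg]
  have h2 := integral_propagator_conjWave hψ hs 0
  simp only [zero_add] at h2
  simp only [h2]

/-- Integration by parts in `t` reduces the case of an initial position to the previous one with `∂ₜ
ψ` in place of `ψ`. The boundary term vanishes because the propagator is zero at `t = 0`. -/
theorem integral_deriv_mul_conjWave {ψ : ℝ × ℝ × ℝ → ℝ} (hψ : ContDiff ℝ ∞ ψ)
    (hs : HasCompactSupport ψ) {g : ℝ × ℝ → ℝ} (hg : Continuous g) {z : ℝ → ℝ × ℝ → ℝ}
    (hz : Continuous (Function.uncurry z))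
    (hd : ∀ t > 0, ∀ q, HasDerivAt (fun s => propagator s g q) (z t q) t) :
    ∫ t in Ioi (0 : ℝ), ∫ q, z t q * conjWave ψ (t, q) = -∫ q, g q * dirDeriv e₁ ψ (0, q) := by
  have hψ' := contDiff_dirDeriv hψ e₁
  have hs' := hasCompactSupport_dirDeriv hs e₁
  have hχ := continuous_conjWave hψ
  have hχs := hasCompactSupport_conjWave hs
  have hχ' := continuous_conjWave hψ'
  have hχs' := hasCompactSupport_conjWave hs'
  have hP : Continuous fun y : ℝ × ℝ × ℝ => propagator y.1 g y.2 :=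
    continuous_propagator (v := fun (_ : ℝ × ℝ × ℝ) q => g q) (hg.comp continuous_snd)
      (by fun_prop) (by fun_prop)
  have hc1 : Continuous fun y : ℝ × ℝ × ℝ => z y.1 y.2 * conjWave ψ y := hz.mul hχ
  have hc2 : Continuous fun y : ℝ × ℝ × ℝ => propagator y.1 g y.2 * conjWave (dirDeriv e₁ ψ) y :=
    hP.mul hχ'
  have i1 := integrable_prod_of_restrict hc1 hχs.mul_left (Ioi 0)
  have i2 := integrable_prod_of_restrict hc2 hχs'.mul_left (Ioi 0)
  rw [← integral_propagator_mul_conjWave hψ' hs' hg,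
    integral_integral_swap (f := fun t q => z t q * conjWave ψ (t, q)) i1,
    integral_integral_swap (f := fun t q => propagator t g q * conjWave (dirDeriv e₁ ψ) (t, q)) i2,
    ← integral_neg]
  congr 1 with q
  obtain ⟨R, hR0, hR⟩ := exists_eq_zero_of_hasCompactSupport hχs
  obtain ⟨R', hR0', hR'⟩ := exists_eq_zero_of_hasCompactSupport hχs'
  have slice : ∀ {f : ℝ × ℝ × ℝ → ℝ}, Continuous f → ∀ ρ, (∀ t, ρ < |t| → f (t, q) = 0) →
      IntegrableOn (fun t => f (t, q)) (Ioi 0) := by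
    intro f hf ρ h0
    refine Integrable.integrableOn (Continuous.integrable_of_hasCompactSupport (by fun_prop)
      (HasCompactSupport.of_support_subset_isCompact (isCompact_closedBall 0 ρ) fun t ht => ?_))
    rw [mem_closedBall_zero_iff, Real.norm_eq_abs]
    by_contra! hlt
    exact ht (h0 t hlt)
  have j1 := slice hc1 R fun t ht => by simp only [hR t q (.inl ht), mul_zero]
  have j2 := slice hc2 R' fun t ht => by simp only [hR' t q (.inl ht), mul_zero]
  have h := integral_Ioi_of_hasDerivAt_of_tendsto (a := 0) (m := 0)
    (f := fun t => propagator t g q * conjWave ψ (t, q))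
    (f' := fun t => z t q * conjWave ψ (t, q) + propagator t g q * conjWave (dirDeriv e₁ ψ) (t, q))
    ?_ (fun t ht => (hd t ht q).mul (hasDerivAt_conjWave hψ q t)) (j1.add j2) ?_
  · rw [integral_add j1 j2] at h
    have h0 : propagator 0 g q = 0 := by simp [propagator]
    rw [h0, zero_mul, sub_zero] at h
    linarith
  · exact ((hP.mul hχ).comp (by fun_prop : Continuous fun t : ℝ => (t, q))).continuousWithinAt
  · refine tendsto_const_nhds.congr' ?_
    filter_upwards [eventually_gt_atTop R] with t ht
    rw [hR t q (.inl (ht.trans_le (le_abs_self t))), mul_zero]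

/-- Fubini on `0 < s < t`, symmetry of the propagator for each pair `(t, s)`, and the shift `t = s +
τ`. For fixed `s` the inner integral is then Duhamel's formula for test functions with vertex time
`s`. -/
theorem integral_duhamel_mul_conjWave {ψ : ℝ × ℝ × ℝ → ℝ} (hψ : ContDiff ℝ ∞ ψ)
    (hs : HasCompactSupport ψ) {f : ℝ → ℝ × ℝ → ℝ} (hf : Continuous (Function.uncurry f)) :
    ∫ t in Ioi (0 : ℝ), ∫ q, (∫ s in (0 : ℝ)..t, propagator (t - s) (f s) q) * conjWave ψ (t, q) =
      ∫ s in Ioi (0 : ℝ), ∫ q, f s q * ψ (s, q) := by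
  set χ := conjWave ψ with hχdef
  have hχ : Continuous χ := continuous_conjWave hψ
  have hχs : HasCompactSupport χ := hasCompactSupport_conjWave hs
  have hfs : ∀ s, Continuous (f s) := fun s =>
    hf.comp (by fun_prop : Continuous fun q : ℝ × ℝ => (s, q))
  have hχt : ∀ t, Continuous fun q => χ (t, q) := fun t => by fun_prop
  obtain ⟨R, hR0, hR⟩ := exists_eq_zero_of_hasCompactSupport hχs
  obtain ⟨R', hR'⟩ := propagator_eq_zero_of_lt_norm R R
  set K : (ℝ × ℝ) × (ℝ × ℝ) → ℝ := fun y =>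
    f y.1.2 y.2 * propagator (y.1.1 - y.1.2) (fun q => χ (y.1.1, q)) y.2 with hK
  have hKc : Continuous K := by
    refine (hf.comp (by fun_prop : Continuous fun y : (ℝ × ℝ) × (ℝ × ℝ) => (y.1.2, y.2))).mul ?_
    exact continuous_propagator (v := fun (y : (ℝ × ℝ) × (ℝ × ℝ)) q => χ (y.1.1, q))
      (hχ.comp (by fun_prop : Continuous fun p : ((ℝ × ℝ) × (ℝ × ℝ)) × (ℝ × ℝ) => (p.1.1.1, p.2)))
      (by fun_prop) (by fun_prop)
  set Ω : Set (ℝ × ℝ) := {p | 0 < p.2 ∧ p.2 < p.1} with hΩ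
  have hΩm : MeasurableSet Ω :=
    (measurableSet_lt measurable_const measurable_snd).inter
      (measurableSet_lt measurable_snd measurable_fst)
  have hΩm' : MeasurableSet (Ω ×ˢ (univ : Set (ℝ × ℝ))) := hΩm.prod MeasurableSet.univ
  set L : (ℝ × ℝ) × (ℝ × ℝ) → ℝ := (Ω ×ˢ univ).indicator K with hL
  have hLint : Integrable L (volume.prod volume) := by
    set ball : Set ((ℝ × ℝ) × (ℝ × ℝ)) :=
      (Icc 0 R ×ˢ Icc 0 R) ×ˢ Metric.closedBall 0 R' with hball
    have hballc : IsCompact ball :=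
      (isCompact_Icc.prod isCompact_Icc).prod (isCompact_closedBall _ _)
    have h1 : IntegrableOn L ball (volume.prod volume) := by
      rw [← Measure.volume_eq_prod]
      exact (hKc.continuousOn.integrableOn_compact hballc).indicator hΩm'
    refine (integrableOn_iff_integrable_of_support_subset fun y hy => ?_).1 h1
    have hyΩ : y.1 ∈ Ω := by
      by_contra hn
      exact hy (indicator_of_notMem (fun h => hn h.1) _)
    have hyK : K y ≠ 0 := by
      intro h0
      apply hy
      rw [hL, indicator_of_mem (show y ∈ Ω ×ˢ univ from ⟨hyΩ, mem_univ _⟩), h0]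
    have hP0 : propagator (y.1.1 - y.1.2) (fun q => χ (y.1.1, q)) y.2 ≠ 0 := right_ne_zero_of_mul hyK
    have hy1 : y.1.1 ≤ R := by
      by_contra! hlt
      apply hP0
      have : (fun q => χ (y.1.1, q)) = fun _ => 0 := funext fun q =>
        hR _ _ (.inl (hlt.trans_le (le_abs_self _)))
      rw [this]
      simp [propagator]
    have hy2 : ‖y.2‖ ≤ R' := by
      by_contra! hlt
      exact hP0 (hR' _ ⟨by linarith [hyΩ.2], by linarith [hyΩ.1]⟩ _
        (fun q hq => hR _ _ (.inr hq)) _ hlt)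
    exact ⟨⟨⟨by linarith [hyΩ.1, hyΩ.2], hy1⟩, ⟨hyΩ.1.le, by linarith [hyΩ.2]⟩⟩, by simpa using hy2⟩
  set H : ℝ → ℝ → ℝ := fun t s => ∫ q, L ((t, s), q) with hH
  have hHint : Integrable (Function.uncurry H) (volume.prod volume) := by
    rw [← Measure.volume_eq_prod]
    exact hLint.integral_prod_left
  have hHin : ∀ t s, 0 < s → s < t → H t s = ∫ q, K ((t, s), q) := fun t s h0 h1 => by
    refine integral_congr_ae (.of_forall fun q => ?_)
    exact indicator_of_mem (show ((t, s), q) ∈ Ω ×ˢ univ from ⟨⟨h0, h1⟩, mem_univ _⟩) _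
  have hHout : ∀ t s, ¬ (0 < s ∧ s < t) → H t s = 0 := fun t s hn => by
    have : ∀ q, L ((t, s), q) = 0 := fun q => indicator_of_notMem (fun h => hn h.1) _
    simp only [hH, this, integral_zero]
  have hleft : ∀ t ∈ Ioi (0 : ℝ),
      ∫ q, (∫ s in (0 : ℝ)..t, propagator (t - s) (f s) q) * χ (t, q) = ∫ s, H t s := by
    intro t ht
    have hint : Integrable (Function.uncurry fun (q : ℝ × ℝ) s =>
        propagator (t - s) (f s) q * χ (t, q)) (volume.prod (volume.restrict (Icc 0 t))) := by
      refine integrable_prod_restrict_of_isCompact ?_ (isCompact_closedBall (0 : ℝ × ℝ) R)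
        isCompact_Icc fun q s _ hq => ?_
      · refine Continuous.mul ?_ (hχ.comp (by fun_prop : Continuous fun p : (ℝ × ℝ) × ℝ => (t, p.1)))
        exact continuous_propagator (v := fun (p : (ℝ × ℝ) × ℝ) => f p.2)
          (hf.comp (by fun_prop : Continuous fun p : ((ℝ × ℝ) × ℝ) × (ℝ × ℝ) => (p.1.2, p.2)))
          (by fun_prop) (by fun_prop)
      · simp only [Function.uncurry_apply_pair]
        rw [hR t q (.inr (by simpa using hq)), mul_zero]
    have h1 : ∀ q, (∫ s in (0 : ℝ)..t, propagator (t - s) (f s) q) * χ (t, q) =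
        ∫ s in Icc 0 t, propagator (t - s) (f s) q * χ (t, q) := fun q => by
      rw [intervalIntegral.integral_of_le (le_of_lt ht), ← integral_Icc_eq_integral_Ioc,
        integral_mul_const]
    simp only [h1]
    rw [integral_integral_swap hint, integral_Icc_eq_integral_Ioo,
      ← integral_indicator measurableSet_Ioo]
    congr 1 with s
    by_cases hst : s ∈ Ioo 0 t
    · rw [indicator_of_mem hst, hHin t s hst.1 hst.2]
      exact integral_propagator_mul _ (hfs s) (hχt t) (hasCompactSupport_slice hχs t)
    · rw [indicator_of_notMem hst, hHout t s hst]
  have hright : ∀ s ∈ Ioi (0 : ℝ), ∫ t, H t s = ∫ q, f s q * ψ (s, q) := by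
    intro s hs0
    rw [← integral_add_left_eq_self _ s]
    have h1 : ∀ τ, H (s + τ) s = (Ioi (0 : ℝ)).indicator
        (fun τ => ∫ q, f s q * propagator τ (fun q => χ (s + τ, q)) q) τ := by
      intro τ
      by_cases hτ : τ ∈ Ioi (0 : ℝ)
      · rw [indicator_of_mem hτ, hHin _ _ hs0 (by linarith [mem_Ioi.1 hτ])]
        simp only [hK, add_sub_cancel_left]
      · rw [indicator_of_notMem hτ, hHout]
        intro h
        exact hτ (mem_Ioi.2 (by linarith [h.2]))
    simp only [h1]
    have hsh : HasCompactSupport fun y : ℝ × ℝ × ℝ => χ (s + y.1, y.2) := by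
      have := hχs.comp_homeomorph ((Homeomorph.addLeft s).prodCongr (Homeomorph.refl (ℝ × ℝ)))
      exact this
    rw [integral_indicator measurableSet_Ioi, integral_mul_integral_propagator
      (χ := fun y => χ (s + y.1, y.2)) (by fun_prop) hsh (hfs s)]
    simp only [hχdef, integral_propagator_conjWave hψ hs s]
  rw [setIntegral_congr_fun measurableSet_Ioi hleft]
  have hfull : ∫ t in Ioi (0 : ℝ), ∫ s, H t s = ∫ t, ∫ s, H t s := by
    refine setIntegral_eq_integral_of_forall_compl_eq_zero fun t ht => ?_
    have : ∀ s, H t s = 0 := fun s => hHout t s fun h => ht (mem_Ioi.2 (h.1.trans h.2))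
    simp only [this, integral_zero]
  rw [hfull, integral_integral_swap hHint, ← setIntegral_congr_fun measurableSet_Ioi hright]
  refine (setIntegral_eq_integral_of_forall_compl_eq_zero fun s hs0 => ?_).symm
  have : ∀ t, H t s = 0 := fun t => hHout t s fun h => hs0 h.1
  simp only [this, integral_zero]

/-! ### Test functions in horocyclic coordinates -/

/-- Since `pt` is a measurable embedding, the change of variables holds for every `f`, with no
measurability or integrability assumed. -/
theorem integral_volume_eq_pt (f : ℍ → ℝ) : ∫ z, f z = ∫ q, Real.exp (-q.2) * f (pt q) := by
  have hd : Measurable fun q : ℝ × ℝ => ENNReal.ofReal (Real.exp (-q.2)) := by fun_prop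
  have hmap : (volume : Measure ℍ) =
      ((volume : Measure (ℝ × ℝ)).withDensity fun q => ENNReal.ofReal (Real.exp (-q.2))).map pt := by
    refine Measure.ext_of_lintegral _ fun f hf => ?_
    rw [lintegral_volume_eq_pt hf, lintegral_map hf continuous_pt.measurable,
      lintegral_withDensity_eq_lintegral_mul _ hd (g := fun q => f (pt q))
        (hf.comp continuous_pt.measurable)]
    rfl
  have hemb : MeasurableEmbedding pt := ptHomeo.measurableEmbedding
  rw [hmap, hemb.integral_map, integral_withDensity_eq_integral_toReal_smul hd
    (ae_of_all _ fun _ => ENNReal.ofReal_lt_top)]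
  simp only [ENNReal.toReal_ofReal (Real.exp_pos _).le, smul_eq_mul]

/-- A function of time and space, multiplied by the square root of the horocyclic density. -/
def conj (φ : ℝ → ℍ → ℝ) (y : ℝ × ℝ × ℝ) : ℝ := Real.exp (-y.2.2 / 2) * φ y.1 (pt y.2)

theorem isOpen_upper : IsOpen {w : ℂ | 0 < w.im} := isOpen_lt continuous_const Complex.continuous_im

theorem IsTestFunction.contDiff_conj {φ : ℝ → ℍ → ℝ} (hφ : IsTestFunction φ) :
    ContDiff ℝ ∞ (conj φ) := by
  have h : ContDiff ℝ ∞ fun y : ℝ × ℝ × ℝ => φ y.1 (pt y.2) := by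
    have e : (fun y : ℝ × ℝ × ℝ => φ y.1 (pt y.2)) = (fun q : ℝ × ℂ => φ q.1 (ofComplex q.2)) ∘
        fun y : ℝ × ℝ × ℝ => (y.1, Complex.equivRealProdCLM.symm (y.2.1, Real.exp y.2.2)) := by
      ext y
      simp only [Function.comp, ← coe_pt, ofComplex_apply]
    rw [e, ← contDiffOn_univ]
    refine hφ.smooth.comp (ContDiff.contDiffOn (by fun_prop)) fun y _ => ?_
    simp [Real.exp_pos]
  exact ContDiff.mul (by fun_prop) h

theorem IsTestFunction.hasCompactSupport_conj {φ : ℝ → ℍ → ℝ} (hφ : IsTestFunction φ) :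
    HasCompactSupport (conj φ) := by
  have h := hφ.compact.comp_homeomorph ((Homeomorph.refl ℝ).prodCongr ptHomeo)
  exact h.mul_left (f := fun y : ℝ × ℝ × ℝ => Real.exp (-y.2.2 / 2))

/-! ### Conjugation of the wave operator by the square root of the density. -/

theorem hasDerivAt_second {g : ℝ × ℝ × ℝ → ℝ} (hg : ContDiff ℝ ∞ g) (t a σ : ℝ) :
    HasDerivAt (fun s => g (t, s, σ)) (dirDeriv e₂ g (t, a, σ)) a :=
  dirDeriv_comp_hasDerivAt hg
    ((hasDerivAt_const a t).prodMk ((hasDerivAt_id a).prodMk (hasDerivAt_const a σ)))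

theorem dirDeriv_time_conj {φ : ℝ → ℍ → ℝ} (hφ : IsTestFunction φ) (t : ℝ) (q : ℝ × ℝ) :
    HasDerivAt (fun s => φ s (pt q)) (Real.exp (q.2 / 2) * dirDeriv e₁ (conj φ) (t, q)) t := by
  have h := (hasDerivAt_time hφ.contDiff_conj q t).const_mul (Real.exp (q.2 / 2))
  refine h.congr_of_eventuallyEq (.of_forall fun s => ?_)
  simp only [conj]
  rw [← mul_assoc, ← Real.exp_add, neg_div, add_neg_cancel, Real.exp_zero, one_mul]

theorem iteratedDeriv_two_eq {φ : ℝ → ℍ → ℝ} (hφ : IsTestFunction φ) (t : ℝ) (q : ℝ × ℝ) :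
    iteratedDeriv 2 (fun s => φ s (pt q)) t =
      Real.exp (q.2 / 2) * dirDeriv e₁ (dirDeriv e₁ (conj φ)) (t, q) := by
  have h1 : deriv (fun s => φ s (pt q)) =
      fun s => Real.exp (q.2 / 2) * dirDeriv e₁ (conj φ) (s, q) :=
    funext fun s => (dirDeriv_time_conj hφ s q).deriv
  rw [iteratedDeriv_succ, iteratedDeriv_one, h1]
  exact ((hasDerivAt_time (contDiff_dirDeriv hφ.contDiff_conj e₁) q t).const_mul _).deriv

theorem hasDerivAt_clm_apply_comp {E : Type*} [NormedAddCommGroup E] [NormedSpace ℝ E]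
    {g : E → E →L[ℝ] ℝ} {D : E →L[ℝ] E →L[ℝ] ℝ} {c : ℝ → E} {c' : E} {a : ℝ}
    (hg : HasFDerivAt g D (c a)) (hc : HasDerivAt c c' a) (v : E) :
    HasDerivAt (fun s => g (c s) v) (D c' v) a := by
  have h1 : HasDerivAt (fun s => g (c s)) (D c') a := hg.comp_hasDerivAt a hc
  have h2 : HasDerivAt (fun s => g (c s) v) _ a := h1.clm_apply (hasDerivAt_const a v)
  simpa using h2

/-- With height `exp σ` the vertical part of the Laplacian is `∂_σ² - ∂_σ`. Conjugation by `exp (-σ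
/ 2)` completes the square to `∂_σ² - 1/4`, and the shift by `1/4` removes the constant. -/
theorem laplaceBeltrami_eq {φ : ℝ → ℍ → ℝ} (hφ : IsTestFunction φ) (t a σ : ℝ) :
    laplaceBeltrami (φ t) (pt (a, σ)) + 1 / 4 * φ t (pt (a, σ)) = Real.exp (σ / 2) *
      (dirDeriv e₃ (dirDeriv e₃ (conj φ)) (t, a, σ) +
        Real.exp (2 * σ) * dirDeriv e₂ (dirDeriv e₂ (conj φ)) (t, a, σ)) := by
  have hψ := hφ.contDiff_conj
  obtain ⟨f, hf⟩ : ∃ f, f = inChart (φ t) := ⟨_, rfl⟩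
  have hfs : ContDiffOn ℝ ∞ f {w : ℂ | 0 < w.im} := by
    rw [hf]
    exact hφ.smooth.comp (ContDiff.contDiffOn (by fun_prop : ContDiff ℝ ∞ fun w : ℂ => (t, w)))
      fun w hw => hw
  have hfs' : ContDiffOn ℝ ∞ (fderiv ℝ f) {w : ℂ | 0 < w.im} :=
    hfs.fderiv_of_isOpen isOpen_upper (by simp)
  have hd : ∀ w : ℂ, 0 < w.im → HasFDerivAt f (fderiv ℝ f w) w := fun w hw =>
    ((hfs.contDiffAt (isOpen_upper.mem_nhds hw)).differentiableAt (by simp)).hasFDerivAt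
  have hd' : ∀ w : ℂ, 0 < w.im → HasFDerivAt (fderiv ℝ f) (fderiv ℝ (fderiv ℝ f) w) w := fun w hw =>
    ((hfs'.contDiffAt (isOpen_upper.mem_nhds hw)).differentiableAt (by simp)).hasFDerivAt
  obtain ⟨c, hc⟩ : ∃ c : ℝ → ℝ → ℂ, c = fun a σ : ℝ => (a : ℂ) + (Real.exp σ : ℂ) * Complex.I :=
    ⟨_, rfl⟩
  have him : ∀ a σ, 0 < (c a σ).im := fun a σ => by simp [hc, Real.exp_pos, -Complex.ofReal_exp]
  have hcpt : ∀ a σ, ((pt (a, σ) : ℍ) : ℂ) = c a σ := fun a σ => by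
    apply Complex.ext <;> simp [hc, -Complex.ofReal_exp]
  have hφf : ∀ a σ, φ t (pt (a, σ)) = f (c a σ) := fun a σ => by
    simp only [hf, inChart, ← hcpt, ofComplex_apply]
  have hc1 : ∀ a σ, HasDerivAt (fun s => c s σ) 1 a := fun a σ => by
    rw [hc]
    exact (Complex.ofRealCLM.hasDerivAt (x := a)).add_const _
  have hc2 : ∀ a σ, HasDerivAt (fun s => c a s) (Real.exp σ • Complex.I) σ := fun a σ => by
    rw [Complex.real_smul, hc]
    exact ((Real.hasDerivAt_exp σ).ofReal_comp.mul_const Complex.I).const_add (a : ℂ)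
  have hexp : ∀ σ, HasDerivAt (fun s : ℝ => Real.exp (-s / 2)) (Real.exp (-σ / 2) * (-1 / 2)) σ :=
    fun σ => ((hasDerivAt_id σ).neg.div_const 2).exp
  have h2 : ∀ a σ, dirDeriv e₂ (conj φ) (t, a, σ) =
      Real.exp (-σ / 2) * fderiv ℝ f (c a σ) 1 := fun a σ => by
    refine (hasDerivAt_second hψ t a σ).unique ?_
    have := ((hd _ (him a σ)).comp_hasDerivAt a (hc1 a σ)).const_mul (Real.exp (-σ / 2))
    exact this.congr_of_eventuallyEq (.of_forall fun s => by simp only [conj, hφf, Function.comp])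
  have h22 : dirDeriv e₂ (dirDeriv e₂ (conj φ)) (t, a, σ) =
      Real.exp (-σ / 2) * fderiv ℝ (fderiv ℝ f) (c a σ) 1 1 := by
    refine (hasDerivAt_second (contDiff_dirDeriv hψ e₂) t a σ).unique ?_
    simp only [h2]
    exact (hasDerivAt_clm_apply_comp (c := fun s => c s σ) (hd' _ (him a σ)) (hc1 a σ)
      1).const_mul _
  have h3 : ∀ a σ, dirDeriv e₃ (conj φ) (t, a, σ) = Real.exp (-σ / 2) * (-1 / 2) * f (c a σ) +
      Real.exp (-σ / 2) * (Real.exp σ * fderiv ℝ f (c a σ) Complex.I) := fun a σ => by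
    refine (hasDerivAt_third hψ t a σ).unique ?_
    have := (hexp σ).mul ((hd _ (him a σ)).comp_hasDerivAt σ (hc2 a σ))
    refine (this.congr_of_eventuallyEq (.of_forall fun s => ?_)).congr_deriv ?_
    · simp only [conj, hφf]; rfl
    · simp [-Complex.real_smul]
  have h33 : dirDeriv e₃ (dirDeriv e₃ (conj φ)) (t, a, σ) =
      Real.exp (-σ / 2) * (1 / 4 * f (c a σ) +
        Real.exp (2 * σ) * fderiv ℝ (fderiv ℝ f) (c a σ) Complex.I Complex.I) := by
    refine (hasDerivAt_third (contDiff_dirDeriv hψ e₃) t a σ).unique ?_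
    simp only [h3]
    have d1 := ((hexp σ).mul_const (-1 / 2)).mul ((hd _ (him a σ)).comp_hasDerivAt σ (hc2 a σ))
    have d2 := (hexp σ).mul ((Real.hasDerivAt_exp σ).mul
      (hasDerivAt_clm_apply_comp (c := fun s => c a s) (hd' _ (him a σ)) (hc2 a σ) Complex.I))
    refine (d1.add d2).congr_deriv ?_
    have e : Real.exp (2 * σ) = Real.exp σ * Real.exp σ := by rw [← Real.exp_add]; ring_nf
    rw [e]
    simp [-Complex.real_smul]
    ring
  have hlap : laplaceBeltrami (φ t) (pt (a, σ)) = Real.exp (2 * σ) *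
      (fderiv ℝ (fderiv ℝ f) (c a σ) 1 1 + fderiv ℝ (fderiv ℝ f) (c a σ) Complex.I Complex.I) := by
    rw [laplaceBeltrami, ← hf, hcpt, InnerProductSpace.laplacian_eq_iteratedFDeriv_complexPlane]
    simp only [iteratedFDeriv_two_apply, pt_im]
    rw [← Real.exp_nat_mul]
    simp
  have e1 : Real.exp (σ / 2) * Real.exp (-σ / 2) = 1 := by rw [← Real.exp_add, neg_div]; simp
  rw [hlap, h22, h33, hφf]
  linear_combination (-(1 / 4 * f (c a σ) + Real.exp (2 * σ) * (fderiv ℝ (fderiv ℝ f) (c a σ) 1 1 +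
    fderiv ℝ (fderiv ℝ f) (c a σ) Complex.I Complex.I))) * e1

theorem waveOp_eq_conjWave {φ : ℝ → ℍ → ℝ} (hφ : IsTestFunction φ) (t : ℝ) (q : ℝ × ℝ) :
    waveOp φ t (pt q) = Real.exp (q.2 / 2) * conjWave (conj φ) (t, q) := by
  rw [waveOp, iteratedDeriv_two_eq hφ, laplaceBeltrami_eq hφ, conjWave]
  ring

/-! ### Weak solutions -/

theorem exp_mul_evol (t : ℝ) (f : ℝ × ℝ → ℝ) (x : ℝ × ℝ) : Real.exp (-x.2 / 2) * evol t f x =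
    propagator t (fun q => Real.exp (-q.2 / 2) * f q) x := by
  rw [evol, ← mul_assoc, ← Real.exp_add, neg_div, neg_add_cancel, Real.exp_zero, one_mul]

/-- The Riemannian density `exp (-σ)` is shared equally between the solution and the test function,
which turns every integral over `ℍ` into one with Lebesgue measure. Velocity, position and Duhamel
terms are then handled by the three duality lemmas. Compact support of the test function supplies
all integrability. -/
theorem weak_form {u : ℝ → ℝ × ℝ → ℝ} (hu : Continuous (Function.uncurry u)) {F : ℝ → ℝ}
    (hF : Continuous F) {u₀ u₁ : ℍ → ℝ} (hu₀ : IsC1 u₀) (hu₁ : Continuous u₁) {ε : ℝ}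
    (hmild : ∀ t, 0 ≤ t → ∀ x, u t x = ε * evol t (fun q => u₁ (pt q)) x +
      ε * diskIntegralDeriv t (fun q => u₀ (pt q)) x + duhamel (fun s q => F (u s q)) t x)
    {φ : ℝ → ℍ → ℝ} (hφ : IsTestFunction φ) :
    ∫ t in Ioi (0 : ℝ), ∫ z : ℍ, u t (ptHomeo.symm z) * waveOp φ t z =
      (∫ t in Ioi (0 : ℝ), ∫ z : ℍ, F (u t (ptHomeo.symm z)) * φ t z) +
        ∫ z : ℍ, (ε * u₁ z * φ 0 z - ε * u₀ z * deriv (fun s => φ s z) 0) := by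
  set ψ := conj φ with hψdef
  have hψ : ContDiff ℝ ∞ ψ := hφ.contDiff_conj
  have hψs : HasCompactSupport ψ := hφ.hasCompactSupport_conj
  have hψ₁ : ContDiff ℝ ∞ (dirDeriv e₁ ψ) := contDiff_dirDeriv hψ e₁
  have hχ := continuous_conjWave hψ
  have hχs := hasCompactSupport_conjWave hψs
  have hsymm : ∀ q, ptHomeo.symm (pt q) = q := ptHomeo.symm_apply_apply
  have hexp : ∀ σ : ℝ, Real.exp (-σ) = Real.exp (-σ / 2) * Real.exp (-σ / 2) := fun σ => by
    rw [← Real.exp_add]; ring_nf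
  have hexp' : ∀ σ : ℝ, Real.exp (-σ / 2) * Real.exp (σ / 2) = 1 := fun σ => by
    rw [← Real.exp_add, neg_div]; simp
  set v₀ : ℝ × ℝ → ℝ := fun q => Real.exp (-q.2 / 2) * u₀ (pt q) with hv₀
  set v₁ : ℝ × ℝ → ℝ := fun q => Real.exp (-q.2 / 2) * u₁ (pt q) with hv₁
  set f : ℝ → ℝ × ℝ → ℝ := fun s q => Real.exp (-q.2 / 2) * F (u s q) with hf
  set z : ℝ → ℝ × ℝ → ℝ := fun t q =>
    Real.exp (-q.2 / 2) * diskIntegralDeriv t (fun q => u₀ (pt q)) q with hz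
  have hpt := continuous_pt
  have hu₀c : Continuous u₀ := continuous_of_isC1 hu₀
  have hv₀c : Continuous v₀ := by fun_prop
  have hv₁c : Continuous v₁ := by fun_prop
  have hFu : Continuous (Function.uncurry fun s q => F (u s q)) := hF.comp hu
  have hfc : Continuous (Function.uncurry f) :=
    (by fun_prop : Continuous fun p : ℝ × ℝ × ℝ => Real.exp (-p.2.2 / 2)).mul hFu
  have hzc : Continuous (Function.uncurry z) :=
    (by fun_prop : Continuous fun p : ℝ × ℝ × ℝ => Real.exp (-p.2.2 / 2)).mul
      (continuous_diskIntegralDeriv (contDiff_comp_pt hu₀))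
  have hzd : ∀ t > 0, ∀ q, HasDerivAt (fun s => propagator s v₀ q) (z t q) t := fun t ht q => by
    have h1 := (hasDerivAt_diskIntegral (contDiff_comp_pt hu₀) t q).const_mul (Real.exp (-q.2 / 2))
    refine h1.congr_of_eventuallyEq ?_
    filter_upwards [lt_mem_nhds ht] with s hs
    rw [diskIntegral_eq_propagator (f := fun q => u₀ (pt q)) hs.le (hu₀c.comp hpt), ← mul_assoc, hexp', one_mul]
  have hWc : Continuous fun y : ℝ × ℝ × ℝ => ∫ s in (0 : ℝ)..y.1, propagator (y.1 - s) (f s) y.2 := by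
    refine intervalIntegral.continuous_parametric_intervalIntegral_of_continuous
      (f := fun (y : ℝ × ℝ × ℝ) s => propagator (y.1 - s) (f s) y.2) ?_ continuous_fst
    exact continuous_propagator (v := fun p : (ℝ × ℝ × ℝ) × ℝ => f p.2)
      (f := fun p => p.1.1 - p.2) (g := fun p => p.1.2)
      (hfc.comp (by fun_prop : Continuous fun p : ((ℝ × ℝ × ℝ) × ℝ) × (ℝ × ℝ) => (p.1.2, p.2)))
      (by fun_prop) (by fun_prop)
  have hPc : Continuous fun y : ℝ × ℝ × ℝ => propagator y.1 v₁ y.2 :=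
    continuous_propagator (v := fun (_ : ℝ × ℝ × ℝ) q => v₁ q) (hv₁c.comp continuous_snd)
      (by fun_prop) (by fun_prop)
  have hv : ∀ t ∈ Ioi (0 : ℝ), ∀ q, Real.exp (-q.2 / 2) * u t q = ε * propagator t v₁ q +
      ε * z t q + ∫ s in (0 : ℝ)..t, propagator (t - s) (f s) q := by
    intro t ht q
    rw [hmild t (le_of_lt ht) q]
    have h1 := exp_mul_evol t (fun q => u₁ (pt q)) q
    have h2 : Real.exp (-q.2 / 2) * duhamel (fun s q => F (u s q)) t q =
        ∫ s in (0 : ℝ)..t, propagator (t - s) (f s) q := by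
      rw [duhamel, ← intervalIntegral.integral_const_mul]
      refine intervalIntegral.integral_congr fun s _ => ?_
      exact exp_mul_evol (t - s) (fun q => F (u s q)) q
    rw [← h2, ← h1]
    simp only [hz]
    ring
  have hL : ∀ t ∈ Ioi (0 : ℝ), ∫ z : ℍ, u t (ptHomeo.symm z) * waveOp φ t z =
      ∫ q, (ε * (propagator t v₁ q * conjWave ψ (t, q)) + ε * (z t q * conjWave ψ (t, q)) +
        (∫ s in (0 : ℝ)..t, propagator (t - s) (f s) q) * conjWave ψ (t, q)) := by
    intro t ht
    rw [integral_volume_eq_pt]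
    refine integral_congr_ae (.of_forall fun q => ?_)
    simp only [hsymm]
    rw [waveOp_eq_conjWave hφ, hexp]
    have h1 := hv t ht q
    linear_combination conjWave (conj φ) (t, q) * h1 +
      Real.exp (-q.2 / 2) * u t q * conjWave (conj φ) (t, q) * hexp' q.2
  have hR : ∀ t ∈ Ioi (0 : ℝ), ∫ z : ℍ, F (u t (ptHomeo.symm z)) * φ t z =
      ∫ q, f t q * ψ (t, q) := by
    intro t _
    rw [integral_volume_eq_pt]
    refine integral_congr_ae (.of_forall fun q => ?_)
    simp only [hsymm, hf, hψdef, conj]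
    rw [hexp]
    ring
  have hI : ∫ z : ℍ, (ε * u₁ z * φ 0 z - ε * u₀ z * deriv (fun s => φ s z) 0) =
      ∫ q, (ε * (v₁ q * ψ (0, q)) - ε * (v₀ q * dirDeriv e₁ ψ (0, q))) := by
    rw [integral_volume_eq_pt]
    refine integral_congr_ae (.of_forall fun q => ?_)
    simp only
    rw [(dirDeriv_time_conj hφ 0 q).deriv, hexp]
    simp only [hψdef, conj, hv₁, hv₀]
    linear_combination (-(ε * Real.exp (-q.2 / 2) * u₀ (pt q) * dirDeriv e₁ (conj φ) (0, q))) *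
      hexp' q.2
  rw [setIntegral_congr_fun measurableSet_Ioi hL, setIntegral_congr_fun measurableSet_Ioi hR, hI]
  have hslice : ∀ {g : ℝ × ℝ × ℝ → ℝ}, Continuous g → HasCompactSupport g → ∀ t,
      Integrable fun q => g (t, q) := fun hg hgs t =>
    Continuous.integrable_of_hasCompactSupport (by fun_prop) (hasCompactSupport_slice hgs t)
  have hprod : ∀ {g : ℝ × ℝ × ℝ → ℝ}, Continuous g → HasCompactSupport g →
      IntegrableOn (fun t => ∫ q, g (t, q)) (Ioi 0) := fun hg hgs =>
    (integrable_prod_of_restrict hg hgs (Ioi 0)).integral_prod_left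
  have c1 : Continuous fun y : ℝ × ℝ × ℝ => propagator y.1 v₁ y.2 * conjWave ψ y := hPc.mul hχ
  have c2 : Continuous fun y : ℝ × ℝ × ℝ => z y.1 y.2 * conjWave ψ y := hzc.mul hχ
  have c3 : Continuous fun y : ℝ × ℝ × ℝ =>
    (∫ s in (0 : ℝ)..y.1, propagator (y.1 - s) (f s) y.2) * conjWave ψ y := hWc.mul hχ
  have s1 := hχs.mul_left (f := fun y : ℝ × ℝ × ℝ => propagator y.1 v₁ y.2)
  have s2 := hχs.mul_left (f := fun y : ℝ × ℝ × ℝ => z y.1 y.2)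
  have s3 := hχs.mul_left
    (f := fun y : ℝ × ℝ × ℝ => ∫ s in (0 : ℝ)..y.1, propagator (y.1 - s) (f s) y.2)
  have hsplit : ∀ t, ∫ q, (ε * (propagator t v₁ q * conjWave ψ (t, q)) +
      ε * (z t q * conjWave ψ (t, q)) +
      (∫ s in (0 : ℝ)..t, propagator (t - s) (f s) q) * conjWave ψ (t, q)) =
      ε * (∫ q, propagator t v₁ q * conjWave ψ (t, q)) + ε * (∫ q, z t q * conjWave ψ (t, q)) +
      ∫ q, (∫ s in (0 : ℝ)..t, propagator (t - s) (f s) q) * conjWave ψ (t, q) := by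
    intro t
    have i1 : Integrable fun q => ε * (propagator t v₁ q * conjWave ψ (t, q)) :=
      (hslice c1 s1 t).const_mul ε
    have i2 : Integrable fun q => ε * (z t q * conjWave ψ (t, q)) := (hslice c2 s2 t).const_mul ε
    have i12 : Integrable fun q => ε * (propagator t v₁ q * conjWave ψ (t, q)) +
      ε * (z t q * conjWave ψ (t, q)) := i1.add i2
    have i3 : Integrable fun q => (∫ s in (0 : ℝ)..t, propagator (t - s) (f s) q) *
      conjWave ψ (t, q) := hslice c3 s3 t
    rw [integral_add i12 i3, integral_add i1 i2, integral_const_mul, integral_const_mul]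
  simp only [hsplit]
  have j1 : IntegrableOn (fun t => ε * ∫ q, propagator t v₁ q * conjWave ψ (t, q)) (Ioi 0) :=
    (hprod c1 s1).const_mul ε
  have j2 : IntegrableOn (fun t => ε * ∫ q, z t q * conjWave ψ (t, q)) (Ioi 0) :=
    (hprod c2 s2).const_mul ε
  have j12 : IntegrableOn (fun t => (ε * ∫ q, propagator t v₁ q * conjWave ψ (t, q)) +
    ε * ∫ q, z t q * conjWave ψ (t, q)) (Ioi 0) := j1.add j2
  have j3 : IntegrableOn (fun t => ∫ q, (∫ s in (0 : ℝ)..t, propagator (t - s) (f s) q) *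
    conjWave ψ (t, q)) (Ioi 0) := hprod c3 s3
  have k1 : Integrable fun q => ε * (v₁ q * ψ (0, q)) := by
    refine Integrable.const_mul (Continuous.integrable_of_hasCompactSupport ?_
      (hasCompactSupport_slice hψs 0).mul_left) ε
    have := hψ.continuous
    fun_prop
  have k2 : Integrable fun q => ε * (v₀ q * dirDeriv e₁ ψ (0, q)) := by
    refine Integrable.const_mul (Continuous.integrable_of_hasCompactSupport ?_
      (hasCompactSupport_slice (hasCompactSupport_dirDeriv hψs e₁) 0).mul_left) ε
    have := hψ₁.continuous
    fun_prop
  rw [integral_add j12 j3, integral_add j1 j2, integral_const_mul, integral_const_mul,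
    integral_propagator_mul_conjWave hψ hψs hv₁c, integral_deriv_mul_conjWave hψ hψs hv₀c hzc hzd,
    integral_duhamel_mul_conjWave hψ hψs hfc, integral_sub k1 k2, integral_const_mul,
    integral_const_mul]
  ring

/-! ### Time reversal and gluing -/

theorem IsTestFunction.comp_neg {φ : ℝ → ℍ → ℝ} (hφ : IsTestFunction φ) :
    IsTestFunction fun t z => φ (-t) z where
  smooth := hφ.smooth.comp (ContDiff.contDiffOn
    (by fun_prop : ContDiff ℝ ∞ fun q : ℝ × ℂ => (-q.1, q.2))) fun _ hq => hq
  compact := hφ.compact.comp_homeomorph ((Homeomorph.neg ℝ).prodCongr (Homeomorph.refl ℍ))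

theorem waveOp_comp_neg (φ : ℝ → ℍ → ℝ) (t : ℝ) (z : ℍ) :
    waveOp (fun t z => φ (-t) z) t z = waveOp φ (-t) z := by
  simp only [waveOp]
  rw [iteratedDeriv_comp_neg 2 (fun s => φ s z) t]
  norm_num

theorem IsAdmissibleData.neg {k : ℝ} {u₀ u₁ : ℍ → ℝ} (hu : IsAdmissibleData k u₀ u₁) :
    IsAdmissibleData k u₀ fun z => -u₁ z where
  c1 := hu.c1
  continuous := hu.continuous.neg
  bound z := by simpa only [abs_neg] using hu.bound z

theorem setIntegral_Iio_eq (f : ℝ → ℝ) : ∫ t in Iio (0 : ℝ), f t = ∫ t in Ioi (0 : ℝ), f (-t) := by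
  rw [integral_comp_neg_Ioi, neg_zero, integral_Iic_eq_integral_Iio]

/-- The backward half is the forward problem with reversed velocity, tested against reflected test
functions. The two halves agree at `t = 0`, where both equal `ε * u₀`, so the glued function is
continuous. -/
theorem isGlobalWeakSolution_glue {F : ℝ → ℝ} (hF : Continuous F) {u₀ u₁ : ℍ → ℝ} (hu₀ : IsC1 u₀)
    (hu₁ : Continuous u₁) {ε : ℝ} {u v : ℝ → ℝ × ℝ → ℝ} (hu : Continuous (Function.uncurry u))
    (hv : Continuous (Function.uncurry v))
    (hmu : ∀ t, 0 ≤ t → ∀ x, u t x = ε * evol t (fun q => u₁ (pt q)) x +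
      ε * diskIntegralDeriv t (fun q => u₀ (pt q)) x + duhamel (fun s q => F (u s q)) t x)
    (hmv : ∀ t, 0 ≤ t → ∀ x, v t x = ε * evol t (fun q => -u₁ (pt q)) x +
      ε * diskIntegralDeriv t (fun q => u₀ (pt q)) x + duhamel (fun s q => F (v s q)) t x) :
    IsGlobalWeakSolution F (fun z => ε * u₀ z) (fun z => ε * u₁ z)
      fun t z => if 0 ≤ t then u t (ptHomeo.symm z) else v (-t) (ptHomeo.symm z) := by
  have hu0 : ∀ x, u 0 x = ε * u₀ (pt x) := fun x => by
    rw [hmu 0 le_rfl, evol_zero, diskIntegralDeriv_zero, duhamel, intervalIntegral.integral_same]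
    ring
  have hv0 : ∀ x, v 0 x = ε * u₀ (pt x) := fun x => by
    rw [hmv 0 le_rfl, evol_zero, diskIntegralDeriv_zero, duhamel, intervalIntegral.integral_same]
    ring
  have hsymm := ptHomeo.symm.continuous
  refine ⟨?_, fun z => ?_, fun φ hφ => ?_, fun φ hφ => ?_⟩
  · refine Continuous.if_le (f := fun p : ℝ × ℍ => (0 : ℝ)) (g := fun p => p.1)
      (f' := fun p : ℝ × ℍ => u p.1 (ptHomeo.symm p.2))
      (g' := fun p => v (-p.1) (ptHomeo.symm p.2))
      (hu.comp (by fun_prop : Continuous fun p : ℝ × ℍ => (p.1, ptHomeo.symm p.2)))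
      (hv.comp (by fun_prop : Continuous fun p : ℝ × ℍ => (-p.1, ptHomeo.symm p.2)))
      continuous_const continuous_fst fun p hp => ?_
    rw [← hp, neg_zero, hu0, hv0]
  · simp only [le_refl, if_true]
    rw [hu0, pt_ptHomeo_symm]
  · have h := weak_form hu hF hu₀ hu₁ hmu hφ
    have e : ∀ t ∈ Ioi (0 : ℝ), ∀ z : ℍ,
        (if 0 ≤ t then u t (ptHomeo.symm z) else v (-t) (ptHomeo.symm z)) =
          u t (ptHomeo.symm z) := fun t ht z => if_pos (le_of_lt ht)
    refine Eq.trans ?_ (h.trans ?_)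
    · exact setIntegral_congr_fun measurableSet_Ioi fun t ht => by simp only [e t ht]
    · congr 1
      exact setIntegral_congr_fun measurableSet_Ioi fun t ht => by simp only [e t ht]
  · have h := weak_form (u₁ := fun z => -u₁ z) hv hF hu₀ hu₁.neg hmv hφ.comp_neg
    have e : ∀ t ∈ Ioi (0 : ℝ), ∀ z : ℍ,
        (if 0 ≤ -t then u (-t) (ptHomeo.symm z) else v (- -t) (ptHomeo.symm z)) =
          v t (ptHomeo.symm z) := fun t ht z => by
      rw [if_neg (by have := mem_Ioi.1 ht; linarith), neg_neg]
    rw [setIntegral_Iio_eq, setIntegral_Iio_eq]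
    simp only [waveOp_comp_neg] at h
    have h1 : ∫ z : ℍ, (ε * -u₁ z * φ (-0) z - ε * u₀ z * deriv (fun s => φ (-s) z) 0) =
        -∫ z : ℍ, (ε * u₁ z * φ 0 z - ε * u₀ z * deriv (fun s => φ s z) 0) := by
      rw [← integral_neg]
      refine integral_congr_ae (.of_forall fun z => ?_)
      simp only
      rw [deriv_comp_neg (fun s => φ s z) 0, neg_zero]
      ring
    rw [h1, ← sub_eq_add_neg] at h
    refine Eq.trans ?_ (h.trans ?_)
    · exact setIntegral_congr_fun measurableSet_Ioi fun t ht => by simp only [e t ht]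
    · congr 1
      exact setIntegral_congr_fun measurableSet_Ioi fun t ht => by simp only [e t ht]

end HypWave

end

theorem theorem1p1 (p : ℝ) (hp : 3 < p) (k : ℝ) (hk : 0 < k)
    (C δ : ℝ) (hδ : 0 < δ) (hδ1 : δ < 1) :
    ∃ h ∈ Set.Ioo 1 (p - 2), ∃ ε₀ > 0, ∃ N > 0,
      ∀ F : ℝ → ℝ, HypWave.IsLogNonlinearity p C δ F →
      ∀ u₀ u₁ : UpperHalfPlane → ℝ, HypWave.IsAdmissibleData k u₀ u₁ →
      ∀ ε : ℝ, |ε| < ε₀ →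
        ∃ u : ℝ → UpperHalfPlane → ℝ,
          HypWave.IsGlobalWeakSolution F (fun z => ε * u₀ z) (fun z => ε * u₁ z) u ∧
          ∀ t z, HypWave.weight h |t| (HypWave.radius z) * |u t z| ≤ N * |ε| := by
  obtain ⟨ε₀, hε₀, N, hN, H⟩ := HypWave.exists_mild_solution hp hk C hδ
  refine ⟨(p - 1) / 2, ⟨by linarith, by linarith⟩, ε₀, hε₀, N, hN, fun F hF u₀ u₁ hu ε hε => ?_⟩
  obtain ⟨u, huc, hub, hum⟩ := H F hF u₀ u₁ hu ε hε
  -- Negative times: `v` solves the problem with the opposite velocity, which satisfies the same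
  -- bound and hence has the same `ε₀` and `N`.
  obtain ⟨v, hvc, hvb, hvm⟩ := H F hF u₀ (fun z => -u₁ z) hu.neg ε hε
  refine ⟨_, HypWave.isGlobalWeakSolution_glue hF.c1.continuous hu.c1 hu.continuous huc hvc hum hvm,
    fun t z => ?_⟩
  by_cases ht : 0 ≤ t
  · have := hub t (HypWave.ptHomeo.symm z)
    rw [HypWave.pt_ptHomeo_symm] at this
    simpa only [if_pos ht] using this
  · have := hvb (-t) (HypWave.ptHomeo.symm z)
    rw [HypWave.pt_ptHomeo_symm, abs_neg] at this
    simpa only [if_neg ht] using this
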